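/- **Notation.** Work on $\mathbb{R}^3$ with $\widehat u(\xi)=\int e^{-ix\cdot\xi}u(x)\,dx$ and $\phi(D)u=\mathcal F^{-1}(\phi\,\widehat u)$. Fix a smooth radial cut-off $\psi:\mathbb{R}^3\to\mathbb{R}$, nonincreasing in $|\xi|$, supported in the ball of radius $\frac43$ and equal to $1$ near the ball of radius $\frac34$; put $\varphi(\xi)=\psi(\xi/2)-\psi(\xi)$, which is supported in $\{c_0\le|\xi|\le C_0\}$ with $c_0=\frac34$, $C_0=\frac83$, and $\dot\Delta_j=\varphi(2^{-j}D)$, $j\in\mathbb{Z}$. For $s\in\mathbb{R}$ let $$\|u\|_{\dot B^s_{p,q}}=\big\|\,2^{js}\|\dot\Delta_j u\|_{L^p}\big\|_{\ell^q(\mathbb{Z})},\qquad \||D|^d f\|_{\widetilde L^p_T\dot B^0_{r,q}}=\big\|\,\|\dot\Delta_j|D|^d f\|_{L^p([0,T),L^r)}\big\|_{\ell^q(\mathbb{Z})}.$$ Let $F>0$, $F\ne1$, $\nu>0$, $\varepsilon>0$. For $U=(v,\theta_U)=(v^1,v^2,v^3,\theta_U)$ let $\operatorname{div}U=\partial_1v^1+\partial_2v^2+\partial_3v^3$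 and let $\Omega(U)=\partial_1v^2-\partial_2v^1-F\partial_3\theta_U$ be its potential vorticity. Let $\mathbb{P}$ be the Leray projector acting on the first three components (identity on the fourth), and $$\mathcal A=\begin{pmatrix}0&-1&0&0\\1&0&0&0\\0&0&0&F^{-1}\\0&0&-F^{-1}&0\end{pmatrix}.$$ For $T\in[0,\infty]$ consider, on $[0,T)$, the linear system (with equal viscosity and diffusivity $\nu=\nu'$) $$\partial_t f-\nu\Delta f+\tfrac1\varepsilon\,\mathbb{P}\mathcal A f=F_{ext},\qquad f_{|t=0}=f_0, \tag{S}$$ where $f_0$, $f(t)$, $F_{ext}(t)$ are tempered distributions with values in $\mathbb{C}^4$ (in particular, in $\mathbb{R}^4$). As $\mathbb{P}$ is singular at $\xi=0$ and the norms above do not see $\xi=0$, (S) is understood in Fourier variables on $\mathbb{R}^3\setminus\{0\}$: there $\widehat f_0$, $\widehat f(t)$, $\widehat F_{ext}(t)$ are locally integrable functions, $\widehat f$ and $\widehat F_{ext}$ are integrable on $[0,t]\times K$ for all $t\in[0,T)$ and compact $K\subset\mathbb{R}^3\setminus\{0\}$, and for each $t\in[0,T)$ and a.e. $\xi$, $$\widehat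 f(t,\xi)=\widehat f_0(\xi)+\int_0^t\big(\mathbb{B}(\xi,\varepsilon)\widehat f(s,\xi)+\widehat F_{ext}(s,\xi)\big)ds,$$ $\mathbb{B}(\xi,\varepsilon)$ being the symbol of $\nu\Delta-\frac1\varepsilon\mathbb{P}\mathcal A$. **Proposition (Strichartz estimates when $\nu=\nu'$).** There is a constant $C_F>0$, depending only on $F$ (and on the fixed cut-off $\psi$), such that for all $\nu,\varepsilon>0$, $T\in[0,\infty]$, $d\in\mathbb{R}$, $r\in(4,\infty]$, $q\in[1,\infty]$, $$\theta\in\Big]0,\frac{\frac12-\frac1r}{1-\frac4r}\Big[\,\cap\,]0,1],\qquad p\in\Big[1,\frac{4}{\theta(1-\frac4r)}\Big],$$ the following holds. If $f$ solves (S) on $[0,T)$ with $f_0$ and (for a.e. $t$) $F_{ext}(t)$ both of zero divergence and zero potential vorticity, then $$\||D|^d f\|_{\widetilde L^p_T\dot B^0_{r,q}}\le C_F\,\max(c_0^{\,d},C_0^{\,d})\,\frac{C_{p,\theta,r}}{\nu^{\frac1p-\frac\theta4(1-\frac4r)}}\;\varepsilon^{\frac\theta4(1-\frac4r)}\Big(\|f_0\|_{\dot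 B^\sigma_{2,q}}+\int_0^T\|F_{ext}(\tau)\|_{\dot B^\sigma_{2,q}}\,d\tau\Big),$$ where $$\sigma=d+\frac32-\frac3r-\frac2p+\frac\theta2\Big(1-\frac4r\Big),$$ $$C_{p,\theta,r}=\Big[\frac2{c_0^2}\Big(\frac1p-\frac\theta4\big(1-\tfrac4r\big)\Big)\Big]^{\frac1p-\frac\theta4(1-\frac4r)}\;\frac{2^{\frac12(1-\frac2r-2\theta(1-\frac4r))}}{1-2^{-\frac12(1-\frac2r-2\theta(1-\frac4r))}}$$ (with $0^0=1$). The right-hand side may be infinite, in which case nothing is claimed. -/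

import Mathlib

open MeasureTheory Set Filter Topology FourierTransform LineDeriv
open scoped SchwartzMap ENNReal Matrix

noncomputable section

namespace PrimitiveStrichartz

/-- The physical (and frequency) space `ℝ³` with its Euclidean norm. -/
abbrev Space : Type := EuclideanSpace ℝ (Fin 3)

/-- The space of values `(v¹, v², v³, θ)`. -/
abbrev Val : Type := EuclideanSpace ℂ (Fin 4)

/-- Mathlib's Fourier transform is `∫ exp (-2πi x·ξ) u(x) dx`, so that the frequency variable of the
convention `∫ exp (-i x·ω) u(x) dx` (in which `∂_k` has symbol `i ω_k`) is `ω = 2π ξ`. All symbols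
below are written in the variable `ω`. -/
def angFreq (ξ : Space) : Space := (2 * Real.pi) • ξ

/-! ### Littlewood-Paley decomposition -/

/-- The lower radius `c₀ = 3/4` of the Littlewood-Paley annulus. -/
def lpInner : ℝ := 3 / 4

/-- The upper radius `C₀ = 8/3` of the Littlewood-Paley annulus. -/
def lpOuter : ℝ := 8 / 3

/-- `ψ` is a smooth radial nonincreasing cut-off, supported in the ball of radius `4/3` and equal to
`1` near the ball of radius `3/4`. (The field `antitone` contains radiality.) -/
structure IsLPCutoff (ψ : Space → ℝ) : Prop where
  smooth : ContDiff ℝ ((⊤ : ℕ∞) : WithTop ℕ∞) ψ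
  antitone : ∀ ω ω' : Space, ‖ω‖ ≤ ‖ω'‖ → ψ ω' ≤ ψ ω
  support : tsupport ψ ⊆ Metric.closedBall 0 (4 / 3)
  eq_one : ∀ᶠ ω in 𝓝ˢ (Metric.closedBall (0 : Space) (3 / 4)), ψ ω = 1

/-- `φ(ω) = ψ(ω/2) - ψ(ω)`. -/
def lpPhi (ψ : Space → ℝ) (ω : Space) : ℝ := ψ ((2 : ℝ)⁻¹ • ω) - ψ ω

/-- The dyadic block `Δ̇_j u = φ(2^{-j} D) u`. -/
def dyadicBlock (ψ : Space → ℝ) (j : ℤ) (u : 𝓢'(Space, Val)) : 𝓢'(Space, Val) :=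
  TemperedDistribution.fourierMultiplierCLM Val
    (fun ξ => ((lpPhi ψ ((2 : ℝ) ^ (-j) • angFreq ξ) : ℝ) : ℂ)) u

/-- The dyadic block `Δ̇_j |D|^d u = φ(2^{-j} D) |D|^d u`. As `φ` vanishes near the origin, its
symbol is smooth and compactly supported for every real `d`. -/
def dyadicBlockAbsD (ψ : Space → ℝ) (d : ℝ) (j : ℤ) (u : 𝓢'(Space, Val)) : 𝓢'(Space, Val) :=
  TemperedDistribution.fourierMultiplierCLM Val
    (fun ξ => ((lpPhi ψ ((2 : ℝ) ^ (-j) • angFreq ξ) * ‖angFreq ξ‖ ^ d : ℝ) : ℂ)) u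

/-- The `L^p` norm of a tempered distribution, equal to `∞` if it is not a function in `L^p`. -/
def distLpNorm (u : 𝓢'(Space, Val)) (p : ℝ≥0∞) : ℝ≥0∞ :=
  ⨅ (h : Space → Val) (_ : MemLp h p volume) (_ : ∀ χ : 𝓢(Space, ℂ), u χ = ∫ x, χ x • h x),
    eLpNorm h p volume

/-- The `ℓ^q(ℤ)` norm. -/
def lqNorm (q : ℝ≥0∞) (a : ℤ → ℝ≥0∞) : ℝ≥0∞ :=
  if q = ∞ then ⨆ j, a j else (∑' j, a j ^ q.toReal) ^ (1 / q.toReal)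

/-- The homogeneous Besov norm `‖u‖_{Ḃ^s_{p,q}}`. -/
def besovNorm (ψ : Space → ℝ) (s : ℝ) (p q : ℝ≥0∞) (u : 𝓢'(Space, Val)) : ℝ≥0∞ :=
  lqNorm q fun j => (2 : ℝ≥0∞) ^ ((j : ℝ) * s) * distLpNorm (dyadicBlock ψ j u) p

/-- The time interval `[0, T)`, where `0 ≤ T ≤ ∞`. -/
def timeInterval (T : ℝ≥0∞) : Set ℝ := {t | 0 ≤ t ∧ ENNReal.ofReal t < T}

/-- The norm `‖ |D|^d f ‖_{L̃^p_T Ḃ^s_{r,q}}`, that is the `ℓ^q` norm in `j` of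
`2^{js} ‖Δ̇_j |D|^d f‖_{L^p([0,T), L^r)}`. -/
def tildeBesovNormAbsD (ψ : Space → ℝ) (T : ℝ≥0∞) (d p s : ℝ) (r q : ℝ≥0∞)
    (f : ℝ → 𝓢'(Space, Val)) : ℝ≥0∞ :=
  lqNorm q fun j => (2 : ℝ≥0∞) ^ ((j : ℝ) * s) *
    (∫⁻ t in timeInterval T, distLpNorm (dyadicBlockAbsD ψ d j (f t)) r ^ p) ^ (1 / p)

/-! ### Divergence and potential vorticity -/

/-- The `k`-th vector of the canonical basis of `ℝ³`. -/
def basisVec (k : Fin 3) : Space := EuclideanSpace.single k 1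

/-- `div v = ∂₁ v¹ + ∂₂ v² + ∂₃ v³ = 0` in the sense of distributions, for `u = (v, θ)`. -/
def IsDivFree (u : 𝓢'(Space, Val)) : Prop :=
  ∀ χ : 𝓢(Space, ℂ),
    (∂_{basisVec 0} u) χ 0 + (∂_{basisVec 1} u) χ 1 + (∂_{basisVec 2} u) χ 2 = 0

/-- `Ω(u) = ∂₁ v² - ∂₂ v¹ - F ∂₃ θ = 0` in the sense of distributions, for `u = (v, θ)`. -/
def HasZeroPotentialVorticity (F : ℝ) (u : 𝓢'(Space, Val)) : Prop :=
  ∀ χ : 𝓢(Space, ℂ),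
    (∂_{basisVec 0} u) χ 1 - (∂_{basisVec 1} u) χ 0 - (F : ℂ) * (∂_{basisVec 2} u) χ 3 = 0

/-! ### The linear system -/

/-- The symbol of `L (v, θ) = (ν Δ v, ν' Δ θ)`. -/
def symbolL (ν ν' : ℝ) (ω : Space) : Matrix (Fin 4) (Fin 4) ℝ :=
  Matrix.diagonal ![-ν * ‖ω‖ ^ 2, -ν * ‖ω‖ ^ 2, -ν * ‖ω‖ ^ 2, -ν' * ‖ω‖ ^ 2]

/-- The symbol of the Leray projector `ℙ` (acting on the first three components). -/
def symbolLeray (ω : Space) : Matrix (Fin 4) (Fin 4) ℝ :=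
  1 - (‖ω‖ ^ 2)⁻¹ • Matrix.vecMulVec ![ω 0, ω 1, ω 2, 0] ![ω 0, ω 1, ω 2, 0]

/-- The skew-symmetric matrix `𝒜`. -/
def matrixA (F : ℝ) : Matrix (Fin 4) (Fin 4) ℝ :=
  !![0, -1, 0, 0;
     1, 0, 0, 0;
     0, 0, 0, F⁻¹;
     0, 0, -F⁻¹, 0]

/-- The symbol `𝔹(ω, ε)` of `L - (1/ε) ℙ 𝒜`. -/
def symbolB (F ν ν' ε : ℝ) (ω : Space) : Matrix (Fin 4) (Fin 4) ℝ :=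
  symbolL ν ν' ω - ε⁻¹ • (symbolLeray ω * matrixA F)

/-- A real `4 × 4` matrix applied to a vector of `ℂ⁴`. -/
def applyMat (M : Matrix (Fin 4) (Fin 4) ℝ) (z : Val) : Val :=
  WithLp.toLp 2 fun a => ∑ b, (M a b : ℂ) * z b

/-- Away from the zero frequency, the Fourier transform of the tempered distribution `u` is the
locally integrable function `g`. -/
def HasFourierDensity (u : 𝓢'(Space, Val)) (g : Space → Val) : Prop :=
  LocallyIntegrableOn g {0}ᶜ volume ∧
  ∀ η : 𝓢(Space, ℂ), HasCompactSupport η → (0 : Space) ∉ tsupport η →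
    (𝓕 u) η = ∫ ξ, η ξ • g ξ

/-- `f` solves `∂_t f - (L - (1/ε) ℙ 𝒜) f = Fext`, `f|_{t=0} = f₀` on `[0, T)`. The Fourier multiplier
`ℙ` is singular at the zero frequency, and homogeneous Besov norms do not see that frequency; so the
equation is read, in the integrated form, for the spatial Fourier transforms `g₀, g, G` of
`f₀, f, Fext` on `ℝ³ \ {0}`, which are required to be locally integrable functions. -/
def IsSolution (F ν ν' ε : ℝ) (T : ℝ≥0∞) (f₀ : 𝓢'(Space, Val)) (Fext f : ℝ → 𝓢'(Space, Val)) :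
    Prop :=
  ∃ (g₀ : Space → Val) (g G : ℝ → Space → Val),
    HasFourierDensity f₀ g₀ ∧
    (∀ t ∈ timeInterval T, HasFourierDensity (f t) (g t)) ∧
    (∀ᵐ t ∂volume.restrict (timeInterval T), HasFourierDensity (Fext t) (G t)) ∧
    (∀ t ∈ timeInterval T, ∀ K : Set Space, IsCompact K → (0 : Space) ∉ K →
      IntegrableOn (Function.uncurry g) (Icc 0 t ×ˢ K) (volume.prod volume) ∧
      IntegrableOn (Function.uncurry G) (Icc 0 t ×ˢ K) (volume.prod volume)) ∧
    ∀ t ∈ timeInterval T, ∀ᵐ ξ : Space,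
      g t ξ = g₀ ξ +
        ∫ s in (0 : ℝ)..t, (applyMat (symbolB F ν ν' ε (angFreq ξ)) (g s ξ) + G s ξ)

/-! ### The constants of the estimate -/

/-- `(θ/4) (1 - 4/r)`, for `r ∈ (4, ∞]`. -/
def dispExponent (θ : ℝ) (r : ℝ≥0∞) : ℝ := θ / 4 * (1 - 4 * (r⁻¹).toReal)

/-- `1 - 2/r - 2 θ (1 - 4/r)`. -/
def vertExponent (θ : ℝ) (r : ℝ≥0∞) : ℝ :=
  1 - 2 * (r⁻¹).toReal - 2 * θ * (1 - 4 * (r⁻¹).toReal)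

/-- The constant `C_{p,θ,r}`. -/
def strichartzConst (p θ : ℝ) (r : ℝ≥0∞) : ℝ :=
  (2 / lpInner ^ 2 * (1 / p - dispExponent θ r)) ^ (1 / p - dispExponent θ r) *
    ((2 : ℝ) ^ (1 / 2 * vertExponent θ r) / (1 - (2 : ℝ) ^ (-(1 / 2 * vertExponent θ r))))

/-- The regularity index `σ = d + 3/2 - 3/r - 2/p + (θ/2) (1 - 4/r)`. -/
def regIndex (d p θ : ℝ) (r : ℝ≥0∞) : ℝ :=
  d + 3 / 2 - 3 * (r⁻¹).toReal - 2 / p + θ / 2 * (1 - 4 * (r⁻¹).toReal)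

end PrimitiveStrichartz

end

noncomputable section

namespace PrimitiveStrichartz

/-! ### The phase and its oscillation in the vertical variable -/

/-! On fields of zero divergence and zero potential vorticity, the symbol of `ℙ𝒜` squares to minus
the square of the scalar `phase F ω` (`coriolis_coriolis`). As viscosity and diffusivity agree, the
heat part is scalar too, so the propagator `flow` is a heat factor times a combination of the two
waves exp(± i t phase / ε). Duhamel's formula then reduces the problem to scalar oscillatory
integrals on one dyadic annulus. The phase is homogeneous of degree 0, so rescaling that annulus to
unit size only turns ν into ν 4^j and produces powers of 2^j (`blockEvol_apply_eq`).

The core is a dispersive bound: the kernel of the unit-scale evolution is O(|t|^(-1/4)) uniformly in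
x (`exists_norm_dispKernel_le`). It combines two estimates. Integration by parts in the vertical
frequency, where for nonzero horizontal frequency the phase is critical only at 0, gives √((1 +
|x₃|)/|t|); here F ≠ 1 is essential, since the phase is constant when F = 1. Averaging over
dilations, which do not change the phase, gives |x₃|^(-1/2) for every t. The two bounds meet at |x₃|
= |t|^(1/2).

A TT* argument converts this decay into an L^P bound in time of the supremum in space
(`exists_lintegral_iSup_evol_le`). The kernel of TT* enters Young's inequality to the power P/2, and
|t|^(-P/8) is integrable at infinity exactly for P > 8. The supremum is linearized by a measurable
path t ↦ x(t), which is harmless because the kernel bound is uniform in x(t) - x(s). The viscous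
factors at times t and s multiply instead of cancelling; they are absorbed into the amplitude, whose
C¹ size is bounded uniformly in the damping (`exists_isAmplitude_dampedCutoff`).

For one block (`exists_lintegral_blockEvol_le`), L^r is interpolated between L² and L^∞, both of
which keep a factor exp(-ν 4^j t/8). Hölder in time with 1/p = β + δ, where δ is `dispExponent θ r`,
gives (β/(ν 4^j))^β from the exponential, up to a constant, and ε^δ from the waves, used with P = (1
- 2/r)/δ. The requirement P > 8 is positivity of `vertExponent`, that is, the upper bound on θ.
Minkowski's inequality carries this through the Duhamel integral and through the ℓ^q sum over
blocks, and the powers of 2^j add up to σ. -/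

/-- The phase `√((s + F² z²) / (s + z²)) / F`, as a function of `s = ω₁² + ω₂²` and `z = ω₃`. -/
def phaseAux (F s z : ℝ) : ℝ := √((s + F ^ 2 * z ^ 2) / (s + z ^ 2)) / F

/-- The phase `|ω|_F / (F |ω|)` of the oscillating modes. -/
def phase (F : ℝ) (ω : Space) : ℝ := phaseAux F (ω 0 ^ 2 + ω 1 ^ 2) (ω 2)

/-- The ratio is the convex combination of 1 and F² with weights s/(s + z²) and z²/(s + z²). -/
lemma phaseAux_ratio_bounds {F s z : ℝ} (hs : 0 ≤ s) (hD : 0 < s + z ^ 2) :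
    min 1 (F ^ 2) ≤ (s + F ^ 2 * z ^ 2) / (s + z ^ 2) ∧
      (s + F ^ 2 * z ^ 2) / (s + z ^ 2) ≤ max 1 (F ^ 2) := by
  have hz := sq_nonneg z
  refine ⟨?_, ?_⟩
  · rw [le_div_iff₀ hD]
    nlinarith [min_le_left 1 (F ^ 2), min_le_right 1 (F ^ 2)]
  · rw [div_le_iff₀ hD]
    nlinarith [le_max_left 1 (F ^ 2), le_max_right 1 (F ^ 2)]

lemma phaseAux_bounds {F s z : ℝ} (hF : 0 < F) (hs : 0 ≤ s) (hD : 0 < s + z ^ 2) :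
    min 1 F / F ≤ phaseAux F s z ∧ phaseAux F s z ≤ max 1 F / F := by
  obtain ⟨h1, h2⟩ := phaseAux_ratio_bounds (F := F) hs hD
  unfold phaseAux
  refine ⟨?_, ?_⟩
  · gcongr
    apply Real.le_sqrt_of_sq_le
    refine le_trans ?_ h1
    rcases le_total 1 F with h | h
    · rw [min_eq_left h, min_eq_left (by nlinarith)]; norm_num
    · rw [min_eq_right h, min_eq_right (by nlinarith)]
  · gcongr
    apply Real.sqrt_le_iff.2 ⟨by positivity, h2.trans ?_⟩
    rcases le_total 1 F with h | h
    · rw [max_eq_right h, max_eq_right (by nlinarith)]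
    · rw [max_eq_left h, max_eq_left (by nlinarith)]; norm_num

lemma phaseAux_pos {F s : ℝ} (hF : 0 < F) (hs : 0 < s) (z : ℝ) : 0 < phaseAux F s z :=
  lt_of_lt_of_le (by positivity) (phaseAux_bounds hF hs.le (by positivity)).1

/-- The form of the derivative matters: for F ≠ 1 the only critical point is z = 0, and dividing by
the derivative costs just 1/z and the harmless weight (s + z²)² times the phase, besides constants
and 1/s. -/
lemma hasDerivAt_phaseAux {F s : ℝ} (hF : 0 < F) (hs : 0 < s) (z : ℝ) :
    HasDerivAt (phaseAux F s)
      ((F ^ 2 - 1) / F ^ 2 * (z * s) / ((s + z ^ 2) ^ 2 * phaseAux F s z)) z := by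
  have hD : 0 < s + z ^ 2 := by positivity
  have hpos : 0 < (s + F ^ 2 * z ^ 2) / (s + z ^ 2) := by positivity
  have h1 : HasDerivAt (fun z : ℝ => (s + F ^ 2 * z ^ 2) / (s + z ^ 2))
      (((F ^ 2 * (2 * z)) * (s + z ^ 2) - (s + F ^ 2 * z ^ 2) * (2 * z)) / (s + z ^ 2) ^ 2) z := by
    have hn : HasDerivAt (fun z : ℝ => s + F ^ 2 * z ^ 2) (F ^ 2 * (2 * z)) z := by
      simpa using ((hasDerivAt_pow 2 z).const_mul (F ^ 2)).const_add s
    have hd : HasDerivAt (fun z : ℝ => s + z ^ 2) (2 * z) z := by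
      simpa using (hasDerivAt_pow 2 z).const_add s
    exact hn.div hd hD.ne'
  have h2 := (h1.sqrt hpos.ne').div_const F
  refine h2.congr_deriv ?_
  have hsq : √((s + F ^ 2 * z ^ 2) / (s + z ^ 2)) ≠ 0 := (Real.sqrt_pos.2 hpos).ne'
  unfold phaseAux
  field_simp
  ring

lemma integral_inv_sq_add_sq {δ : ℝ} (hδ : 0 < δ) :
    Integrable (fun z : ℝ => (δ ^ 2 + z ^ 2)⁻¹) ∧ ∫ z : ℝ, (δ ^ 2 + z ^ 2)⁻¹ = Real.pi / δ := by
  have h0 : (fun z : ℝ => (δ ^ 2 + z ^ 2)⁻¹) = fun z => (δ ^ 2)⁻¹ * (1 + (δ⁻¹ * z) ^ 2)⁻¹ := by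
    ext z
    have : δ ^ 2 + z ^ 2 = δ ^ 2 * (1 + (δ⁻¹ * z) ^ 2) := by field_simp
    rw [this, mul_inv]
  rw [h0]
  refine ⟨((integrable_comp_mul_left_iff (fun x : ℝ => (1 + x ^ 2)⁻¹) (inv_ne_zero hδ.ne')).2
    integrable_inv_one_add_sq).const_mul _, ?_⟩
  rw [integral_const_mul, Measure.integral_comp_mul_left (fun x : ℝ => (1 + x ^ 2)⁻¹),
    integral_univ_inv_one_add_sq]
  rw [inv_inv, abs_of_pos hδ]
  simp
  field_simp

/-- The constant of the vertical oscillation estimate. -/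
def vertConst (F R : ℝ) : ℝ :=
  Real.pi + (4 * R ^ 4 * (max 1 F / F) + (8 * R ^ 3 * (max 1 F / F) +
    |(F ^ 2 - 1) / F ^ 2| * R ^ 3 / (min 1 F / F))) * (2 * R + Real.pi) / |(F ^ 2 - 1) / F ^ 2|

lemma vertConst_nonneg {F R : ℝ} (hF : 0 < F) (hR : 0 ≤ R) : 0 ≤ vertConst F R := by
  unfold vertConst
  have := Real.pi_pos
  positivity

-- Integration by parts away from the critical point z = 0, with the region |z| < δ removed
-- smoothly: the partition 1 = δ²/(δ² + z²) + z²/(δ² + z²) replaces a cut-off. The first part has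
-- integral O(δ). In the second, z² cancels the zero of the derivative of the phase. The parameter X
-- measures how fast the amplitude itself oscillates.
set_option maxHeartbeats 1000000 in
lemma norm_integral_exp_phaseAux_le {F R : ℝ} (hF : 0 < F) (hF1 : F ≠ 1) (hR : 0 < R)
    {s t X A : ℝ} (hs : 0 < s) (hsR : s ≤ R ^ 2) (ht : t ≠ 0) (hX : 0 ≤ X) (hA : 0 ≤ A)
    {b b' : ℝ → ℂ} (hb : ∀ z, HasDerivAt b (b' z) z) (hb'c : Continuous b')
    (hbA : ∀ z, ‖b z‖ ≤ A) (hb'A : ∀ z, ‖b' z‖ ≤ A * (1 + X))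
    (hb0 : ∀ z, R < |z| → b z = 0) (hb'0 : ∀ z, R < |z| → b' z = 0) :
    ‖∫ z, Complex.exp ((t * phaseAux F s z : ℝ) * Complex.I) * b z‖ ≤
      vertConst F R * A * √((1 + X) / (|t| * s)) := by
  set κ : ℝ := (F ^ 2 - 1) / F ^ 2 with hκ
  have hκ0 : κ ≠ 0 := by
    rw [hκ]
    have : F ^ 2 - 1 ≠ 0 := by
      intro h
      have : (F - 1) * (F + 1) = 0 := by linarith
      rcases mul_eq_zero.1 this with h | h
      · exact hF1 (by linarith)
      · linarith
    positivity
  have ht' : 0 < |t| := abs_pos.2 ht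
  -- This choice balances the two parts: the mass O(δ) near the critical point against the
  -- integrated remainder of size (1 + X)/(|t| s δ), which equals δ.
  set δ : ℝ := √((1 + X) / (|t| * s)) with hδ
  have hδ0 : 0 < δ := Real.sqrt_pos.2 (by positivity)
  have hδ2 : δ ^ 2 = (1 + X) / (|t| * s) := Real.sq_sqrt (by positivity)
  set a : ℝ → ℝ := phaseAux F s with ha
  have ha0 : ∀ z, 0 < a z := phaseAux_pos hF hs
  set hi := max 1 F / F
  set lo := min 1 F / F
  have hlo : 0 < lo := by positivity
  have hda : ∀ z, HasDerivAt a (κ * (z * s) / ((s + z ^ 2) ^ 2 * a z)) z :=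
    hasDerivAt_phaseAux hF hs
  have hac : Continuous a := continuous_iff_continuousAt.2 fun z => (hda z).continuousAt
  set E : ℝ → ℂ := fun z => Complex.exp ((t * a z : ℝ) * Complex.I) with hE
  have hEn : ∀ z, ‖E z‖ = 1 := fun z => Complex.norm_exp_ofReal_mul_I _
  have hEc : Continuous E := by fun_prop
  have hdE : ∀ z, HasDerivAt E
      (E z * ((t * (κ * (z * s) / ((s + z ^ 2) ^ 2 * a z)) : ℝ) * Complex.I)) z := fun z =>
    ((((hda z).const_mul t).ofReal_comp).mul_const Complex.I).cexp
  -- the auxiliary weights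
  set W : ℝ → ℝ := fun z => (s + z ^ 2) ^ 2 * a z with hW
  set W' : ℝ → ℝ := fun z => 4 * z * (s + z ^ 2) * a z + κ * (z * s) / a z with hW'
  have hdW : ∀ z, HasDerivAt W (W' z) z := fun z => by
    have h1 : HasDerivAt (fun z : ℝ => (s + z ^ 2) ^ 2) (2 * (s + z ^ 2) * (2 * z)) z := by
      have hd : HasDerivAt (fun z : ℝ => s + z ^ 2) (2 * z) z := by
        simpa using (hasDerivAt_pow 2 z).const_add s
      exact (hd.pow 2).congr_deriv (by simp)
    refine (h1.mul (hda z)).congr_deriv ?_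
    have h2 : (s + z ^ 2) ≠ 0 := by positivity
    have h3 := (ha0 z).ne'
    simp only [hW']
    field_simp
    ring
  have hW'c : Continuous W' := by
    have : ∀ z, a z ≠ 0 := fun z => (ha0 z).ne'
    simp only [hW']
    fun_prop (disch := assumption)
  -- A regularization of 1/z at scale δ. The product c q W is z²/(δ² + z²) divided by the derivative
  -- of the exponent. Since q' is dominated by (δ² + z²)⁻¹, its integral is at most π/δ rather than
  -- of order δ⁻² times a length.
  set q : ℝ → ℝ := fun z => z * (δ ^ 2 + z ^ 2)⁻¹ with hq
  set q' : ℝ → ℝ := fun z => (δ ^ 2 - z ^ 2) * ((δ ^ 2 + z ^ 2)⁻¹) ^ 2 with hq'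
  have hden : ∀ z : ℝ, 0 < δ ^ 2 + z ^ 2 := fun z => by positivity
  have hdq : ∀ z, HasDerivAt q (q' z) z := fun z => by
    have hd : HasDerivAt (fun z : ℝ => δ ^ 2 + z ^ 2) (2 * z) z := by
      simpa using (hasDerivAt_pow 2 z).const_add (δ ^ 2)
    have hinv : HasDerivAt (fun z : ℝ => (δ ^ 2 + z ^ 2)⁻¹)
        (-(2 * z) / (δ ^ 2 + z ^ 2) ^ 2) z := hd.inv (hden z).ne'
    refine ((hasDerivAt_id z).mul hinv).congr_deriv ?_
    have := (hden z).ne'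
    simp only [hq', id]
    field_simp
    ring
  have hq'c : Continuous q' := by
    have : ∀ z : ℝ, δ ^ 2 + z ^ 2 ≠ 0 := fun z => (hden z).ne'
    simp only [hq']
    fun_prop (disch := assumption)
  have hqb : ∀ z, |q z| ≤ 1 / δ := fun z => by
    rw [hq]
    simp only
    rw [← div_eq_mul_inv, abs_div, abs_of_pos (hden z), div_le_div_iff₀ (hden z) hδ0]
    nlinarith [sq_nonneg (δ - |z|), sq_abs z, abs_nonneg z]
  have hq'b : ∀ z, |q' z| ≤ (δ ^ 2 + z ^ 2)⁻¹ := fun z => by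
    have h1 : |δ ^ 2 - z ^ 2| ≤ δ ^ 2 + z ^ 2 :=
      abs_le.2 ⟨by nlinarith [sq_nonneg δ], by nlinarith [sq_nonneg z]⟩
    rw [hq']
    simp only
    rw [abs_mul, abs_of_nonneg (sq_nonneg (δ ^ 2 + z ^ 2)⁻¹)]
    calc _ ≤ (δ ^ 2 + z ^ 2) * ((δ ^ 2 + z ^ 2)⁻¹) ^ 2 := by gcongr
      _ = _ := by have := (hden z).ne'; field_simp
  set c : ℂ := ((t * κ * s : ℝ) * Complex.I)⁻¹ with hc
  have hcn : ‖c‖ = 1 / (|t| * |κ| * s) := by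
    rw [hc, norm_inv, norm_mul, Complex.norm_I, mul_one, Complex.norm_real, Real.norm_eq_abs,
      abs_mul, abs_mul, abs_of_pos hs, one_div]
  set Q : ℝ → ℂ := fun z => c * (b z * ((q z * W z : ℝ) : ℂ)) with hQ
  set Q' : ℝ → ℂ := fun z =>
    c * (b' z * ((q z * W z : ℝ) : ℂ) + b z * ((q' z * W z + q z * W' z : ℝ) : ℂ)) with hQ'
  have hdQ : ∀ z, HasDerivAt Q (Q' z) z := fun z =>
    ((hb z).mul ((hdq z).mul (hdW z)).ofReal_comp).const_mul c
  have hbc : Continuous b := continuous_iff_continuousAt.2 fun z => (hb z).continuousAt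
  have hqc : Continuous q := continuous_iff_continuousAt.2 fun z => (hdq z).continuousAt
  have hWc : Continuous W := continuous_iff_continuousAt.2 fun z => (hdW z).continuousAt
  have hcs : ∀ f : ℝ → ℂ, Continuous f → (∀ z, R < |z| → f z = 0) → Integrable f := by
    intro f hf h0
    refine hf.integrable_of_hasCompactSupport ?_
    refine HasCompactSupport.intro (isCompact_Icc (a := -R) (b := R)) fun z hz => h0 z ?_
    by_contra h
    exact hz (abs_le.1 (not_lt.1 h))
  have hQ'c : Continuous Q' := by fun_prop
  have hQc : Continuous Q := by fun_prop
  have hQ'0 : ∀ z, R < |z| → Q' z = 0 := fun z hz => by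
    simp only [hQ', hb0 z hz, hb'0 z hz]; simp
  have hQ0 : ∀ z, R < |z| → Q z = 0 := fun z hz => by simp only [hQ, hb0 z hz]; simp
  -- the identity behind the integration by parts
  set B : ℝ → ℂ := fun z => E z * b z * ((δ ^ 2 * (δ ^ 2 + z ^ 2)⁻¹ : ℝ) : ℂ) with hB
  have hBc : Continuous B := by
    have : ∀ z : ℝ, δ ^ 2 + z ^ 2 ≠ 0 := fun z => (hden z).ne'
    have h1 : Continuous fun z : ℝ => δ ^ 2 * (δ ^ 2 + z ^ 2)⁻¹ := by
      fun_prop (disch := assumption)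
    fun_prop
  have hBi : Integrable B := hcs B hBc fun z hz => by simp only [hB, hb0 z hz]; simp
  set E' : ℝ → ℂ := fun z =>
    E z * ((t * (κ * (z * s) / ((s + z ^ 2) ^ 2 * a z)) : ℝ) * Complex.I) with hE'
  have hsplit : ∀ z, E z * b z = B z + E' z * Q z := fun z => by
    have h1 : (t * (κ * (z * s) / ((s + z ^ 2) ^ 2 * a z))) * (q z * W z) =
        (t * κ * s) * (z ^ 2 * (δ ^ 2 + z ^ 2)⁻¹) := by
      have h2 : (s + z ^ 2) ≠ 0 := by positivity
      have h3 := (ha0 z).ne'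
      simp only [hq, hW]
      field_simp
    have h2 : E' z * Q z = E z * b z * c * Complex.I *
        (((t * (κ * (z * s) / ((s + z ^ 2) ^ 2 * a z))) * (q z * W z) : ℝ) : ℂ) := by
      simp only [hE', hQ]; push_cast; ring
    have h3 : (c * Complex.I) * ((t * κ * s : ℝ) : ℂ) = 1 := by
      have : ((t * κ * s : ℝ) : ℂ) ≠ 0 := by
        exact_mod_cast mul_ne_zero (mul_ne_zero ht hκ0) hs.ne'
      rw [hc]
      field_simp
    have h4 : δ ^ 2 * (δ ^ 2 + z ^ 2)⁻¹ + z ^ 2 * (δ ^ 2 + z ^ 2)⁻¹ = 1 := by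
      have := (hden z).ne'
      field_simp
    rw [h2, h1]
    calc E z * b z = E z * b z * ((δ ^ 2 * (δ ^ 2 + z ^ 2)⁻¹ +
          z ^ 2 * (δ ^ 2 + z ^ 2)⁻¹ : ℝ) : ℂ) := by rw [h4]; simp
      _ = B z + E z * b z * ((c * Complex.I) * ((t * κ * s : ℝ) : ℂ)) *
          ((z ^ 2 * (δ ^ 2 + z ^ 2)⁻¹ : ℝ) : ℂ) := by rw [h3]; simp only [hB]; push_cast; ring
      _ = _ := by push_cast; ring
  have hE'c : Continuous E' := by
    have : ∀ z : ℝ, (s + z ^ 2) ^ 2 * a z ≠ 0 := fun z => by have := (ha0 z).ne'; positivity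
    have h1 : Continuous fun z : ℝ => t * (κ * (z * s) / ((s + z ^ 2) ^ 2 * a z)) := by
      fun_prop (disch := assumption)
    fun_prop
  have hi1 : Integrable fun z => E' z * Q z := hcs _ (hE'c.mul hQc) fun z hz => by simp [hQ0 z hz]
  have hi2 : Integrable fun z => E z * Q' z := hcs _ (hEc.mul hQ'c) fun z hz => by simp [hQ'0 z hz]
  have hi3 : Integrable fun z => E z * Q z := hcs _ (hEc.mul hQc) fun z hz => by simp [hQ0 z hz]
  have hibp : ∫ z, (E' z * Q z + E z * Q' z) = 0 :=
    integral_eq_zero_of_hasDerivAt_of_integrable (fun z => (hdE z).mul (hdQ z)) (hi1.add hi2) hi3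
  have hmain : ∫ z, E z * b z = ∫ z, (B z - E z * Q' z) := by
    rw [integral_add hi1 hi2] at hibp
    rw [integral_sub hBi hi2, integral_congr_ae (ae_of_all _ hsplit), integral_add hBi hi1]
    linear_combination hibp
  -- the bounds
  set w : ℝ := 4 * R ^ 4 * hi + (8 * R ^ 3 * hi + |κ| * R ^ 3 / lo) with hw
  have hhi : 0 ≤ hi := by positivity
  have hw0 : 0 ≤ w := by positivity
  have hWb : ∀ z, |z| ≤ R → |W z| ≤ 4 * R ^ 4 * hi ∧ |W' z| ≤ 8 * R ^ 3 * hi + |κ| * R ^ 3 / lo := by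
    intro z hz
    have hz2 : z ^ 2 ≤ R ^ 2 := sq_le_sq' (by linarith [abs_le.1 hz]) (abs_le.1 hz).2
    have hD : s + z ^ 2 ≤ 2 * R ^ 2 := by linarith
    have hD0 : 0 ≤ s + z ^ 2 := by positivity
    have ha1 : a z ≤ hi := (phaseAux_bounds hF hs.le (by positivity)).2
    have ha2 : lo ≤ a z := (phaseAux_bounds hF hs.le (by positivity)).1
    have ha3 := ha0 z
    refine ⟨?_, ?_⟩
    · simp only [hW]
      rw [abs_of_nonneg (by positivity)]
      calc _ ≤ (2 * R ^ 2) ^ 2 * hi := by gcongr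
        _ = _ := by ring
    · simp only [hW']
      refine (abs_add_le _ _).trans ?_
      have e1 : |4 * z * (s + z ^ 2) * a z| = 4 * |z| * (s + z ^ 2) * a z := by
        rw [abs_mul, abs_mul, abs_mul, abs_of_pos ha3, abs_of_nonneg hD0]; norm_num
      have e2 : |κ * (z * s) / a z| = |κ| * (|z| * s) / a z := by
        rw [abs_div, abs_mul, abs_mul, abs_of_pos ha3, abs_of_pos hs]
      rw [e1, e2]
      have i1 : 4 * |z| * (s + z ^ 2) * a z ≤ 4 * R * (2 * R ^ 2) * hi := by gcongr
      have i2 : |κ| * (|z| * s) / a z ≤ |κ| * (R * R ^ 2) / lo := by gcongr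
      calc _ ≤ 4 * R * (2 * R ^ 2) * hi + |κ| * (R * R ^ 2) / lo := add_le_add i1 i2
        _ = _ := by ring
  obtain ⟨hgi, hgint⟩ := integral_inv_sq_add_sq hδ0
  set G : ℝ → ℝ := fun z => (A * δ ^ 2 + ‖c‖ * A * w) * (δ ^ 2 + z ^ 2)⁻¹ +
    (Icc (-R) R).indicator (fun _ => ‖c‖ * A * w * (1 + X) / δ) z with hG
  have hGle : ∀ z, ‖B z - E z * Q' z‖ ≤ G z := by
    intro z
    have hinv : 0 < (δ ^ 2 + z ^ 2)⁻¹ := inv_pos.2 (hden z)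
    by_cases hz : |z| ≤ R
    · obtain ⟨w1, w2⟩ := hWb z hz
      have w1' : |W z| ≤ w := w1.trans (by rw [hw]; linarith [show 0 ≤ 8 * R ^ 3 * hi + |κ| * R ^ 3 / lo by positivity])
      have hmem : z ∈ Icc (-R) R := abs_le.1 hz
      have hBn : ‖B z‖ ≤ A * δ ^ 2 * (δ ^ 2 + z ^ 2)⁻¹ := by
        simp only [hB]
        rw [norm_mul, norm_mul, hEn, one_mul, Complex.norm_real, Real.norm_eq_abs,
          abs_of_nonneg (by positivity), mul_assoc]
        gcongr
        exact hbA z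
      have hQn : ‖E z * Q' z‖ ≤ ‖c‖ * A * w * (δ ^ 2 + z ^ 2)⁻¹ + ‖c‖ * A * w * (1 + X) / δ := by
        rw [norm_mul, hEn, one_mul]
        simp only [hQ']
        rw [norm_mul]
        have n1 : ‖b' z * ((q z * W z : ℝ) : ℂ)‖ ≤ A * (1 + X) * (1 / δ * (4 * R ^ 4 * hi)) := by
          rw [norm_mul, Complex.norm_real, Real.norm_eq_abs, abs_mul]
          gcongr
          · exact hb'A z
          · exact hqb z
        have n2 : ‖b z * ((q' z * W z + q z * W' z : ℝ) : ℂ)‖ ≤ A * ((δ ^ 2 + z ^ 2)⁻¹ * w +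
            1 / δ * (8 * R ^ 3 * hi + |κ| * R ^ 3 / lo)) := by
          rw [norm_mul, Complex.norm_real, Real.norm_eq_abs]
          gcongr
          · exact hbA z
          · refine (abs_add_le _ _).trans ?_
            rw [abs_mul (q' z), abs_mul (q z)]
            gcongr
            · exact hq'b z
            · exact hqb z
        have n3 : A * (1 / δ * (8 * R ^ 3 * hi + |κ| * R ^ 3 / lo)) ≤
            A * (1 + X) * (1 / δ * (8 * R ^ 3 * hi + |κ| * R ^ 3 / lo)) := by
          rw [mul_assoc A (1 + X)]
          refine mul_le_mul_of_nonneg_left ?_ hA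
          exact le_mul_of_one_le_left (by positivity) (by linarith)
        calc _ ≤ ‖c‖ * (A * (1 + X) * (1 / δ * (4 * R ^ 4 * hi)) + (A * ((δ ^ 2 + z ^ 2)⁻¹ * w) +
            A * (1 + X) * (1 / δ * (8 * R ^ 3 * hi + |κ| * R ^ 3 / lo)))) := by
              gcongr
              refine (norm_add_le _ _).trans (add_le_add n1 (n2.trans ?_))
              rw [mul_add]
              linarith
          _ = _ := by rw [hw]; ring
      simp only [hG, indicator_of_mem hmem]
      calc _ ≤ _ := norm_sub_le _ _
        _ ≤ _ := add_le_add hBn hQn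
        _ = _ := by ring
    · rw [not_le] at hz
      have h1 : B z = 0 := by simp only [hB, hb0 z hz]; simp
      rw [h1, hQ'0 z hz]
      simp only [hG, mul_zero, sub_zero, norm_zero]
      refine add_nonneg (by positivity) (indicator_nonneg (fun _ _ => by positivity) _)
  have hGi : Integrable G := by
    refine (hgi.const_mul _).add ?_
    exact (integrable_indicator_iff measurableSet_Icc).2 (integrableOn_const (by simp))
  calc ‖∫ z, E z * b z‖ = ‖∫ z, (B z - E z * Q' z)‖ := by rw [hmain]
    _ ≤ ∫ z, G z := norm_integral_le_of_norm_le hGi (ae_of_all _ hGle)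
    _ = (A * δ ^ 2 + ‖c‖ * A * w) * (Real.pi / δ) + (2 * R) * (‖c‖ * A * w * (1 + X) / δ) := by
      simp only [hG]
      rw [integral_add (hgi.const_mul _) ((integrable_indicator_iff measurableSet_Icc).2
        (integrableOn_const (by simp))), integral_const_mul, hgint,
        integral_indicator measurableSet_Icc, setIntegral_const, Measure.real, Real.volume_Icc,
        ENNReal.toReal_ofReal (by linarith), smul_eq_mul]
      ring
    _ ≤ A * δ * Real.pi + (‖c‖ * A * w * (1 + X) / δ) * (2 * R + Real.pi) := by
      have h1 : A * δ ^ 2 * (Real.pi / δ) = A * δ * Real.pi := by field_simp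
      have h2 : ‖c‖ * A * w * (Real.pi / δ) ≤ ‖c‖ * A * w * (1 + X) / δ * Real.pi := by
        have : 0 ≤ ‖c‖ * A * w * (Real.pi / δ) := by have := Real.pi_pos; positivity
        calc _ ≤ (‖c‖ * A * w * (Real.pi / δ)) * (1 + X) :=
              le_mul_of_one_le_right this (by linarith)
          _ = _ := by ring
      linarith
    _ = _ := by
      have h1 : ‖c‖ * (1 + X) / δ = δ / |κ| := by
        rw [hcn]
        have h2 : (1 + X) = δ ^ 2 * (|t| * s) := by rw [hδ2]; field_simp
        have h3 : |κ| ≠ 0 := abs_ne_zero.2 hκ0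
        rw [h2]
        field_simp
      have h4 : ‖c‖ * A * w * (1 + X) / δ = A * w * (‖c‖ * (1 + X) / δ) := by ring
      rw [h4, h1, vertConst, ← hw]
      ring

/-! ### Horizontal and vertical coordinates -/

/-- The splitting of `ℝ³` into horizontal and vertical variables. -/
def splitEquiv : Space ≃ᵐ (ℝ × ℝ) × ℝ :=
  (((MeasurableEquiv.toLp 2 (Fin 3 → ℝ)).symm.trans
    (MeasurableEquiv.piFinSuccAbove (fun _ : Fin 3 => ℝ) 2)).trans
    ((MeasurableEquiv.refl ℝ).prodCongr MeasurableEquiv.finTwoArrow)).trans MeasurableEquiv.prodComm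

lemma measurePreserving_splitEquiv : MeasurePreserving splitEquiv volume volume := by
  have h1 := EuclideanSpace.volume_preserving_symm_measurableEquiv_toLp (Fin 3)
  have h2 := volume_preserving_piFinSuccAbove (fun _ : Fin 3 => ℝ) 2
  have h3 : MeasurePreserving ((MeasurableEquiv.refl ℝ).prodCongr
      (MeasurableEquiv.finTwoArrow (α := ℝ))) volume volume :=
    (MeasurePreserving.id volume).prod (volume_preserving_finTwoArrow ℝ)
  have h4 : MeasurePreserving (MeasurableEquiv.prodComm (α := ℝ) (β := ℝ × ℝ)) volume volume :=
    Measure.measurePreserving_swap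
  exact h4.comp (h3.comp (h2.comp h1))

/-- The point of `ℝ³` with horizontal part `w` and vertical part `z`. -/
def mkSpace (w : ℝ × ℝ) (z : ℝ) : Space := !₂[w.1, w.2, z]

@[simp] lemma mkSpace_zero (w : ℝ × ℝ) (z : ℝ) : mkSpace w z 0 = w.1 := rfl
@[simp] lemma mkSpace_one (w : ℝ × ℝ) (z : ℝ) : mkSpace w z 1 = w.2 := rfl
@[simp] lemma mkSpace_two (w : ℝ × ℝ) (z : ℝ) : mkSpace w z 2 = z := rfl

lemma splitEquiv_mkSpace (w : ℝ × ℝ) (z : ℝ) : splitEquiv (mkSpace w z) = (w, z) := rfl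

lemma splitEquiv_symm_apply (p : (ℝ × ℝ) × ℝ) : splitEquiv.symm p = mkSpace p.1 p.2 := by
  rw [MeasurableEquiv.symm_apply_eq, splitEquiv_mkSpace]

lemma lintegral_eq_lintegral_mkSpace {f : Space → ℝ≥0∞} (hf : Measurable f) :
    ∫⁻ ω, f ω = ∫⁻ w : ℝ × ℝ, ∫⁻ z, f (mkSpace w z) := by
  rw [← measurePreserving_splitEquiv.symm.lintegral_comp_emb splitEquiv.symm.measurableEmbedding,
    Measure.volume_eq_prod, lintegral_prod _ (by fun_prop)]
  simp only [splitEquiv_symm_apply]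

lemma integral_eq_integral_mkSpace {f : Space → ℂ} (hf : Integrable f) :
    ∫ ω, f ω = ∫ w : ℝ × ℝ, ∫ z, f (mkSpace w z) := by
  rw [← measurePreserving_splitEquiv.symm.integral_comp splitEquiv.symm.measurableEmbedding,
    Measure.volume_eq_prod, integral_prod]
  · simp only [splitEquiv_symm_apply]
  · rw [← Measure.volume_eq_prod]
    exact (measurePreserving_splitEquiv.symm.integrable_comp_emb
      splitEquiv.symm.measurableEmbedding).2 hf

lemma abs_coord_le_norm (ω : Space) (i : Fin 3) : |ω i| ≤ ‖ω‖ := by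
  simpa using PiLp.norm_apply_le ω i

lemma norm_sq_eq (ω : Space) : ‖ω‖ ^ 2 = ω 0 ^ 2 + ω 1 ^ 2 + ω 2 ^ 2 := by
  rw [EuclideanSpace.norm_sq_eq, Fin.sum_univ_three]
  simp

lemma inner_eq_sum (x ω : Space) : inner ℝ x ω = x 0 * ω 0 + x 1 * ω 1 + x 2 * ω 2 := by
  rw [PiLp.inner_apply, Fin.sum_univ_three]
  simp [mul_comm]

lemma phase_smul (F : ℝ) {c : ℝ} (hc : c ≠ 0) (ω : Space) : phase F (c • ω) = phase F ω := by
  have h : ((c * ω 0) ^ 2 + (c * ω 1) ^ 2 + F ^ 2 * (c * ω 2) ^ 2) /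
      ((c * ω 0) ^ 2 + (c * ω 1) ^ 2 + (c * ω 2) ^ 2) =
      (ω 0 ^ 2 + ω 1 ^ 2 + F ^ 2 * ω 2 ^ 2) / (ω 0 ^ 2 + ω 1 ^ 2 + ω 2 ^ 2) := by
    rw [← mul_div_mul_left (ω 0 ^ 2 + ω 1 ^ 2 + F ^ 2 * ω 2 ^ 2) _ (pow_ne_zero 2 hc)]
    congr 1 <;> ring
  simp only [phase, phaseAux, PiLp.smul_apply, smul_eq_mul]
  rw [h]

lemma measurable_phase (F : ℝ) : Measurable (phase F) := by
  unfold phase phaseAux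
  fun_prop

/-! ### One-dimensional integrals -/

lemma lintegral_inv_sqrt_lt_top (R : ℝ) :
    ∫⁻ u in Icc (-R) R, ENNReal.ofReal (√|u|)⁻¹ < ∞ := by
  have h1 : IntegrableOn (fun u : ℝ => (√|u|)⁻¹) (Icc (-R) R) := by
    rcases lt_or_ge R 0 with hR | hR
    · rw [Icc_eq_empty (by linarith)]; exact integrableOn_empty
    · have hpos : IntegrableOn (fun u : ℝ => (√|u|)⁻¹) (Icc 0 R) := by
        have h := (intervalIntegral.intervalIntegrable_rpow' (a := 0) (b := R)
          (r := -(1 / 2)) (by norm_num))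
        rw [intervalIntegrable_iff_integrableOn_Icc_of_le hR] at h
        refine h.congr_fun (fun u hu => ?_) measurableSet_Icc
        simp only
        rw [abs_of_nonneg hu.1, Real.sqrt_eq_rpow, Real.rpow_neg hu.1]
      have hneg : IntegrableOn (fun u : ℝ => (√|u|)⁻¹) (Icc (-R) 0) := by
        have := (Measure.measurePreserving_neg (volume : Measure ℝ)).integrableOn_comp_preimage
          (MeasurableEquiv.neg ℝ).measurableEmbedding (f := fun u : ℝ => (√|u|)⁻¹)
          (s := Icc 0 R)
        have h2 := this.2 hpos
        refine (h2.congr_fun (fun u _ => by simp) (by measurability)).mono_set ?_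
        intro u hu
        simp only [mem_preimage, mem_Icc] at *
        constructor <;> linarith [hu.1, hu.2]
      exact (hneg.union hpos).mono_set fun u hu => by
        rcases le_total u 0 with h | h
        · exact Or.inl ⟨hu.1, h⟩
        · exact Or.inr ⟨h, hu.2⟩
  have := h1.hasFiniteIntegral
  rw [hasFiniteIntegral_iff_norm] at this
  refine lt_of_le_of_lt (lintegral_mono fun u => ?_) this
  rw [Real.norm_of_nonneg (by positivity)]

/-- `2 R + ∫_{-1}^{1} |u|^{-1/2} du`. -/
def sqrtMass (R : ℝ) : ℝ≥0∞ :=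
  ENNReal.ofReal (2 * R) + ∫⁻ u in Icc (-1 : ℝ) 1, ENNReal.ofReal (√|u|)⁻¹

lemma sqrtMass_lt_top (R : ℝ) : sqrtMass R < ∞ :=
  ENNReal.add_lt_top.2 ⟨ENNReal.ofReal_lt_top, lintegral_inv_sqrt_lt_top 1⟩

/-- After factoring out the slope, |u|^(-1/2) is at most 1 plus its restriction to [-1, 1].
Extending the integral of the latter to the whole line makes it translation invariant, whence a
bound independent of c. -/
lemma lintegral_inv_sqrt_affine_le (R : ℝ) {α : ℝ} (hα : α ≠ 0) (c : ℝ) :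
    ∫⁻ z in Icc (-R) R, ENNReal.ofReal (√|α * z + c|)⁻¹ ≤
      ENNReal.ofReal (√|α|)⁻¹ * sqrtMass R := by
  have h1 : ∀ z, ENNReal.ofReal (√|α * z + c|)⁻¹ =
      ENNReal.ofReal (√|α|)⁻¹ * ENNReal.ofReal (√|z + c / α|)⁻¹ := fun z => by
    rw [← ENNReal.ofReal_mul (by positivity)]
    congr 1
    have : α * z + c = α * (z + c / α) := by field_simp
    rw [this, abs_mul, Real.sqrt_mul (abs_nonneg _), mul_inv]
  simp only [h1]
  rw [lintegral_const_mul _ (by fun_prop)]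
  gcongr
  set g : ℝ → ℝ≥0∞ := (Icc (-1 : ℝ) 1).indicator fun u => ENNReal.ofReal (√|u|)⁻¹ with hg
  have hgm : Measurable g := Measurable.indicator (by fun_prop) measurableSet_Icc
  have h2 : ∀ u : ℝ, ENNReal.ofReal (√|u|)⁻¹ ≤ 1 + g u := fun u => by
    by_cases hu : u ∈ Icc (-1 : ℝ) 1
    · rw [hg, indicator_of_mem hu]; exact le_add_self
    · refine le_add_right ?_
      rw [← ENNReal.ofReal_one]
      apply ENNReal.ofReal_le_ofReal
      apply inv_le_one_of_one_le₀
      rw [Real.one_le_sqrt]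
      by_contra h
      exact hu (abs_le.1 (not_le.1 h).le)
  calc ∫⁻ z in Icc (-R) R, ENNReal.ofReal (√|z + c / α|)⁻¹
      ≤ ∫⁻ z in Icc (-R) R, (1 + g (z + c / α)) := lintegral_mono fun z => h2 _
    _ = ENNReal.ofReal (2 * R) + ∫⁻ z in Icc (-R) R, g (z + c / α) := by
      rw [lintegral_add_left measurable_const, setLIntegral_const, Real.volume_Icc, one_mul]
      congr 2; ring
    _ ≤ ENNReal.ofReal (2 * R) + ∫⁻ z, g (z + c / α) := by
      gcongr; exact Measure.restrict_le_self
    _ = sqrtMass R := by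
      rw [lintegral_add_right_eq_self, hg, lintegral_indicator measurableSet_Icc, sqrtMass]

/-- One integration by parts gives 3B/|y| and the trivial bound is B; their minimum is below
3B|y|^(-1/2). The weaker power is chosen because it is locally integrable in y. -/
lemma norm_integral_exp_le_inv_sqrt {g g' : ℝ → ℂ} (hg : ∀ l, HasDerivAt g (g' l) l)
    (hg'c : Continuous g') {B : ℝ} (hgB : ∀ l ∈ Icc (1 : ℝ) 2, ‖g l‖ ≤ B)
    (hg'B : ∀ l ∈ Icc (1 : ℝ) 2, ‖g' l‖ ≤ B) {y : ℝ} (hy : y ≠ 0) :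
    ‖∫ l in (1 : ℝ)..2, g l * Complex.exp ((l * y : ℝ) * Complex.I)‖ ≤ 3 * B * (√|y|)⁻¹ := by
  have hB : 0 ≤ B := (norm_nonneg _).trans (hgB 1 ⟨le_rfl, by norm_num⟩)
  have hy' : 0 < |y| := abs_pos.2 hy
  have hsq : 0 < √|y| := Real.sqrt_pos.2 hy'
  have hI : uIoc (1 : ℝ) 2 ⊆ Icc 1 2 := by
    rw [uIoc_of_le (by norm_num)]; exact Ioc_subset_Icc_self
  have htriv : ‖∫ l in (1 : ℝ)..2, g l * Complex.exp ((l * y : ℝ) * Complex.I)‖ ≤ B := by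
    have := intervalIntegral.norm_integral_le_of_norm_le_const (a := 1) (b := 2) (C := B)
      (f := fun l => g l * Complex.exp ((l * y : ℝ) * Complex.I)) fun l hl => by
        rw [norm_mul, Complex.norm_exp_ofReal_mul_I, mul_one]; exact hgB l (hI hl)
    refine this.trans ?_
    norm_num
  rcases le_total |y| 1 with h1 | h1
  · refine htriv.trans ?_
    have : 1 ≤ (√|y|)⁻¹ := by
      rw [one_le_inv₀ hsq]; exact Real.sqrt_le_one.2 h1
    nlinarith
  · set v : ℝ → ℂ := fun l => Complex.exp ((l * y : ℝ) * Complex.I) * ((y : ℂ) * Complex.I)⁻¹ with hv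
    have hyI : ((y : ℂ) * Complex.I) ≠ 0 := by
      simp [hy]
    have hdv : ∀ l : ℝ, HasDerivAt v (Complex.exp ((l * y : ℝ) * Complex.I)) l := fun l => by
      have h0 : HasDerivAt (fun l : ℝ => l * y) y l := by
        simpa using (hasDerivAt_id l).mul_const y
      have := ((h0.ofReal_comp.mul_const Complex.I).cexp).mul_const ((y : ℂ) * Complex.I)⁻¹
      refine this.congr_deriv ?_
      rw [mul_assoc, mul_inv_cancel₀ hyI, mul_one]
    have hvn : ∀ l, ‖v l‖ = |y|⁻¹ := fun l => by
      rw [hv]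
      simp only
      rw [norm_mul, Complex.norm_exp_ofReal_mul_I, norm_inv, norm_mul, Complex.norm_I,
        Complex.norm_real, Real.norm_eq_abs]
      simp
    have hib := intervalIntegral.integral_mul_deriv_eq_deriv_mul (a := 1) (b := 2)
      (fun l _ => hg l) (fun l _ => hdv l) (hg'c.intervalIntegrable _ _)
      (by apply Continuous.intervalIntegrable; fun_prop)
    rw [hib]
    have n1 : ‖g 2 * v 2‖ ≤ B * |y|⁻¹ := by
      rw [norm_mul, hvn]; gcongr; exact hgB 2 ⟨by norm_num, le_rfl⟩
    have n2 : ‖g 1 * v 1‖ ≤ B * |y|⁻¹ := by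
      rw [norm_mul, hvn]; gcongr; exact hgB 1 ⟨le_rfl, by norm_num⟩
    have n3 : ‖∫ l in (1 : ℝ)..2, g' l * v l‖ ≤ B * |y|⁻¹ := by
      have := intervalIntegral.norm_integral_le_of_norm_le_const (a := 1) (b := 2)
        (C := B * |y|⁻¹) (f := fun l => g' l * v l) fun l hl => by
          rw [norm_mul, hvn]; gcongr; exact hg'B l (hI hl)
      refine this.trans ?_
      norm_num
    calc _ ≤ ‖g 2 * v 2‖ + ‖g 1 * v 1‖ + ‖∫ l in (1 : ℝ)..2, g' l * v l‖ :=
          (norm_sub_le _ _).trans (add_le_add_left (norm_sub_le _ _) _)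
      _ ≤ 3 * B * |y|⁻¹ := by linarith
      _ ≤ 3 * B * (√|y|)⁻¹ := by
        gcongr
        rw [Real.sqrt_le_left (abs_nonneg _)]
        nlinarith

/-! ### The dispersive kernel -/

/-- An amplitude: a `C¹` function, bounded with its derivative by `A`, supported in the ball of
radius `R`. -/
structure IsAmplitude (R A : ℝ) (m : Space → ℝ) : Prop where
  contDiff : ContDiff ℝ 1 m
  bound : ∀ ω, |m ω| ≤ A
  bound_fderiv : ∀ ω, ‖fderiv ℝ m ω‖ ≤ A
  eq_zero : ∀ ω, R < ‖ω‖ → m ω = 0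

namespace IsAmplitude

variable {R A : ℝ} {m : Space → ℝ}

lemma nonneg (h : IsAmplitude R A m) : 0 ≤ A := (abs_nonneg _).trans (h.bound 0)

lemma fderiv_eq_zero (h : IsAmplitude R A m) {ω : Space} (hω : R < ‖ω‖) : fderiv ℝ m ω = 0 := by
  have : m =ᶠ[𝓝 ω] fun _ => 0 := by
    filter_upwards [(isOpen_lt continuous_const continuous_norm).mem_nhds hω] with y hy
    exact h.eq_zero y hy
  rw [this.fderiv_eq]
  simp

lemma eq_indicator (h : IsAmplitude R A m) (ω : Space) (hω : ω ∉ Metric.closedBall 0 R) :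
    m ω = 0 := by
  apply h.eq_zero
  simpa using hω

lemma integrable_kernel (h : IsAmplitude R A m) (F t : ℝ) (x : Space) :
    Integrable fun ω => Complex.exp ((inner ℝ x ω + t * phase F ω : ℝ) * Complex.I) * (m ω : ℂ) := by
  have hm : Integrable fun ω => (m ω : ℂ) := by
    refine Integrable.ofReal ?_
    exact h.contDiff.continuous.integrable_of_hasCompactSupport
      (HasCompactSupport.intro (isCompact_closedBall 0 R) h.eq_indicator)
  refine hm.bdd_mul (c := 1) ?_ (ae_of_all _ fun ω => (Complex.norm_exp_ofReal_mul_I _).le)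
  have := measurable_phase F
  exact Measurable.aestronglyMeasurable (by fun_prop)

end IsAmplitude

/-- The kernel of the dispersive evolution with amplitude `m`. -/
def dispKernel (F : ℝ) (m : Space → ℝ) (t : ℝ) (x : Space) : ℂ :=
  ∫ ω, Complex.exp ((inner ℝ x ω + t * phase F ω : ℝ) * Complex.I) * (m ω : ℂ)

lemma norm_dispKernel_le_const {F R A : ℝ} {m : Space → ℝ} (h : IsAmplitude R A m) (t : ℝ)
    (x : Space) :
    ‖dispKernel F m t x‖ ≤ (volume (Metric.closedBall (0 : Space) R)).toReal * A := by
  have hfin : volume (Metric.closedBall (0 : Space) R) ≠ ∞ := measure_closedBall_lt_top.ne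
  have hi : Integrable ((Metric.closedBall (0 : Space) R).indicator fun _ => A) :=
    (integrable_indicator_iff measurableSet_closedBall).2 (integrableOn_const hfin)
  calc ‖dispKernel F m t x‖ ≤ ∫ ω, (Metric.closedBall (0 : Space) R).indicator (fun _ => A) ω := by
        refine norm_integral_le_of_norm_le hi (ae_of_all _ fun ω => ?_)
        rw [norm_mul, Complex.norm_exp_ofReal_mul_I, one_mul, Complex.norm_real, Real.norm_eq_abs]
        by_cases hω : ω ∈ Metric.closedBall (0 : Space) R
        · rw [indicator_of_mem hω]; exact h.bound ω
        · rw [indicator_of_notMem hω, h.eq_indicator ω hω, abs_zero]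
    _ = _ := by
      rw [integral_indicator measurableSet_closedBall, setIntegral_const]
      simp [Measure.real]

/-- With the horizontal frequency frozen, the factor exp(i x₃ z) is counted as part of the
amplitude, so that the derivative of the amplitude is at most A(1 + |x₃|), and the one-dimensional
estimate applies with s = w₁² + w₂². The remaining factor s^(-1/2) is split into two integrable
one-variable singularities. -/
lemma enorm_integral_vert_le {F R A : ℝ} (hF : 0 < F) (hF1 : F ≠ 1) (hR : 0 < R) {m : Space → ℝ}
    (h : IsAmplitude R A m) {t : ℝ} (ht : t ≠ 0) (x : Space) {w : ℝ × ℝ} (hw1 : w.1 ≠ 0)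
    (hw2 : w.2 ≠ 0) :
    ‖∫ z, Complex.exp ((inner ℝ x (mkSpace w z) + t * phase F (mkSpace w z) : ℝ) * Complex.I) *
        (m (mkSpace w z) : ℂ)‖ₑ ≤
      ENNReal.ofReal (vertConst F R * A * √((1 + |x 2|) / |t|)) *
        ((Icc (-R) R).indicator (fun u => ENNReal.ofReal (√|u|)⁻¹) w.1 *
          (Icc (-R) R).indicator (fun u => ENNReal.ofReal (√|u|)⁻¹) w.2) := by
  have hA := h.nonneg
  by_cases hbox : |w.1| ≤ R ∧ |w.2| ≤ R ∧ w.1 ^ 2 + w.2 ^ 2 ≤ R ^ 2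
  swap
  · have hz : ∀ z, m (mkSpace w z) = 0 := fun z => by
      apply h.eq_zero
      by_contra hn
      rw [not_lt] at hn
      apply hbox
      refine ⟨(abs_coord_le_norm (mkSpace w z) 0).trans hn,
        (abs_coord_le_norm (mkSpace w z) 1).trans hn, ?_⟩
      have h1 := norm_sq_eq (mkSpace w z)
      simp only [mkSpace_zero, mkSpace_one, mkSpace_two] at h1
      have h2 : ‖mkSpace w z‖ ^ 2 ≤ R ^ 2 := by gcongr
      nlinarith [sq_nonneg z]
    simp [hz]
  obtain ⟨hb1, hb2, hb3⟩ := hbox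
  rw [indicator_of_mem (show w.1 ∈ Icc (-R) R from abs_le.1 hb1),
    indicator_of_mem (show w.2 ∈ Icc (-R) R from abs_le.1 hb2),
    ← ENNReal.ofReal_mul (by positivity),
    ← ENNReal.ofReal_mul (mul_nonneg (mul_nonneg (vertConst_nonneg hF hR.le) hA) (by positivity)),
    ← ofReal_norm]
  apply ENNReal.ofReal_le_ofReal
  set s := w.1 ^ 2 + w.2 ^ 2 with hs
  have hs0 : 0 < s := by positivity
  set e : Space := EuclideanSpace.single 2 1 with he
  have hmk : ∀ z, mkSpace w z = mkSpace w 0 + z • e := fun z => by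
    ext i
    fin_cases i <;> simp [mkSpace, he]
  have hdmk : ∀ z, HasDerivAt (mkSpace w) e z := fun z => by
    have h1 : HasDerivAt (fun z : ℝ => mkSpace w 0 + z • e) ((1 : ℝ) • e) z :=
      ((hasDerivAt_id z).smul_const e).const_add _
    rw [one_smul] at h1
    exact h1.congr_of_eventuallyEq (Eventually.of_forall hmk)
  have hdm : ∀ z, HasDerivAt (fun z => m (mkSpace w z)) (fderiv ℝ m (mkSpace w z) e) z := fun z =>
    ((h.contDiff.differentiable one_ne_zero) (mkSpace w z)).hasFDerivAt.comp_hasDerivAt z (hdmk z)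
  have hmkc : Continuous (mkSpace w) :=
    continuous_iff_continuousAt.2 fun z => (hdmk z).continuousAt
  have hen : ‖e‖ = 1 := by simp [he]
  set c0 : ℂ := Complex.exp ((x 0 * w.1 + x 1 * w.2 : ℝ) * Complex.I) with hc0
  set b : ℝ → ℂ := fun z => Complex.exp ((x 2 * z : ℝ) * Complex.I) * (m (mkSpace w z) : ℂ) with hb
  set b' : ℝ → ℂ := fun z => Complex.exp ((x 2 * z : ℝ) * Complex.I) * ((x 2 : ℝ) * Complex.I) *
    (m (mkSpace w z) : ℂ) + Complex.exp ((x 2 * z : ℝ) * Complex.I) *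
      (fderiv ℝ m (mkSpace w z) e : ℂ) with hb'
  have hfac : ∀ z, Complex.exp ((inner ℝ x (mkSpace w z) + t * phase F (mkSpace w z) : ℝ) *
      Complex.I) * (m (mkSpace w z) : ℂ) =
      c0 * (Complex.exp ((t * phaseAux F s z : ℝ) * Complex.I) * b z) := fun z => by
    rw [hc0, hb]
    simp only
    rw [← mul_assoc, ← mul_assoc, ← Complex.exp_add, ← Complex.exp_add]
    congr 2
    rw [inner_eq_sum]
    simp only [phase, mkSpace_zero, mkSpace_one, mkSpace_two, ← hs]
    push_cast
    ring
  simp only [hfac]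
  rw [integral_const_mul, norm_mul, hc0, Complex.norm_exp_ofReal_mul_I, one_mul]
  have hmain := norm_integral_exp_phaseAux_le hF hF1 hR hs0 hb3 ht (abs_nonneg (x 2)) hA
    (b := b) (b' := b') ?_ ?_ ?_ ?_ ?_ ?_
  · refine hmain.trans ?_
    have hle : √((1 + |x 2|) / (|t| * s)) ≤ √((1 + |x 2|) / |t|) * ((√|w.1|)⁻¹ * (√|w.2|)⁻¹) := by
      rw [← mul_inv, ← Real.sqrt_mul (abs_nonneg _), ← Real.sqrt_inv,
        ← Real.sqrt_mul (by positivity)]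
      apply Real.sqrt_le_sqrt
      -- The arithmetic-geometric inequality decouples the horizontal singularity, so that its
      -- integral over the box becomes a product.
      have hab : |w.1| * |w.2| ≤ s := by
        rw [hs]
        nlinarith [sq_nonneg (|w.1| - |w.2|), sq_abs w.1, sq_abs w.2, abs_nonneg w.1, abs_nonneg w.2]
      have hab0 : 0 < |w.1| * |w.2| := by positivity
      have : 0 < |t| := abs_pos.2 ht
      rw [← div_div, div_eq_mul_inv _ s]
      gcongr
    calc _ ≤ vertConst F R * A * (√((1 + |x 2|) / |t|) * ((√|w.1|)⁻¹ * (√|w.2|)⁻¹)) := by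
          gcongr
          exact mul_nonneg (vertConst_nonneg hF hR.le) hA
      _ = _ := by ring
  · intro z
    have h0 : HasDerivAt (fun z : ℝ => x 2 * z) (x 2) z := by
      simpa using (hasDerivAt_id z).const_mul (x 2)
    exact ((h0.ofReal_comp.mul_const Complex.I).cexp).mul (hdm z).ofReal_comp
  · have h1 : Continuous fun z => fderiv ℝ m (mkSpace w z) e :=
      ((h.contDiff.continuous_fderiv one_ne_zero).comp hmkc).clm_apply continuous_const
    have h2 : Continuous fun z => m (mkSpace w z) := h.contDiff.continuous.comp hmkc
    have h3 : Continuous fun z : ℝ => Complex.exp ((x 2 * z : ℝ) * Complex.I) := by fun_prop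
    exact ((h3.mul continuous_const).mul (Complex.continuous_ofReal.comp h2)).add
      (h3.mul (Complex.continuous_ofReal.comp h1))
  · intro z
    rw [hb]
    simp only
    rw [norm_mul, Complex.norm_exp_ofReal_mul_I, one_mul, Complex.norm_real]
    exact h.bound _
  · intro z
    rw [hb']
    simp only
    refine (norm_add_le _ _).trans ?_
    simp only [norm_mul, Complex.norm_exp_ofReal_mul_I, one_mul, Complex.norm_real, Complex.norm_I,
      mul_one, Real.norm_eq_abs]
    have h1 := h.bound (mkSpace w z)
    have h2 : |fderiv ℝ m (mkSpace w z) e| ≤ A := by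
      have := (fderiv ℝ m (mkSpace w z)).le_opNorm e
      rw [hen, mul_one] at this
      exact this.trans (h.bound_fderiv _)
    have : |x 2| * |m (mkSpace w z)| ≤ |x 2| * A := by gcongr
    linarith
  · intro z hz
    have : R < ‖mkSpace w z‖ := hz.trans_le (abs_coord_le_norm (mkSpace w z) 2)
    simp [hb, h.eq_zero _ this]
  · intro z hz
    have : R < ‖mkSpace w z‖ := hz.trans_le (abs_coord_le_norm (mkSpace w z) 2)
    simp [hb', h.eq_zero _ this, h.fderiv_eq_zero this]

/-- Fubini in the horizontal frequencies: the vertical bound is integrable there, and the axes where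
it is not available form a null set. -/
lemma exists_norm_dispKernel_le_sqrt {F R : ℝ} (hF : 0 < F) (hF1 : F ≠ 1) (hR : 0 < R) :
    ∃ C : ℝ, 0 ≤ C ∧ ∀ (A : ℝ) (m : Space → ℝ), IsAmplitude R A m → ∀ (t : ℝ), t ≠ 0 →
      ∀ x : Space, ‖dispKernel F m t x‖ ≤ C * A * √((1 + |x 2|) / |t|) := by
  set g : ℝ → ℝ≥0∞ := (Icc (-R) R).indicator (fun u => ENNReal.ofReal (√|u|)⁻¹) with hg
  have hgm : Measurable g := Measurable.indicator (by fun_prop) measurableSet_Icc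
  have hgi : ∫⁻ u, g u < ∞ := by
    rw [hg, lintegral_indicator measurableSet_Icc]
    exact lintegral_inv_sqrt_lt_top R
  refine ⟨vertConst F R * (∫⁻ u, g u).toReal ^ 2,
    mul_nonneg (vertConst_nonneg hF hR.le) (by positivity), fun A m h t ht x => ?_⟩
  have hne : ∀ᵐ w : ℝ × ℝ, w.1 ≠ 0 ∧ w.2 ≠ 0 := by
    have h1 : ∀ᵐ w : ℝ × ℝ, w.1 ≠ 0 :=
      (Measure.quasiMeasurePreserving_fst (μ := (volume : Measure ℝ))
        (ν := (volume : Measure ℝ))).ae (Measure.ae_ne volume 0)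
    have h2 : ∀ᵐ w : ℝ × ℝ, w.2 ≠ 0 :=
      (Measure.quasiMeasurePreserving_snd (μ := (volume : Measure ℝ))
        (ν := (volume : Measure ℝ))).ae (Measure.ae_ne volume 0)
    filter_upwards [h1, h2] with w a b using ⟨a, b⟩
  set D := vertConst F R * A * √((1 + |x 2|) / |t|) with hD
  have hD0 : 0 ≤ D :=
    mul_nonneg (mul_nonneg (vertConst_nonneg hF hR.le) h.nonneg) (Real.sqrt_nonneg _)
  have hle : ‖dispKernel F m t x‖ₑ ≤ ENNReal.ofReal D * ((∫⁻ u, g u) * ∫⁻ u, g u) := by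
    rw [dispKernel, integral_eq_integral_mkSpace (h.integrable_kernel F t x)]
    refine (enorm_integral_le_lintegral_enorm _).trans ?_
    calc _ ≤ ∫⁻ w : ℝ × ℝ, ENNReal.ofReal D * (g w.1 * g w.2) := by
          refine lintegral_mono_ae ?_
          filter_upwards [hne] with w hw
          exact enorm_integral_vert_le hF hF1 hR h ht x hw.1 hw.2
      _ = _ := by
        rw [lintegral_const_mul _ (by fun_prop), Measure.volume_eq_prod,
          lintegral_prod_mul hgm.aemeasurable hgm.aemeasurable]
  have h2 := ENNReal.toReal_mono (by finiteness) hle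
  rw [toReal_enorm, ENNReal.toReal_mul, ENNReal.toReal_mul, ENNReal.toReal_ofReal hD0] at h2
  calc _ ≤ _ := h2
    _ = _ := by rw [hD]; ring

/-! ### Averaging over dilations -/

/-- The average over dilations `λ ∈ [1, 2]` of the amplitude and of the plane wave. -/
def radialMean (m : Space → ℝ) (x ω : Space) : ℂ :=
  ∫ l in (1 : ℝ)..2, ((l ^ 3 * m (l • ω) : ℝ) : ℂ) *
    Complex.exp ((l * inner ℝ x ω : ℝ) * Complex.I)

lemma radialMean_eq_zero {R A : ℝ} {m : Space → ℝ} (h : IsAmplitude R A m) (x : Space) {ω : Space}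
    (hω : R < ‖ω‖) : radialMean m x ω = 0 := by
  unfold radialMean
  rw [intervalIntegral.integral_congr (g := fun _ => 0)]
  · simp
  · intro l hl
    rw [uIcc_of_le (by norm_num)] at hl
    have : m (l • ω) = 0 := by
      apply h.eq_zero
      rw [norm_smul, Real.norm_of_nonneg (by linarith [hl.1])]
      nlinarith [hl.1, norm_nonneg ω]
    simp [this]

/-- The factor 12 + 8R bounds the derivative of l³ m(lω) on [1, 2]: at most 3·2²·A from the power
and 2³·A·R from the chain rule, for ω in the ball of radius R. Outside that ball the mean vanishes.
-/
lemma norm_radialMean_le {R A : ℝ} (hR : 0 < R) {m : Space → ℝ} (h : IsAmplitude R A m)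
    (x : Space) {ω : Space} (hω : inner ℝ x ω ≠ 0) :
    ‖radialMean m x ω‖ ≤ 3 * ((12 + 8 * R) * A) * (√|inner ℝ x ω|)⁻¹ := by
  have hA := h.nonneg
  by_cases hωR : ‖ω‖ ≤ R
  · set g : ℝ → ℂ := fun l => ((l ^ 3 * m (l • ω) : ℝ) : ℂ) with hg
    set g' : ℝ → ℂ := fun l =>
      ((3 * l ^ 2 * m (l • ω) + l ^ 3 * fderiv ℝ m (l • ω) ω : ℝ) : ℂ) with hg'
    have hdm : ∀ l : ℝ, HasDerivAt (fun l : ℝ => m (l • ω)) (fderiv ℝ m (l • ω) ω) l := fun l => by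
      have h1 : HasDerivAt (fun l : ℝ => l • ω) ω l := by
        simpa using (hasDerivAt_id l).smul_const ω
      exact ((h.contDiff.differentiable one_ne_zero) (l • ω)).hasFDerivAt.comp_hasDerivAt l h1
    refine norm_integral_exp_le_inv_sqrt (g := g) (g' := g') (fun l => ?_) ?_ ?_ ?_ hω
    · refine HasDerivAt.ofReal_comp ?_
      refine ((hasDerivAt_pow 3 l).mul (hdm l)).congr_deriv ?_
      norm_num
    · have h1 : Continuous fun l : ℝ => fderiv ℝ m (l • ω) ω :=
        ((h.contDiff.continuous_fderiv one_ne_zero).comp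
          (by fun_prop : Continuous fun l : ℝ => l • ω)).clm_apply continuous_const
      have h2 : Continuous fun l : ℝ => m (l • ω) :=
        h.contDiff.continuous.comp (by fun_prop : Continuous fun l : ℝ => l • ω)
      exact Complex.continuous_ofReal.comp
        (((continuous_const.mul (continuous_pow 2)).mul h2).add ((continuous_pow 3).mul h1))
    · intro l hl
      have h0 : 0 ≤ l := by linarith [hl.1]
      have h3 : l ^ 3 ≤ 2 ^ 3 := by gcongr; exact hl.2
      rw [hg]
      simp only
      rw [Complex.norm_real, Real.norm_eq_abs, abs_mul, abs_of_nonneg (by positivity : 0 ≤ l ^ 3)]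
      calc _ ≤ 2 ^ 3 * A := by gcongr; exact h.bound _
        _ ≤ _ := by nlinarith
    · intro l hl
      have h0 : 0 ≤ l := by linarith [hl.1]
      have h3 : l ^ 3 ≤ 2 ^ 3 := by gcongr; exact hl.2
      have h2 : l ^ 2 ≤ 2 ^ 2 := by gcongr; exact hl.2
      have h4 : |fderiv ℝ m (l • ω) ω| ≤ A * R := by
        refine ((fderiv ℝ m (l • ω)).le_opNorm ω).trans ?_
        gcongr
        exact h.bound_fderiv _
      rw [hg']
      simp only
      rw [Complex.norm_real, Real.norm_eq_abs]
      refine (abs_add_le _ _).trans ?_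
      rw [abs_mul, abs_mul _ (fderiv ℝ m (l • ω) ω), abs_of_nonneg (by positivity : 0 ≤ l ^ 3),
        abs_of_nonneg (by positivity : 0 ≤ 3 * l ^ 2)]
      calc _ ≤ 3 * 2 ^ 2 * A + 2 ^ 3 * (A * R) := by gcongr; exact h.bound _
        _ = _ := by ring
  · rw [radialMean_eq_zero h x (not_le.1 hωR), norm_zero]
    positivity

/-- The substitution ω → lω has Jacobian l³ and fixes the phase, which is homogeneous of degree 0.
Hence the kernel equals each of its rescaled versions, and also their mean over l in [1, 2], an
interval of length 1; only the plane wave and the amplitude feel l. -/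
lemma dispKernel_eq_integral_radialMean {R A : ℝ} {m : Space → ℝ} (h : IsAmplitude R A m)
    (F t : ℝ) (x : Space) :
    dispKernel F m t x =
      ∫ ω, Complex.exp ((t * phase F ω : ℝ) * Complex.I) * radialMean m x ω := by
  set f : Space → ℂ :=
    fun ω => Complex.exp ((inner ℝ x ω + t * phase F ω : ℝ) * Complex.I) * (m ω : ℂ) with hf
  have hfin : Module.finrank ℝ Space = 3 := by simp
  have hscale : ∀ l ∈ uIcc (1 : ℝ) 2, ∫ ω, ((l ^ 3 : ℝ) : ℂ) * f (l • ω) = dispKernel F m t x := by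
    intro l hl
    rw [uIcc_of_le (by norm_num)] at hl
    have hl0 : 0 < l := by linarith [hl.1]
    rw [integral_const_mul, Measure.integral_comp_smul, hfin, abs_of_pos (by positivity),
      Complex.real_smul, ← mul_assoc, ← Complex.ofReal_mul, mul_inv_cancel₀ (by positivity),
      Complex.ofReal_one, one_mul]
    rfl
  have hmean : dispKernel F m t x = ∫ l in (1 : ℝ)..2, ∫ ω, ((l ^ 3 : ℝ) : ℂ) * f (l • ω) := by
    rw [intervalIntegral.integral_congr hscale]
    simp
    norm_num
  rw [hmean, intervalIntegral.integral_of_le (by norm_num), integral_integral_swap]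
  · refine integral_congr_ae (ae_of_all _ fun ω => ?_)
    simp only [radialMean]
    rw [intervalIntegral.integral_of_le (by norm_num), ← integral_const_mul]
    refine setIntegral_congr_fun measurableSet_Ioc fun l hl => ?_
    have hl0 : l ≠ 0 := by linarith [hl.1]
    simp only [hf]
    rw [phase_smul F hl0, inner_smul_right, Complex.ofReal_add, add_mul, Complex.exp_add]
    push_cast
    ring
  · have hmeas : Measurable (Function.uncurry fun (l : ℝ) (ω : Space) =>
        ((l ^ 3 : ℝ) : ℂ) * f (l • ω)) := by
      have hfm : Measurable f := by
        have := measurable_phase F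
        have := h.contDiff.continuous.measurable
        fun_prop
      have h1 : Measurable fun p : ℝ × Space => p.1 • p.2 := by fun_prop
      have h2 := hfm.comp h1
      refine Measurable.mul (by fun_prop) h2
    have hA := h.nonneg
    have hbd : Integrable (((Ioc (1 : ℝ) 2) ×ˢ Metric.closedBall (0 : Space) R).indicator
        fun _ => 8 * A) ((volume.restrict (Ioc 1 2)).prod volume) := by
      refine (integrable_indicator_iff (measurableSet_Ioc.prod measurableSet_closedBall)).2
        (integrableOn_const ?_)
      rw [Measure.prod_prod]
      exact ENNReal.mul_ne_top (by simp) measure_closedBall_lt_top.ne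
    refine hbd.mono' hmeas.aestronglyMeasurable ?_
    have hmem : ∀ᵐ p : ℝ × Space ∂((volume.restrict (Ioc 1 2)).prod volume), p.1 ∈ Ioc (1 : ℝ) 2 :=
      Measure.quasiMeasurePreserving_fst.ae (ae_restrict_mem measurableSet_Ioc)
    filter_upwards [hmem] with p hp
    have hp0 : 0 < p.1 := by linarith [hp.1]
    simp only [Function.uncurry, hf]
    rw [norm_mul, norm_mul, Complex.norm_exp_ofReal_mul_I, one_mul, Complex.norm_real,
      Complex.norm_real, Real.norm_eq_abs, Real.norm_eq_abs, abs_of_pos (by positivity)]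
    by_cases hpR : ‖p.2‖ ≤ R
    · have hmem2 : p ∈ Ioc (1 : ℝ) 2 ×ˢ Metric.closedBall (0 : Space) R := ⟨hp, by simpa using hpR⟩
      rw [indicator_of_mem hmem2]
      have h3 : p.1 ^ 3 ≤ 2 ^ 3 := by gcongr; exact hp.2
      calc _ ≤ 2 ^ 3 * A := by gcongr; exact h.bound _
        _ = _ := by ring
    · have : m (p.1 • p.2) = 0 := by
        apply h.eq_zero
        rw [norm_smul, Real.norm_of_nonneg hp0.le]
        nlinarith [hp.1, norm_nonneg p.2, not_le.1 hpR]
      rw [this]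
      simp only [abs_zero, mul_zero]
      exact indicator_nonneg (fun _ _ => by positivity) _

/-- The radial mean is O(|x·ω|^(-1/2)). As a function of the vertical frequency, x·ω is affine with
slope x₃, so its integral over [-R, R] is O(|x₃|^(-1/2)) whatever the horizontal frequency. The
oscillation in time plays no role, so the bound is uniform in F and t. -/
lemma exists_norm_dispKernel_le_inv_sqrt {R : ℝ} (hR : 0 < R) :
    ∃ C : ℝ, 0 ≤ C ∧ ∀ (F A : ℝ) (m : Space → ℝ), IsAmplitude R A m → ∀ (t : ℝ) (x : Space),
      x 2 ≠ 0 → ‖dispKernel F m t x‖ ≤ C * A * (√|x 2|)⁻¹ := by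
  set g : ℝ → ℝ≥0∞ := (Icc (-R) R).indicator (fun _ => 1) with hg
  have hgm : Measurable g := Measurable.indicator (by fun_prop) measurableSet_Icc
  have hgi : ∫⁻ u, g u = ENNReal.ofReal (2 * R) := by
    rw [hg, lintegral_indicator measurableSet_Icc, setLIntegral_const, Real.volume_Icc, one_mul]
    congr 1; ring
  refine ⟨3 * (12 + 8 * R) * (sqrtMass R).toReal * (2 * R) ^ 2, by positivity,
    fun F A m h t x hx => ?_⟩
  have hA := h.nonneg
  set D := 3 * ((12 + 8 * R) * A) with hD
  have hD0 : 0 ≤ D := by positivity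
  -- The mean is only estimated off the hyperplane orthogonal to x; it is a proper subspace because
  -- x₃ ≠ 0, hence null.
  have hxm : ∀ᵐ ω : Space, inner ℝ x ω ≠ 0 := by
    have hker : (LinearMap.ker (innerₛₗ ℝ x)) ≠ ⊤ := by
      intro htop
      have h1 : (EuclideanSpace.single (2 : Fin 3) (1 : ℝ)) ∈ LinearMap.ker (innerₛₗ ℝ x) := by
        rw [htop]; trivial
      rw [LinearMap.mem_ker, innerₛₗ_apply_apply, inner_eq_sum] at h1
      simp at h1
      exact hx h1
    have h2 := Measure.addHaar_submodule (volume : Measure Space) _ hker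
    rw [ae_iff]
    refine measure_mono_null (fun ω hω => ?_) h2
    simpa using hω
  set Φ : Space → ℝ≥0∞ := fun ω =>
    ENNReal.ofReal D * ((g (ω 0) * g (ω 1)) *
      (Icc (-R) R).indicator (fun _ => ENNReal.ofReal (√|inner ℝ x ω|)⁻¹) (ω 2)) with hΦ
  have hind : ∀ ω : Space, (Icc (-R) R).indicator
      (fun _ => ENNReal.ofReal (√|inner ℝ x ω|)⁻¹) (ω 2) =
      g (ω 2) * ENNReal.ofReal (√|inner ℝ x ω|)⁻¹ := fun ω => by
    by_cases hω : ω 2 ∈ Icc (-R) R <;> simp [hg, hω]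
  have hΦm : Measurable Φ := by
    simp only [hΦ, hind]
    fun_prop
  have hle : ‖dispKernel F m t x‖ₑ ≤ ∫⁻ ω, Φ ω := by
    rw [dispKernel_eq_integral_radialMean h]
    refine (enorm_integral_le_lintegral_enorm _).trans (lintegral_mono_ae ?_)
    filter_upwards [hxm] with ω hω
    rw [enorm_mul, ← ofReal_norm, Complex.norm_exp_ofReal_mul_I, ENNReal.ofReal_one, one_mul]
    by_cases hωR : R < ‖ω‖
    · rw [radialMean_eq_zero h x hωR, enorm_zero]; exact zero_le
    · rw [not_lt] at hωR
      have hm : ∀ i, ω i ∈ Icc (-R) R := fun i => abs_le.1 ((abs_coord_le_norm ω i).trans hωR)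
      simp only [hΦ, hg, indicator_of_mem (hm 0), indicator_of_mem (hm 1), indicator_of_mem (hm 2),
        one_mul]
      rw [← ENNReal.ofReal_mul hD0, ← ofReal_norm]
      exact ENNReal.ofReal_le_ofReal (norm_radialMean_le hR h x hω)
  have hΦi : ∫⁻ ω, Φ ω ≤ ENNReal.ofReal D *
      (ENNReal.ofReal (√|x 2|)⁻¹ * sqrtMass R * (ENNReal.ofReal (2 * R) * ENNReal.ofReal (2 * R))) := by
    rw [lintegral_eq_lintegral_mkSpace hΦm]
    calc _ ≤ ∫⁻ w : ℝ × ℝ, ENNReal.ofReal D *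
          ((ENNReal.ofReal (√|x 2|)⁻¹ * sqrtMass R) * (g w.1 * g w.2)) := by
          refine lintegral_mono fun w => ?_
          simp only [hΦ, mkSpace_zero, mkSpace_one, mkSpace_two]
          have hmm : Measurable fun z : ℝ => (Icc (-R) R).indicator
              (fun _ => ENNReal.ofReal (√|inner ℝ x (mkSpace w z)|)⁻¹) z := by
            have : ∀ z : ℝ, (Icc (-R) R).indicator
              (fun _ => ENNReal.ofReal (√|inner ℝ x (mkSpace w z)|)⁻¹) z =
              (Icc (-R) R).indicator (fun z => ENNReal.ofReal
                (√|x 0 * w.1 + x 1 * w.2 + x 2 * z|)⁻¹) z := fun z => by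
              by_cases hz : z ∈ Icc (-R) R <;> simp [hz, inner_eq_sum]
            simp only [this]
            exact Measurable.indicator (by fun_prop) measurableSet_Icc
          rw [lintegral_const_mul _ (by fun_prop), lintegral_const_mul _ (by fun_prop), mul_comm (g w.1 * g w.2)]
          gcongr
          calc _ = ∫⁻ z in Icc (-R) R, ENNReal.ofReal
                (√|x 2 * z + (x 0 * w.1 + x 1 * w.2)|)⁻¹ := by
                rw [← lintegral_indicator measurableSet_Icc]
                refine lintegral_congr fun z => ?_
                by_cases hz : z ∈ Icc (-R) R <;> simp [hz, inner_eq_sum, add_comm]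
            _ ≤ _ := lintegral_inv_sqrt_affine_le R hx _
      _ = _ := by
        rw [lintegral_const_mul _ (by fun_prop), lintegral_const_mul _ (by fun_prop),
          Measure.volume_eq_prod, lintegral_prod_mul hgm.aemeasurable hgm.aemeasurable, hgi]
  have hfin := sqrtMass_lt_top R
  have h2 := ENNReal.toReal_mono (by finiteness) (hle.trans hΦi)
  rw [toReal_enorm, ENNReal.toReal_mul, ENNReal.toReal_mul, ENNReal.toReal_mul, ENNReal.toReal_mul,
    ENNReal.toReal_ofReal hD0, ENNReal.toReal_ofReal (by positivity),
    ENNReal.toReal_ofReal (by positivity)] at h2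
  calc _ ≤ _ := h2
    _ = _ := by rw [hD]; ring

/-- The dispersive estimate, uniform in the space variable. -/
theorem exists_norm_dispKernel_le {F R : ℝ} (hF : 0 < F) (hF1 : F ≠ 1) (hR : 0 < R) :
    ∃ C : ℝ, 0 ≤ C ∧ ∀ (A : ℝ) (m : Space → ℝ), IsAmplitude R A m → ∀ (t : ℝ) (x : Space),
      ‖dispKernel F m t x‖ ≤ C * A ∧
      (t ≠ 0 → ‖dispKernel F m t x‖ ≤ C * A * |t| ^ (-(1 / 4) : ℝ)) := by
  obtain ⟨C1, hC1, h1⟩ := exists_norm_dispKernel_le_sqrt hF hF1 hR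
  obtain ⟨C2, hC2, h2⟩ := exists_norm_dispKernel_le_inv_sqrt hR
  set C0 := (volume (Metric.closedBall (0 : Space) R)).toReal with hC0
  have hC00 : 0 ≤ C0 := ENNReal.toReal_nonneg
  refine ⟨C0 + 2 * C1 + C2, by positivity, fun A m h t x => ?_⟩
  have hA := h.nonneg
  have hK0 := norm_dispKernel_le_const (F := F) h t x
  rw [← hC0] at hK0
  refine ⟨hK0.trans (by gcongr; linarith), fun ht => ?_⟩
  have ht' : 0 < |t| := abs_pos.2 ht
  have hpos : 0 < |t| ^ (-(1 / 4) : ℝ) := by positivity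
  -- For |t| ≤ 1 the trivial bound by the volume of the ball is already below the claimed one.
  rcases le_total |t| 1 with ht1 | ht1
  · have hone : 1 ≤ |t| ^ (-(1 / 4) : ℝ) := Real.one_le_rpow_of_pos_of_le_one_of_nonpos ht' ht1 (by norm_num)
    calc _ ≤ C0 * A * 1 := by rw [mul_one]; exact hK0
      _ ≤ _ := by gcongr; linarith
  · have hq : √(√|t|) = |t| ^ (1 / 4 : ℝ) := by
      rw [Real.sqrt_eq_rpow, Real.sqrt_eq_rpow, ← Real.rpow_mul ht'.le]; norm_num
    have hq' : |t| ^ (-(1 / 4) : ℝ) = (√(√|t|))⁻¹ := by rw [hq, Real.rpow_neg ht'.le]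
    have hst : 0 < √|t| := Real.sqrt_pos.2 ht'
    -- At the threshold |x₃| = |t|^(1/2) the bounds √((1 + |x₃|)/|t|) and |x₃|^(-1/2) are both of
    -- order |t|^(-1/4).
    rcases le_total |x 2| (√|t|) with hx | hx
    · have hb : √((1 + |x 2|) / |t|) ≤ 2 * |t| ^ (-(1 / 4) : ℝ) := by
        rw [hq']
        apply Real.sqrt_le_iff.2 ⟨by positivity, ?_⟩
        rw [mul_pow, inv_pow, Real.sq_sqrt hst.le]
        rw [div_le_iff₀ ht']
        have e1 : (√|t|)⁻¹ * |t| = √|t| := by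
          nth_rewrite 2 [← Real.mul_self_sqrt ht'.le]
          field_simp
        have e2 : 1 ≤ √|t| := Real.one_le_sqrt.2 ht1
        rw [mul_assoc, e1]
        linarith
      calc _ ≤ C1 * A * √((1 + |x 2|) / |t|) := h1 A m h t ht x
        _ ≤ C1 * A * (2 * |t| ^ (-(1 / 4) : ℝ)) := by gcongr
        _ = (2 * C1) * A * |t| ^ (-(1 / 4) : ℝ) := by ring
        _ ≤ _ := by gcongr; linarith
    · have hx0 : x 2 ≠ 0 := abs_pos.1 (hst.trans_le hx)
      calc _ ≤ C2 * A * (√|x 2|)⁻¹ := h2 F A m h t x hx0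
        _ ≤ C2 * A * |t| ^ (-(1 / 4) : ℝ) := by
          rw [hq']; gcongr
        _ ≤ _ := by gcongr; linarith

/-! ### The `TT*` argument -/

section TTStar

variable {α Ω : Type*} [MeasurableSpace α] [MeasurableSpace Ω] {μ : Measure α} {ρ : Measure Ω}
  [IsFiniteMeasure μ] [IsFiniteMeasure ρ]

/-- Duality step of the `TT*` argument for the operator with bounded kernel `e`. -/
lemma enorm_integral_mul_integral_le {e : α → Ω → ℂ} (he : Measurable (Function.uncurry e)) {B : ℝ}
    (heB : ∀ t ω, ‖e t ω‖ ≤ B) {κ : α → α → ℝ≥0∞}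
    (hκ : ∀ t s, ‖∫ ω, e t ω * (starRingEnd ℂ) (e s ω) ∂ρ‖ₑ ≤ κ t s)
    {g : α → ℂ} (hg : Measurable g) {B' : ℝ} (hgB : ∀ t, ‖g t‖ ≤ B') {k : Ω → ℂ}
    (hk : Integrable k ρ) :
    ‖∫ t, g t * ∫ ω, e t ω * k ω ∂ρ ∂μ‖ₑ ≤
      (∫⁻ ω, ‖k ω‖ₑ ^ (2 : ℝ) ∂ρ) ^ (1 / 2 : ℝ) *
        (∫⁻ p, ‖g p.1‖ₑ * ‖g p.2‖ₑ * κ p.1 p.2 ∂(μ.prod μ)) ^ (1 / 2 : ℝ) := by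
  -- Up to conjugation, this is the adjoint operator applied to g. Fubini and Cauchy-Schwarz leave
  -- its L² norm to be bounded, and expanding |Γ|² as a double integral brings in the kernel of TT*.
  set Γ : Ω → ℂ := fun ω => ∫ t, g t * e t ω ∂μ with hΓ
  have hgem : Measurable (Function.uncurry fun (t : α) (ω : Ω) => g t * e t ω) := by
    exact (hg.comp measurable_fst).mul he
  have hΓm : StronglyMeasurable Γ := by
    apply StronglyMeasurable.integral_prod_right
    exact (hgem.comp measurable_swap).stronglyMeasurable
  have hswap : ∫ t, g t * ∫ ω, e t ω * k ω ∂ρ ∂μ = ∫ ω, k ω * Γ ω ∂ρ := by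
    have h1 : ∀ t, g t * ∫ ω, e t ω * k ω ∂ρ = ∫ ω, (g t * e t ω) * k ω ∂ρ := fun t => by
      rw [← integral_const_mul]; simp only [mul_assoc]
    simp only [h1]
    rw [integral_integral_swap]
    · refine integral_congr_ae (ae_of_all _ fun ω => ?_)
      simp only [hΓ]
      rw [integral_mul_const, mul_comm]
    · have h2 : Integrable (fun p : α × Ω => k p.2) (μ.prod ρ) := hk.comp_snd μ
      refine h2.bdd_mul (c := |B'| * |B|) hgem.aestronglyMeasurable (ae_of_all _ fun p => ?_)
      rw [norm_mul]
      gcongr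
      · exact (hgB _).trans (le_abs_self _)
      · exact (heB _ _).trans (le_abs_self _)
  have hΓΓ : ∫⁻ ω, ‖Γ ω‖ₑ ^ (2 : ℝ) ∂ρ ≤
      ∫⁻ p, ‖g p.1‖ₑ * ‖g p.2‖ₑ * κ p.1 p.2 ∂(μ.prod μ) := by
    set q : Ω → (α × α) → ℂ := fun ω p =>
      (g p.1 * e p.1 ω) * (starRingEnd ℂ) (g p.2 * e p.2 ω) with hq
    have hqm : Measurable (Function.uncurry q) := by
      have h1 : Measurable fun z : Ω × (α × α) => g z.2.1 * e z.2.1 z.1 :=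
        hgem.comp (measurable_snd.fst.prodMk measurable_fst)
      have h2 : Measurable fun z : Ω × (α × α) => g z.2.2 * e z.2.2 z.1 :=
        hgem.comp (measurable_snd.snd.prodMk measurable_fst)
      exact h1.mul (Complex.continuous_conj.measurable.comp h2)
    have hqi : Integrable (Function.uncurry q) (ρ.prod (μ.prod μ)) := by
      refine Integrable.of_bound hqm.aestronglyMeasurable ((|B'| * |B|) * (|B'| * |B|))
        (ae_of_all _ fun z => ?_)
      have h1 : ∀ t ω, ‖g t * e t ω‖ ≤ |B'| * |B| := fun t ω => by
        rw [norm_mul]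
        gcongr
        · exact (hgB _).trans (le_abs_self _)
        · exact (heB _ _).trans (le_abs_self _)
      simp only [Function.uncurry, hq]
      rw [norm_mul, RCLike.norm_conj]
      gcongr <;> exact h1 _ _
    have hsq : ∀ ω, ((‖Γ ω‖ ^ 2 : ℝ) : ℂ) = ∫ p, q ω p ∂(μ.prod μ) := fun ω => by
      have h1 : (starRingEnd ℂ) (Γ ω) = ∫ s, (starRingEnd ℂ) (g s * e s ω) ∂μ := by
        rw [integral_conj]
      rw [hq]
      simp only
      rw [integral_prod_mul (fun t => g t * e t ω) (fun s => (starRingEnd ℂ) (g s * e s ω)), ← h1,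
        Complex.mul_conj, Complex.normSq_eq_norm_sq]
    have hΓi : Integrable (fun ω => ‖Γ ω‖ ^ 2) ρ := by
      have := hqi.integral_prod_left
      simp only [Function.uncurry] at this
      rw [integrable_congr (ae_of_all _ fun ω => (hsq ω).symm)] at this
      have h2 := this.re
      simp only [RCLike.re_eq_complex_re, Complex.ofReal_re] at h2
      exact h2
    have h1 : ∫⁻ ω, ‖Γ ω‖ₑ ^ (2 : ℝ) ∂ρ = ‖∫ ω, ((‖Γ ω‖ ^ 2 : ℝ) : ℂ) ∂ρ‖ₑ := by
      rw [integral_complex_ofReal, ← ofReal_norm, Complex.norm_real, Real.norm_of_nonneg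
        (integral_nonneg fun _ => by positivity),
        ofReal_integral_eq_lintegral_ofReal hΓi (ae_of_all _ fun _ => by positivity)]
      refine lintegral_congr fun ω => ?_
      rw [ENNReal.ofReal_pow (norm_nonneg _), ofReal_norm]
      norm_cast
    rw [h1]
    simp only [hsq]
    rw [integral_integral_swap hqi]
    refine (enorm_integral_le_lintegral_enorm _).trans (lintegral_mono fun p => ?_)
    have h2 : ∫ ω, q ω p ∂ρ = (g p.1 * (starRingEnd ℂ) (g p.2)) *
        ∫ ω, e p.1 ω * (starRingEnd ℂ) (e p.2 ω) ∂ρ := by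
      rw [← integral_const_mul]
      refine integral_congr_ae (ae_of_all _ fun ω => ?_)
      simp only [hq, map_mul]
      ring
    rw [h2, enorm_mul, enorm_mul, RCLike.enorm_conj]
    gcongr
    exact hκ _ _
  rw [hswap]
  calc ‖∫ ω, k ω * Γ ω ∂ρ‖ₑ ≤ ∫⁻ ω, ‖k ω * Γ ω‖ₑ ∂ρ := enorm_integral_le_lintegral_enorm _
    _ = ∫⁻ ω, ((fun ω => ‖k ω‖ₑ) * fun ω => ‖Γ ω‖ₑ) ω ∂ρ := by simp only [enorm_mul, Pi.mul_apply]
    _ ≤ (∫⁻ ω, ‖k ω‖ₑ ^ (2 : ℝ) ∂ρ) ^ (1 / 2 : ℝ) * (∫⁻ ω, ‖Γ ω‖ₑ ^ (2 : ℝ) ∂ρ) ^ (1 / 2 : ℝ) :=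
      ENNReal.lintegral_mul_le_Lp_mul_Lq ρ Real.HolderConjugate.two_two
        hk.aestronglyMeasurable.enorm hΓm.aestronglyMeasurable.enorm
    _ ≤ _ := by gcongr

/-- The `TT*` argument: a bilinear bound on the kernel `κ` of `TT*` gives an `L^P` bound on `T`. -/
lemma lintegral_enorm_rpow_le_of_bilinear {e : α → Ω → ℂ} (he : Measurable (Function.uncurry e))
    {B : ℝ} (heB : ∀ t ω, ‖e t ω‖ ≤ B) {κ : α → α → ℝ≥0∞}
    (hκ : ∀ t s, ‖∫ ω, e t ω * (starRingEnd ℂ) (e s ω) ∂ρ‖ₑ ≤ κ t s) {P : ℝ} (hP : 2 < P)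
    {K : ℝ≥0∞} (hK : ∀ h : α → ℝ≥0∞, Measurable h →
      ∫⁻ p, h p.1 * h p.2 * κ p.1 p.2 ∂(μ.prod μ) ≤
        K ^ (2 / P) * (∫⁻ t, h t ^ (P / (P - 1)) ∂μ) ^ (2 * (1 - 1 / P)))
    {k : Ω → ℂ} (hk : Integrable k ρ) :
    (∫⁻ t, ‖∫ ω, e t ω * k ω ∂ρ‖ₑ ^ P ∂μ) ^ (1 / P) ≤
      (∫⁻ ω, ‖k ω‖ₑ ^ (2 : ℝ) ∂ρ) ^ (1 / 2 : ℝ) * K ^ (1 / P) := by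
  obtain ⟨k', hk'm, hkk'⟩ := hk.aestronglyMeasurable
  have hP0 : 0 < P := by linarith
  have hvk' : ∀ t, ∫ ω, e t ω * k ω ∂ρ = ∫ ω, e t ω * k' ω ∂ρ := fun t =>
    integral_congr_ae (by filter_upwards [hkk'] with ω hω; rw [hω])
  set v : α → ℂ := fun t => ∫ ω, e t ω * k ω ∂ρ with hv
  have hvm : Measurable v := by
    have : v = fun t => ∫ ω, e t ω * k' ω ∂ρ := funext hvk'
    rw [this]
    refine StronglyMeasurable.measurable (StronglyMeasurable.integral_prod_right ?_)
    exact (he.mul (hk'm.measurable.comp measurable_snd)).stronglyMeasurable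
  set V : ℝ := |B| * ∫ ω, ‖k ω‖ ∂ρ with hV
  have hvB : ∀ t, ‖v t‖ ≤ V := fun t => by
    rw [hV, ← integral_const_mul]
    refine norm_integral_le_of_norm_le (hk.norm.const_mul _) (ae_of_all _ fun ω => ?_)
    rw [norm_mul]
    gcongr
    exact (heB _ _).trans (le_abs_self _)
  have hV0 : 0 ≤ V := by positivity
  set I : ℝ≥0∞ := ∫⁻ t, ‖v t‖ₑ ^ P ∂μ with hI
  -- Finiteness is what allows the division by a power of `I` at the end; it comes from the
  -- boundedness of the kernel and the finite measure in time.
  have hIfin : I ≠ ∞ := by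
    refine ne_top_of_le_ne_top ?_ (lintegral_mono (g := fun _ => ENNReal.ofReal V ^ P) fun t => ?_)
    · rw [lintegral_const]
      exact ENNReal.mul_ne_top (by finiteness) (measure_ne_top _ _)
    · rw [← ofReal_norm]
      exact ENNReal.rpow_le_rpow (ENNReal.ofReal_le_ofReal (hvB t)) hP0.le
  -- The extremal function of the duality between L^P and its dual: g v = |v|^P, and |g| to the dual
  -- exponent is again |v|^P.
  set g : α → ℂ := fun t => ((‖v t‖ ^ (P - 2) : ℝ) : ℂ) * (starRingEnd ℂ) (v t) with hg
  have hgm : Measurable g := by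
    have : Measurable fun t => (starRingEnd ℂ) (v t) := Complex.continuous_conj.measurable.comp hvm
    fun_prop
  have hgn : ∀ t, ‖g t‖ = ‖v t‖ ^ (P - 1) := fun t => by
    rw [hg]
    simp only
    rw [norm_mul, RCLike.norm_conj, Complex.norm_real, Real.norm_of_nonneg (by positivity)]
    nth_rewrite 2 [← Real.rpow_one ‖v t‖]
    rw [← Real.rpow_add_of_nonneg (norm_nonneg _) (by linarith) (by norm_num)]
    congr 1; ring
  have hge : ∀ t, ‖g t‖ₑ = ‖v t‖ₑ ^ (P - 1) := fun t => by
    rw [← ofReal_norm, hgn, ← ENNReal.ofReal_rpow_of_nonneg (norm_nonneg _) (by linarith),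
      ofReal_norm]
  have hgB : ∀ t, ‖g t‖ ≤ V ^ (P - 1) := fun t => by
    rw [hgn]
    have := hvB t
    gcongr
    linarith
  have hgv : ∀ t, g t * v t = ((‖v t‖ ^ P : ℝ) : ℂ) := fun t => by
    rw [hg]
    simp only
    rw [mul_assoc, mul_comm _ (v t), Complex.mul_conj, Complex.normSq_eq_norm_sq,
      ← Complex.ofReal_mul]
    congr 1
    rw [← Real.rpow_natCast, ← Real.rpow_add_of_nonneg (norm_nonneg _) (by linarith) (by norm_num)]
    congr 1; push_cast; ring
  have hIg : I = ‖∫ t, g t * v t ∂μ‖ₑ := by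
    simp only [hgv]
    have hInt : Integrable (fun t => ‖v t‖ ^ P) μ := by
      refine Integrable.of_bound (hvm.norm.pow_const P).aestronglyMeasurable (V ^ P) (ae_of_all _ fun t => ?_)
      rw [Real.norm_of_nonneg (by positivity)]
      have := hvB t
      gcongr
    rw [integral_complex_ofReal, ← ofReal_norm, Complex.norm_real, Real.norm_of_nonneg
      (integral_nonneg fun _ => by positivity),
      ofReal_integral_eq_lintegral_ofReal hInt (ae_of_all _ fun _ => by positivity)]
    refine lintegral_congr fun t => ?_
    rw [← ENNReal.ofReal_rpow_of_nonneg (norm_nonneg _) hP0.le, ofReal_norm]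
  have hmain := enorm_integral_mul_integral_le (μ := μ) he heB hκ hgm hgB hk
  rw [← hIg] at hmain
  have hKb := hK (fun t => ‖g t‖ₑ) (by fun_prop)
  have hIeq : ∫⁻ t, ‖g t‖ₑ ^ (P / (P - 1)) ∂μ = I := by
    refine lintegral_congr fun t => ?_
    rw [hge, ← ENNReal.rpow_mul]
    congr 1
    have : P - 1 ≠ 0 := by linarith
    field_simp
  rw [hIeq] at hKb
  set N : ℝ≥0∞ := (∫⁻ ω, ‖k ω‖ₑ ^ (2 : ℝ) ∂ρ) ^ (1 / 2 : ℝ) with hN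
  have h2 : I ≤ N * K ^ (1 / P) * I ^ (1 - 1 / P) := by
    refine hmain.trans ?_
    rw [mul_assoc]
    gcongr
    calc _ ≤ (K ^ (2 / P) * I ^ (2 * (1 - 1 / P))) ^ (1 / 2 : ℝ) := by gcongr
      _ = _ := by
        rw [ENNReal.mul_rpow_of_nonneg _ _ (by norm_num), ← ENNReal.rpow_mul, ← ENNReal.rpow_mul]
        congr 2 <;> ring
  rcases eq_or_ne I 0 with h0 | h0
  · rw [h0, ENNReal.zero_rpow_of_pos (by positivity)]; exact zero_le
  · have hsplit : I = I ^ (1 / P) * I ^ (1 - 1 / P) := by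
      rw [← ENNReal.rpow_add _ _ h0 hIfin]
      simp
    have hne : I ^ (1 - 1 / P) ≠ 0 := by simp [h0, hIfin]
    have hne' : I ^ (1 - 1 / P) ≠ ∞ := by
      apply ENNReal.rpow_ne_top_of_nonneg _ hIfin
      rw [sub_nonneg, div_le_one hP0]; linarith
    rw [← ENNReal.mul_le_mul_iff_left hne hne', ← hsplit]
    exact h2

end TTStar

/-! ### Young's inequality and the time decay profile -/

/-- Young's inequality for a convolution kernel, in bilinear form. -/
lemma lintegral_mul_mul_conv_le {κ h : ℝ → ℝ≥0∞} (hκ : Measurable κ) (hh : Measurable h) {P : ℝ}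
    (hP : 2 < P) :
    ∫⁻ p : ℝ × ℝ, h p.1 * h p.2 * κ (p.1 - p.2) ≤
      (∫⁻ u, κ u ^ (P / 2)) ^ (2 / P) * (∫⁻ t, h t ^ (P / (P - 1))) ^ (2 * (1 - 1 / P)) := by
  have hP0 : 0 < P := by linarith
  have hP1 : 0 < P - 1 := by linarith
  set P' := P / (P - 1) with hP'
  have hP'0 : 0 < P' := by positivity
  -- Three-factor Hölder with weights 1/P, 1/P, 1 - 2/P. The factors are chosen so that κ enters
  -- with total exponent (P/2)(2/P) = 1, and each copy of h with P'(1/P + 1 - 2/P) = 1.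
  set f : Fin 3 → ℝ × ℝ → ℝ≥0∞ := ![fun p => κ (p.1 - p.2) ^ (P / 2) * h p.1 ^ P',
    fun p => κ (p.1 - p.2) ^ (P / 2) * h p.2 ^ P', fun p => h p.1 ^ P' * h p.2 ^ P'] with hf
  set w : Fin 3 → ℝ := ![1 / P, 1 / P, 1 - 2 / P] with hw
  have hw2 : 0 ≤ 1 - 2 / P := by rw [sub_nonneg, div_le_one hP0]; exact hP.le
  have hfm : ∀ i ∈ (Finset.univ : Finset (Fin 3)), AEMeasurable (f i) volume := by
    intro i _
    fin_cases i <;> simp only [hf] <;>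
      · refine Measurable.aemeasurable ?_
        simp
        fun_prop
  have hH := ENNReal.lintegral_prod_norm_pow_le (μ := (volume : Measure (ℝ × ℝ))) Finset.univ hfm
    (p := w) (by simp [hw, Fin.sum_univ_three]; ring)
    (by intro i _; fin_cases i <;> simp [hw]
        · exact hP0.le
        · exact hP0.le
        · simpa using hw2)
  simp only [Fin.prod_univ_three, hf, hw, Matrix.cons_val_zero, Matrix.cons_val_one,
    Matrix.cons_val_two, Matrix.tail_cons, Matrix.head_cons] at hH
  set K := ∫⁻ u, κ u ^ (P / 2) with hK
  set H := ∫⁻ t, h t ^ P' with hH'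
  have i1 : ∫⁻ p : ℝ × ℝ, κ (p.1 - p.2) ^ (P / 2) * h p.1 ^ P' = K * H := by
    rw [Measure.volume_eq_prod, lintegral_prod _ (by fun_prop)]
    have : ∀ t : ℝ, ∫⁻ s, κ (t - s) ^ (P / 2) * h t ^ P' = K * h t ^ P' := fun t => by
      rw [lintegral_mul_const _ (by fun_prop),
        lintegral_sub_left_eq_self (fun u => κ u ^ (P / 2))]
    simp only [this]
    rw [lintegral_const_mul _ (by fun_prop)]
  have i2 : ∫⁻ p : ℝ × ℝ, κ (p.1 - p.2) ^ (P / 2) * h p.2 ^ P' = K * H := by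
    rw [Measure.volume_eq_prod, lintegral_prod_symm _ (by fun_prop)]
    have : ∀ s : ℝ, ∫⁻ t, κ (t - s) ^ (P / 2) * h s ^ P' = K * h s ^ P' := fun s => by
      rw [lintegral_mul_const _ (by fun_prop),
        lintegral_sub_right_eq_self (fun u => κ u ^ (P / 2))]
    simp only [this]
    rw [lintegral_const_mul _ (by fun_prop)]
  have i3 : ∫⁻ p : ℝ × ℝ, h p.1 ^ P' * h p.2 ^ P' = H * H := by
    rw [Measure.volume_eq_prod, lintegral_prod_mul (f := fun t => h t ^ P')
      (g := fun t => h t ^ P') (by fun_prop) (by fun_prop)]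
  rw [i1, i2, i3] at hH
  have hexp : P' * (1 / P) + P' * (1 - 2 / P) = 1 := by
    rw [hP']
    field_simp
    ring
  calc ∫⁻ p : ℝ × ℝ, h p.1 * h p.2 * κ (p.1 - p.2)
      = ∫⁻ p : ℝ × ℝ, (κ (p.1 - p.2) ^ (P / 2) * h p.1 ^ P') ^ (1 / P) *
          (κ (p.1 - p.2) ^ (P / 2) * h p.2 ^ P') ^ (1 / P) *
          (h p.1 ^ P' * h p.2 ^ P') ^ (1 - 2 / P) := by
        refine lintegral_congr fun p => ?_
        have e1 : ∀ a : ℝ≥0∞, (a ^ P') ^ (1 / P) * (a ^ P') ^ (1 - 2 / P) = a := fun a => by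
          rw [← ENNReal.rpow_mul, ← ENNReal.rpow_mul,
            ← ENNReal.rpow_add_of_nonneg _ _ (by positivity) (by positivity), hexp, ENNReal.rpow_one]
        have e2 : ∀ a : ℝ≥0∞, (a ^ (P / 2)) ^ (1 / P) * (a ^ (P / 2)) ^ (1 / P) = a := fun a => by
          rw [← ENNReal.rpow_mul, ← ENNReal.rpow_add_of_nonneg _ _ (by positivity) (by positivity)]
          have : P / 2 * (1 / P) + P / 2 * (1 / P) = 1 := by field_simp; norm_num
          rw [this, ENNReal.rpow_one]
        have hp : 0 ≤ 1 / P := by positivity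
        rw [ENNReal.mul_rpow_of_nonneg _ _ hp, ENNReal.mul_rpow_of_nonneg _ _ hp,
          ENNReal.mul_rpow_of_nonneg _ _ hw2]
        calc _ = h p.1 * h p.2 * κ (p.1 - p.2) := rfl
          _ = ((h p.1 ^ P') ^ (1 / P) * (h p.1 ^ P') ^ (1 - 2 / P)) *
              ((h p.2 ^ P') ^ (1 / P) * (h p.2 ^ P') ^ (1 - 2 / P)) *
              ((κ (p.1 - p.2) ^ (P / 2)) ^ (1 / P) * (κ (p.1 - p.2) ^ (P / 2)) ^ (1 / P)) := by
            rw [e1, e1, e2]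
          _ = _ := by ring
    _ ≤ _ := hH
    _ = _ := by
      have hp : 0 ≤ 1 / P := by positivity
      rw [ENNReal.mul_rpow_of_nonneg _ _ hp, ENNReal.mul_rpow_of_nonneg _ _ hw2]
      have e1 : K ^ (1 / P) * K ^ (1 / P) = K ^ (2 / P) := by
        rw [← ENNReal.rpow_add_of_nonneg _ _ hp hp]; congr 1; ring
      have e2 : (H ^ (1 / P) * H ^ (1 / P)) * (H ^ (1 - 2 / P) * H ^ (1 - 2 / P)) =
          H ^ (2 * (1 - 1 / P)) := by
        rw [← ENNReal.rpow_add_of_nonneg _ _ hp hp, ← ENNReal.rpow_add_of_nonneg _ _ hw2 hw2,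
          ← ENNReal.rpow_add_of_nonneg _ _ (by positivity) (by positivity)]
        congr 1; ring
      rw [← e1, ← e2]
      ring

/-- The profile `min(1, |u|^{-1/4})` of the dispersive decay. -/
def decayProfile (u : ℝ) : ℝ≥0∞ :=
  if |u| ≤ 1 then 1 else ENNReal.ofReal (|u| ^ (-(1 / 4) : ℝ))

lemma measurable_decayProfile : Measurable decayProfile :=
  Measurable.ite (measurableSet_le (by fun_prop) measurable_const) measurable_const (by fun_prop)

/-- The tail is |u|^(-P/8), integrable exactly for P > 8. Each half-line contributes 1 + 1/(P/8 - 1)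
= 1/(1 - 8/P). -/
lemma lintegral_decayProfile_rpow_le {P : ℝ} (hP : 8 < P) :
    ∫⁻ u, decayProfile u ^ (P / 2) ≤ ENNReal.ofReal (2 / (1 - 8 / P)) := by
  have hP0 : 0 < P := by linarith
  set G : ℝ → ℝ≥0∞ := fun u => decayProfile u ^ (P / 2) with hG
  have hGm : Measurable G := measurable_decayProfile.pow_const _
  have hGe : ∀ u, G (-u) = G u := fun u => by simp [hG, decayProfile]
  have h1 : ∫⁻ u in Ioi (0 : ℝ), G u ≤ ENNReal.ofReal (1 / (1 - 8 / P)) := by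
    have hsub : Ioi (0 : ℝ) = Ioc 0 1 ∪ Ioi 1 := (Ioc_union_Ioi_eq_Ioi zero_le_one).symm
    rw [hsub]
    refine (lintegral_union_le _ _ _).trans ?_
    have a1 : ∫⁻ u in Ioc (0 : ℝ) 1, G u = 1 := by
      rw [setLIntegral_congr_fun (g := fun _ => 1) measurableSet_Ioc]
      · simp
      · intro u hu
        simp only [hG, decayProfile]
        rw [if_pos (by rw [abs_of_pos hu.1]; exact hu.2), ENNReal.one_rpow]
    have hlt : -(P / 8) < -1 := by linarith
    have a2 : ∫⁻ u in Ioi (1 : ℝ), G u = ENNReal.ofReal (1 / (P / 8 - 1)) := by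
      have h2 : ∫ u in Ioi (1 : ℝ), u ^ (-(P / 8)) = 1 / (P / 8 - 1) := by
        rw [integral_Ioi_rpow_of_lt hlt one_pos, Real.one_rpow, ← neg_div_neg_eq]
        congr 1 <;> ring
      rw [← h2, ofReal_integral_eq_lintegral_ofReal
        (integrableOn_Ioi_rpow_of_lt hlt one_pos)]
      · refine setLIntegral_congr_fun measurableSet_Ioi fun u hu => ?_
        have hu' : (1 : ℝ) < u := hu
        have hu0 : 0 < u := by linarith
        simp only [hG, decayProfile]
        rw [if_neg (by rw [abs_of_pos hu0]; linarith), abs_of_pos hu0,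
          ENNReal.ofReal_rpow_of_pos (by positivity), ← Real.rpow_mul hu0.le]
        congr 2
        ring
      · refine (ae_restrict_iff' measurableSet_Ioi).2 (ae_of_all _ fun u hu => ?_)
        have : (0 : ℝ) < u := lt_trans one_pos hu
        positivity
    rw [a1, a2, ← ENNReal.ofReal_one, ← ENNReal.ofReal_add zero_le_one
      (by apply div_nonneg zero_le_one; linarith)]
    apply ENNReal.ofReal_le_ofReal
    have : P - 8 ≠ 0 := by linarith
    have h3 : P / 8 - 1 ≠ 0 := by linarith
    have h4 : 1 - 8 / P ≠ 0 := by
      rw [sub_ne_zero]; intro h; rw [eq_div_iff hP0.ne'] at h; linarith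
    apply le_of_eq
    field_simp
    ring
  have h2 : ∫⁻ u in Iic (0 : ℝ), G u = ∫⁻ u in Ioi (0 : ℝ), G u := by
    rw [← Measure.restrict_congr_set (Ioi_ae_eq_Ici : Ioi (0 : ℝ) =ᵐ[volume] Ici 0).symm]
    have := (Measure.measurePreserving_neg (volume : Measure ℝ)).setLIntegral_comp_preimage
      (s := Ici 0) measurableSet_Ici hGm
    simp only [hGe] at this
    rw [← this]
    congr 2
    ext u; simp
  have hsplit := lintegral_add_compl G (μ := volume) (measurableSet_Ioi (a := (0 : ℝ)))
  rw [compl_Ioi, h2] at hsplit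
  rw [← hsplit, ← two_mul]
  calc 2 * ∫⁻ u in Ioi (0 : ℝ), G u ≤ 2 * ENNReal.ofReal (1 / (1 - 8 / P)) := by gcongr
    _ = _ := by
      rw [← ENNReal.ofReal_ofNat 2, ← ENNReal.ofReal_mul (by norm_num)]
      congr 1; ring

lemma lintegral_decayProfile_mul_rpow_le {P b : ℝ} (hP : 8 < P) (hb : b ≠ 0) {D : ℝ} (hD : 0 ≤ D) :
    ∫⁻ t, (ENNReal.ofReal D * decayProfile (b * t)) ^ (P / 2) ≤
      ENNReal.ofReal (D ^ (P / 2) * (2 / (|b| * (1 - 8 / P)))) := by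
  have hP0 : 0 < P := by linarith
  have hp : 0 ≤ P / 2 := by positivity
  have h8 : 0 < 1 - 8 / P := by rw [sub_pos, div_lt_one hP0]; exact hP
  have hsc : ∫⁻ t, decayProfile (b * t) ^ (P / 2) =
      ENNReal.ofReal |b⁻¹| * ∫⁻ u, decayProfile u ^ (P / 2) := by
    have h1 := Real.map_volume_mul_left hb
    have h2 := lintegral_map (μ := volume) (measurable_decayProfile.pow_const (P / 2))
      (measurable_const_mul b)
    rw [h1, lintegral_smul_measure] at h2
    exact h2.symm
  have hm : Measurable fun t => decayProfile (b * t) ^ (P / 2) :=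
    (measurable_decayProfile.comp (measurable_const_mul b)).pow_const _
  simp only [ENNReal.mul_rpow_of_nonneg _ _ hp]
  rw [lintegral_const_mul _ hm, hsc, ENNReal.ofReal_rpow_of_nonneg hD hp]
  calc _ ≤ ENNReal.ofReal (D ^ (P / 2)) * (ENNReal.ofReal |b⁻¹| *
        ENNReal.ofReal (2 / (1 - 8 / P))) := by
        gcongr; exact lintegral_decayProfile_rpow_le hP
    _ = _ := by
      rw [← ENNReal.ofReal_mul (by positivity), ← ENNReal.ofReal_mul (by positivity), abs_inv]
      congr 1
      have : |b| ≠ 0 := abs_ne_zero.2 hb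
      field_simp

/-! ### Cut-offs -/

namespace IsLPCutoff

variable {ψ : Space → ℝ}

lemma eq_one_of_norm_le (hψ : IsLPCutoff ψ) {ω : Space} (hω : ‖ω‖ ≤ 3 / 4) : ψ ω = 1 :=
  hψ.eq_one.self_of_nhdsSet ω (by simpa using hω)

lemma eq_zero_of_lt_norm (hψ : IsLPCutoff ψ) {ω : Space} (hω : 4 / 3 < ‖ω‖) : ψ ω = 0 := by
  by_contra h
  have := hψ.support (subset_tsupport ψ (Function.mem_support.2 h))
  simp at this
  linarith

end IsLPCutoff

/-- A cut-off equal to `1` on the Littlewood-Paley annulus. -/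
def wideCutoff (ψ : Space → ℝ) (ω : Space) : ℝ := ψ ((4 : ℝ)⁻¹ • ω) - ψ ((2 : ℝ) • ω)

section WideCutoff

variable {ψ : Space → ℝ}

lemma wideCutoff_eq_zero (hψ : IsLPCutoff ψ) {ω : Space} (hω : ‖ω‖ < 3 / 8 ∨ 16 / 3 < ‖ω‖) :
    wideCutoff ψ ω = 0 := by
  unfold wideCutoff
  rcases hω with h | h
  · rw [hψ.eq_one_of_norm_le, hψ.eq_one_of_norm_le, sub_self]
    · rw [norm_smul]; norm_num; linarith
    · rw [norm_smul]; norm_num; linarith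
  · rw [hψ.eq_zero_of_lt_norm, hψ.eq_zero_of_lt_norm, sub_self]
    · rw [norm_smul]; norm_num; linarith
    · rw [norm_smul]; norm_num; linarith

lemma wideCutoff_eq_one (hψ : IsLPCutoff ψ) {ω : Space} (h1 : 3 / 4 ≤ ‖ω‖) (h2 : ‖ω‖ ≤ 8 / 3) :
    wideCutoff ψ ω = 1 := by
  unfold wideCutoff
  rw [hψ.eq_one_of_norm_le, hψ.eq_zero_of_lt_norm, sub_zero]
  · rw [norm_smul]; norm_num; linarith
  · rw [norm_smul]; norm_num; linarith

lemma norm_bounds_of_wideCutoff_ne_zero (hψ : IsLPCutoff ψ) {ω : Space} (h : wideCutoff ψ ω ≠ 0) :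
    3 / 8 ≤ ‖ω‖ ∧ ‖ω‖ ≤ 16 / 3 := by
  by_contra hn
  apply h
  apply wideCutoff_eq_zero hψ
  by_contra hn'
  rw [not_or, not_lt, not_lt] at hn'
  exact hn hn'

lemma contDiff_wideCutoff (hψ : IsLPCutoff ψ) : ContDiff ℝ 1 (wideCutoff ψ) := by
  have h : ContDiff ℝ 1 ψ := hψ.smooth.of_le (by exact_mod_cast le_top)
  exact (h.comp (by fun_prop)).sub (h.comp (by fun_prop))

lemma hasCompactSupport_wideCutoff (hψ : IsLPCutoff ψ) : HasCompactSupport (wideCutoff ψ) :=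
  HasCompactSupport.intro (isCompact_closedBall 0 (16 / 3)) fun ω hω => by
    apply wideCutoff_eq_zero hψ
    right
    simpa using hω

lemma exists_wideCutoff_bounds (hψ : IsLPCutoff ψ) :
    ∃ B : ℝ, 0 ≤ B ∧ ∀ ω, |wideCutoff ψ ω| ≤ B ∧ ‖fderiv ℝ (wideCutoff ψ) ω‖ ≤ B := by
  obtain ⟨B1, h1⟩ := (contDiff_wideCutoff hψ).continuous.bounded_above_of_compact_support
    (hasCompactSupport_wideCutoff hψ)
  obtain ⟨B2, h2⟩ := ((contDiff_wideCutoff hψ).continuous_fderiv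
    one_ne_zero).bounded_above_of_compact_support ((hasCompactSupport_wideCutoff hψ).fderiv ℝ)
  exact ⟨max B1 B2, (norm_nonneg _).trans ((h1 0).trans (le_max_left _ _)), fun ω =>
    ⟨(h1 ω).trans (le_max_left _ _), (h2 ω).trans (le_max_right _ _)⟩⟩

/-- The damped cut-off `χ² exp(-T (|ω|² - 1/8))`. -/
def dampedCutoff (ψ : Space → ℝ) (T : ℝ) (ω : Space) : ℝ :=
  wideCutoff ψ ω ^ 2 * Real.exp (-T * (‖ω‖ ^ 2 - 1 / 8))

/-- On the support |ω|² ≥ 9/64, which exceeds 1/8 by 1/64: this margin gives decay exp(-T/64),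
enough to absorb the factor T produced by one derivative. -/
lemma exp_damping_le (hψ : IsLPCutoff ψ) {T : ℝ} (hT : 0 ≤ T) {ω : Space}
    (h : wideCutoff ψ ω ≠ 0) :
    Real.exp (-T * (‖ω‖ ^ 2 - 1 / 8)) ≤ 1 ∧ T * Real.exp (-T * (‖ω‖ ^ 2 - 1 / 8)) ≤ 64 := by
  have h1 := (norm_bounds_of_wideCutoff_ne_zero hψ h).1
  have h2 : (1 : ℝ) / 64 ≤ ‖ω‖ ^ 2 - 1 / 8 := by nlinarith
  have h3 : Real.exp (-T * (‖ω‖ ^ 2 - 1 / 8)) ≤ Real.exp (-(T / 64)) := by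
    apply Real.exp_le_exp.2
    nlinarith
  have h4 : T / 64 * Real.exp (-(T / 64)) ≤ 1 := by
    have := Real.add_one_le_exp (T / 64)
    rw [Real.exp_neg, ← div_eq_mul_inv, div_le_one (Real.exp_pos _)]
    linarith
  refine ⟨h3.trans (Real.exp_le_one_iff.2 (by linarith [div_nonneg hT (by norm_num : (0:ℝ) ≤ 64)])), ?_⟩
  calc _ ≤ T * Real.exp (-(T / 64)) := by gcongr
    _ ≤ 64 := by linarith

/-- Uniformity in T is the point: TT* produces dampings T = ν(t + s) of all sizes, and the
dispersive estimate must apply to all of them with one constant. The T created by differentiating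
the exponential is controlled by `exp_damping_le`. -/
lemma exists_isAmplitude_dampedCutoff (hψ : IsLPCutoff ψ) :
    ∃ A : ℝ, ∀ T : ℝ, 0 ≤ T → IsAmplitude 6 A (dampedCutoff ψ T) := by
  obtain ⟨B, hB, hb⟩ := exists_wideCutoff_bounds hψ
  -- The first B² bounds the function. In the bracket, 64 bounds T times the exponential and 12
  -- bounds 2|ω| on the ball of radius 6, while 2·B·B comes from differentiating the squared
  -- cut-off.
  refine ⟨B ^ 2 + (B ^ 2 * (64 * 12) + 2 * B * B), fun T hT => ?_⟩
  have hχ := contDiff_wideCutoff hψ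
  refine ⟨?_, fun ω => ?_, fun ω => ?_, fun ω hω => ?_⟩
  · have h1 : ContDiff ℝ 1 fun ω : Space => ‖ω‖ ^ 2 := contDiff_norm_sq ℝ
    unfold dampedCutoff
    fun_prop
  · by_cases h : wideCutoff ψ ω = 0
    · simp [dampedCutoff, h]; positivity
    · obtain ⟨e1, -⟩ := exp_damping_le hψ hT h
      have h2 : |wideCutoff ψ ω| ^ 2 ≤ B ^ 2 := by gcongr; exact (hb ω).1
      rw [dampedCutoff, abs_mul, abs_pow, abs_of_pos (Real.exp_pos _)]
      calc _ ≤ B ^ 2 * 1 := by gcongr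
        _ ≤ _ := by rw [mul_one]; exact le_add_of_nonneg_right (by positivity)
  · have d1 : HasFDerivAt (fun ω => wideCutoff ψ ω ^ 2)
        ((2 * wideCutoff ψ ω) • fderiv ℝ (wideCutoff ψ) ω) ω := by
      have := ((hχ.differentiable one_ne_zero) ω).hasFDerivAt.pow 2
      refine this.congr_fderiv ?_
      simp
    have d2 : HasFDerivAt (fun ω : Space => Real.exp (-T * (‖ω‖ ^ 2 - 1 / 8)))
        (Real.exp (-T * (‖ω‖ ^ 2 - 1 / 8)) • ((-T) • (2 • innerSL ℝ ω))) ω :=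
      ((((hasStrictFDerivAt_norm_sq ω).hasFDerivAt).sub_const (1 / 8)).const_mul (-T)).exp
    have d3 := d1.mul d2
    have d4 : fderiv ℝ (dampedCutoff ψ T) ω = _ := d3.fderiv
    rw [d4]
    by_cases h : wideCutoff ψ ω = 0
    · simp [h]; positivity
    · obtain ⟨e1, e2⟩ := exp_damping_le hψ hT h
      obtain ⟨-, hn⟩ := norm_bounds_of_wideCutoff_ne_zero hψ h
      obtain ⟨b1, b2⟩ := hb ω
      set E := Real.exp (-T * (‖ω‖ ^ 2 - 1 / 8)) with hE
      have hE0 : 0 < E := Real.exp_pos _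
      have n1 : ‖(wideCutoff ψ ω ^ 2) • (E • ((-T) • (2 • innerSL ℝ ω)))‖ ≤ B ^ 2 * (64 * 12) := by
        have h2 : ‖(2 • innerSL ℝ ω : Space →L[ℝ] ℝ)‖ ≤ 12 := by
          refine (norm_nsmul_le (n := 2) (a := innerSL ℝ ω)).trans ?_
          rw [innerSL_apply_norm]
          push_cast
          linarith
        rw [norm_smul, norm_smul, norm_smul, norm_pow, Real.norm_eq_abs, Real.norm_eq_abs,
          Real.norm_eq_abs, abs_of_pos hE0, abs_neg, abs_of_nonneg hT, ← mul_assoc E T]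
        have h3 : E * T ≤ 64 := by rw [mul_comm]; exact e2
        gcongr
      have n2 : ‖E • ((2 * wideCutoff ψ ω) • fderiv ℝ (wideCutoff ψ) ω)‖ ≤ 2 * B * B := by
        rw [norm_smul, norm_smul, Real.norm_eq_abs, Real.norm_eq_abs, abs_of_pos hE0, abs_mul,
          abs_two]
        calc _ ≤ 1 * (2 * B * B) := by gcongr
          _ = _ := one_mul _
      calc _ ≤ _ := norm_add_le _ _
        _ ≤ B ^ 2 * (64 * 12) + 2 * B * B := add_le_add n1 n2
        _ ≤ _ := le_add_of_nonneg_left (by positivity)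
  · rw [dampedCutoff, wideCutoff_eq_zero hψ (Or.inr (by linarith))]
    simp

end WideCutoff

/-! ### The scalar evolution, frequency localized near the unit sphere -/

/-- The multiplier of the oscillating, damped scalar evolution. The damping is normalized so that
`exp(-ν t / 8)` can be factored out. -/
def evolSymbol (F b ν t : ℝ) (ω : Space) : ℂ :=
  Complex.exp ((t * (b * phase F ω) : ℝ) * Complex.I) *
    (Real.exp (-(ν * t) * (‖ω‖ ^ 2 - 1 / 8)) : ℂ)

/-- The scalar evolution with Fourier data `k`. -/
def evol (F b ν : ℝ) (k : Space → ℂ) (t : ℝ) (x : Space) : ℂ :=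
  ∫ ω, Complex.exp ((inner ℝ x ω : ℝ) * Complex.I) * (evolSymbol F b ν t ω * k ω)

lemma measurable_evolSymbol (F b ν : ℝ) :
    Measurable fun p : ℝ × Space => evolSymbol F b ν p.1 p.2 := by
  have := measurable_phase F
  unfold evolSymbol
  fun_prop

lemma norm_evolSymbol (F b ν t : ℝ) (ω : Space) :
    ‖evolSymbol F b ν t ω‖ = Real.exp (-(ν * t) * (‖ω‖ ^ 2 - 1 / 8)) := by
  rw [evolSymbol, norm_mul, Complex.norm_exp_ofReal_mul_I, one_mul, Complex.norm_real,
    Real.norm_of_nonneg (Real.exp_pos _).le]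

lemma measurable_evol (F b ν : ℝ) {k : Space → ℂ} (hk : Measurable k) :
    Measurable fun p : ℝ × Space => evol F b ν k p.1 p.2 := by
  unfold evol
  refine StronglyMeasurable.measurable (StronglyMeasurable.integral_prod_right ?_)
  have h1 : Measurable fun q : (ℝ × Space) × Space => evolSymbol F b ν q.1.1 q.2 :=
    (measurable_evolSymbol F b ν).comp (by fun_prop : Measurable fun q : (ℝ × Space) × Space => (q.1.1, q.2))
  have h2 : Measurable fun q : (ℝ × Space) × Space => k q.2 := hk.comp measurable_snd
  refine Measurable.stronglyMeasurable ?_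
  simp only [Function.uncurry_def]
  exact Measurable.mul (by fun_prop) (h1.mul h2)

/-- `k` vanishes outside of the Littlewood-Paley annulus `{3/4 ≤ |ω| ≤ 8/3}`. -/
def SuppAnnulus (k : Space → ℂ) : Prop := ∀ ω, k ω ≠ 0 → 3 / 4 ≤ ‖ω‖ ∧ ‖ω‖ ≤ 8 / 3

/-- TT* for the operator that evaluates the evolution along an arbitrary measurable path. The kernel
bound does not see the path, so neither does the constant; this is the linearized form of the
estimate for the supremum in space. -/
lemma exists_lintegral_evol_le {ψ : Space → ℝ} (hψ : IsLPCutoff ψ) {F : ℝ} (hF : 0 < F)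
    (hF1 : F ≠ 1) :
    ∃ C : ℝ, 0 ≤ C ∧ ∀ (P b ν : ℝ), 8 < P → b ≠ 0 → 0 ≤ ν → ∀ k : Space → ℂ, Integrable k →
      SuppAnnulus k → ∀ x : ℝ → Space, Measurable x → ∀ N : ℝ,
      (∫⁻ t in Icc 0 N, ‖evol F b ν k t (x t)‖ₑ ^ P) ^ (1 / P) ≤
        (∫⁻ ω, ‖k ω‖ₑ ^ (2 : ℝ)) ^ (1 / 2 : ℝ) *
          ENNReal.ofReal (C * (2 / (|b| * (1 - 8 / P))) ^ (1 / P)) := by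
  obtain ⟨A, hA⟩ := exists_isAmplitude_dampedCutoff hψ
  obtain ⟨B, hB, hb⟩ := exists_wideCutoff_bounds hψ
  obtain ⟨C0, hC0, hC⟩ := exists_norm_dispKernel_le hF hF1 (R := 6) (by norm_num)
  have hA0 : 0 ≤ A := (hA 0 le_rfl).nonneg
  set D := C0 * A with hD
  have hD0 : 0 ≤ D := by positivity
  -- The constant D of the kernel appears as (D^(P/2))^(1/P) after Young's inequality.
  refine ⟨√D, Real.sqrt_nonneg _, fun P b ν hP hbne hν k hk hks x hx N => ?_⟩
  have hP0 : 0 < P := by linarith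
  have h8 : 0 < 1 - 8 / P := by rw [sub_pos, div_lt_one hP0]; exact hP
  set S := Icc (0 : ℝ) N with hS
  have hSm : MeasurableSet S := measurableSet_Icc
  set Bl := Metric.closedBall (0 : Space) 6 with hBl
  have : IsFiniteMeasure ((volume : Measure Space).restrict Bl) :=
    ⟨by rw [Measure.restrict_apply_univ]; exact measure_closedBall_lt_top⟩
  have : IsFiniteMeasure ((volume : Measure ℝ).restrict S) :=
    ⟨by rw [Measure.restrict_apply_univ]; exact measure_Icc_lt_top⟩
  -- The wide cut-off equals 1 on the support of k, so it may be inserted freely, and it makes e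
  -- bounded. Truncating time at 0 in the damping gives bounds for all real t, as the TT* lemma
  -- demands; nothing changes on [0, N].
  set e : ℝ → Space → ℂ := fun t ω =>
    (wideCutoff ψ ω : ℂ) * (Complex.exp ((inner ℝ (x t) ω + t * (b * phase F ω) : ℝ) * Complex.I) *
      (Real.exp (-(ν * max t 0) * (‖ω‖ ^ 2 - 1 / 8)) : ℂ)) with he
  have hem : Measurable (Function.uncurry e) := by
    have h1 := measurable_phase F
    have h2 := (contDiff_wideCutoff hψ).continuous.measurable
    simp only [he, Function.uncurry_def]
    fun_prop
  have heB : ∀ t ω, ‖e t ω‖ ≤ B := fun t ω => by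
    by_cases h : wideCutoff ψ ω = 0
    · simp [he, h, hB]
    · rw [he]
      simp only
      rw [norm_mul, norm_mul, Complex.norm_exp_ofReal_mul_I, one_mul, Complex.norm_real,
        Complex.norm_real, Real.norm_eq_abs, Real.norm_of_nonneg (Real.exp_pos _).le]
      calc _ ≤ B * 1 := by
            gcongr
            · exact (hb ω).1
            · exact (exp_damping_le hψ (by positivity) h).1
        _ = B := mul_one B
  set κ : ℝ → ℝ≥0∞ := fun u => ENNReal.ofReal D * decayProfile (b * u) with hκ
  have hκm : Measurable κ :=
    (measurable_decayProfile.comp (measurable_const_mul b)).const_mul _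
  have hκb : ∀ t s, ‖∫ ω, e t ω * (starRingEnd ℂ) (e s ω) ∂(volume.restrict Bl)‖ₑ ≤ κ (t - s) := by
    intro t s
    -- Conjugation cancels the oscillation down to t - s but adds the dampings, so TT* is not a
    -- convolution; its majorant depends only on t - s.
    set T := ν * max t 0 + ν * max s 0 with hT
    have hT0 : 0 ≤ T := by positivity
    have hker : ∫ ω, e t ω * (starRingEnd ℂ) (e s ω) ∂(volume.restrict Bl) =
        dispKernel F (dampedCutoff ψ T) (b * (t - s)) (x t - x s) := by
      have h1 : ∀ ω, e t ω * (starRingEnd ℂ) (e s ω) =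
          Complex.exp ((inner ℝ (x t - x s) ω + b * (t - s) * phase F ω : ℝ) * Complex.I) *
            (dampedCutoff ψ T ω : ℂ) := fun ω => by
        simp only [he, map_mul, Complex.conj_ofReal, ← Complex.exp_conj, Complex.conj_I]
        have e1 : ((inner ℝ (x t - x s) ω + b * (t - s) * phase F ω : ℝ) : ℂ) * Complex.I =
            ((inner ℝ (x t) ω + t * (b * phase F ω) : ℝ) : ℂ) * Complex.I +
            ((inner ℝ (x s) ω + s * (b * phase F ω) : ℝ) : ℂ) * -Complex.I := by
          rw [inner_sub_left]; push_cast; ring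
        have e2 : dampedCutoff ψ T ω = wideCutoff ψ ω * wideCutoff ψ ω *
            (Real.exp (-(ν * max t 0) * (‖ω‖ ^ 2 - 1 / 8)) *
              Real.exp (-(ν * max s 0) * (‖ω‖ ^ 2 - 1 / 8))) := by
          rw [dampedCutoff, ← Real.exp_add, sq, hT]
          congr 2; ring
        rw [e1, Complex.exp_add, e2]
        push_cast
        ring
      rw [dispKernel, integral_congr_ae (ae_of_all _ h1)]
      refine setIntegral_eq_integral_of_forall_compl_eq_zero fun ω hω => ?_
      rw [(hA T hT0).eq_indicator ω hω]
      simp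
    rw [hker, hκ]
    simp only [decayProfile]
    obtain ⟨k1, k2⟩ := hC A _ (hA T hT0) (b * (t - s)) (x t - x s)
    split_ifs with hle
    · rw [mul_one, ← ofReal_norm]
      exact ENNReal.ofReal_le_ofReal k1
    · rw [← ENNReal.ofReal_mul hD0, ← ofReal_norm]
      apply ENNReal.ofReal_le_ofReal
      apply k2
      intro h0
      rw [h0] at hle
      simp at hle
  have hYoung : ∀ h : ℝ → ℝ≥0∞, Measurable h →
      ∫⁻ p, h p.1 * h p.2 * κ (p.1 - p.2) ∂((volume.restrict S).prod (volume.restrict S)) ≤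
        (∫⁻ u, κ u ^ (P / 2)) ^ (2 / P) *
          (∫⁻ t, h t ^ (P / (P - 1)) ∂(volume.restrict S)) ^ (2 * (1 - 1 / P)) := by
    intro h hh
    have hP1 : 0 < P - 1 := by linarith
    have := lintegral_mul_mul_conv_le hκm (hh.indicator (measurableSet_Icc (a := 0) (b := N)))
      (P := P) (by linarith)
    have e1 : ∫⁻ t, S.indicator h t ^ (P / (P - 1)) = ∫⁻ t in S, h t ^ (P / (P - 1)) := by
      rw [← lintegral_indicator measurableSet_Icc]
      refine lintegral_congr fun t => ?_
      by_cases ht : t ∈ S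
      · rw [indicator_of_mem ht, indicator_of_mem ht]
      · rw [indicator_of_notMem ht, indicator_of_notMem ht, ENNReal.zero_rpow_of_pos (by positivity)]
    have e2 : ∫⁻ p : ℝ × ℝ, S.indicator h p.1 * S.indicator h p.2 * κ (p.1 - p.2) =
        ∫⁻ p, h p.1 * h p.2 * κ (p.1 - p.2) ∂((volume.restrict S).prod (volume.restrict S)) := by
      rw [Measure.prod_restrict, ← lintegral_indicator (hSm.prod hSm),
        Measure.volume_eq_prod]
      refine lintegral_congr fun p => ?_
      by_cases h1 : p.1 ∈ S <;> by_cases h2 : p.2 ∈ S <;>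
        simp only [indicator_apply, mem_prod, h1, h2, and_self, and_true, and_false, if_true, if_false,
          zero_mul, mul_zero]
    rw [e1, e2] at this
    exact this
  have hkr : Integrable k (volume.restrict Bl) := hk.restrict
  have hTT := lintegral_enorm_rpow_le_of_bilinear hem heB hκb (P := P) (by linarith) hYoung hkr
  have hLHS : ∫⁻ t in S, ‖evol F b ν k t (x t)‖ₑ ^ P =
      ∫⁻ t in S, ‖∫ ω, e t ω * k ω ∂(volume.restrict Bl)‖ₑ ^ P := by
    refine setLIntegral_congr_fun measurableSet_Icc fun t ht => ?_
    congr 2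
    rw [evol, ← setIntegral_eq_integral_of_forall_compl_eq_zero (s := Bl)]
    · refine integral_congr_ae (ae_of_all _ fun ω => ?_)
      simp only
      by_cases h0 : k ω = 0
      · simp [h0]
      · obtain ⟨a1, a2⟩ := hks ω h0
        simp only [he, evolSymbol]
        rw [wideCutoff_eq_one hψ a1 a2, max_eq_left ht.1, Complex.ofReal_add, add_mul,
          Complex.exp_add]
        push_cast
        ring
    · intro ω hω
      have : k ω = 0 := by
        by_contra h0
        apply hω
        rw [hBl, mem_closedBall_zero_iff]
        linarith [(hks ω h0).2]
      simp [this]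
  rw [hLHS]
  refine hTT.trans ?_
  gcongr
  · exact Measure.restrict_le_self
  · calc (∫⁻ u, κ u ^ (P / 2)) ^ (1 / P)
        ≤ (ENNReal.ofReal (D ^ (P / 2) * (2 / (|b| * (1 - 8 / P))))) ^ (1 / P) := by
          gcongr
          exact lintegral_decayProfile_mul_rpow_le hP hbne hD0
      _ = _ := by
        have hb0 : 0 < |b| := abs_pos.2 hbne
        rw [ENNReal.ofReal_rpow_of_nonneg (by positivity) (by positivity),
          Real.mul_rpow (by positivity) (by positivity), ← Real.rpow_mul hD0, Real.sqrt_eq_rpow]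
        congr 3
        field_simp

/-- On the annulus |ω|² > 1/8, so the normalized damping is still at most 1 and |k| dominates.
Continuity is what lets suprema in space be taken over a countable dense set. -/
lemma continuous_evol {F b ν : ℝ} (hν : 0 ≤ ν) {k : Space → ℂ} (hkm : Measurable k)
    (hk : Integrable k) (hks : SuppAnnulus k) {t : ℝ} (ht : 0 ≤ t) :
    Continuous (evol F b ν k t) := by
  have hsm : Measurable (evolSymbol F b ν t) :=
    (measurable_evolSymbol F b ν).comp measurable_prodMk_left
  refine continuous_of_dominated (bound := fun ω => ‖k ω‖) (fun x => ?_) (fun x => ?_) hk.norm ?_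
  · exact Measurable.aestronglyMeasurable (by fun_prop)
  · refine ae_of_all _ fun ω => ?_
    rw [norm_mul, norm_mul, Complex.norm_exp_ofReal_mul_I, one_mul, norm_evolSymbol]
    by_cases h0 : k ω = 0
    · simp [h0]
    · refine mul_le_of_le_one_left (norm_nonneg _) (Real.exp_le_one_iff.2 ?_)
      have := (hks ω h0).1
      have h2 : 0 ≤ ‖ω‖ ^ 2 - 1 / 8 := by nlinarith
      have h3 : 0 ≤ ν * t := by positivity
      nlinarith
  · refine ae_of_all _ fun ω => ?_
    fun_prop

/-! ### From measurable paths to the supremum in space -/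

/-- Measurable selection of approximate maximizers over a countable set of parameters. -/
lemma exists_measurable_selection {X : Type*} [MeasurableSpace X] {u : ℝ → X → ℝ≥0∞}
    (hu : Measurable fun p : ℝ × X => u p.1 p.2) (q : ℕ → X) :
    ∃ x : ℕ → ℝ → X, (∀ n, Measurable (x n)) ∧ (∀ t, Monotone fun n => u t (x n t)) ∧
      ∀ n t, u t (q n) ≤ u t (x n t) := by
  classical
  -- A greedy choice: the current point is replaced by the next candidate exactly when the candidate
  -- does at least as well, so values never decrease and measurability survives each step.
  set x : ℕ → ℝ → X := fun n => Nat.rec (fun _ => q 0)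
    (fun n y t => if u t (y t) ≤ u t (q (n + 1)) then q (n + 1) else y t) n with hx
  have hxs : ∀ n t, x (n + 1) t =
    if u t (x n t) ≤ u t (q (n + 1)) then q (n + 1) else x n t := fun n t => rfl
  have hm : ∀ n, Measurable (x n) := by
    intro n
    induction n with
    | zero => exact measurable_const
    | succ n ih =>
      refine Measurable.ite (measurableSet_le ?_ ?_) measurable_const ih
      · exact hu.comp (measurable_id.prodMk ih)
      · exact hu.comp (measurable_id.prodMk measurable_const)
  refine ⟨x, hm, fun t => monotone_nat_of_le_succ fun n => ?_, fun n t => ?_⟩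
  · rw [hxs]
    split_ifs with h
    · exact h
    · exact le_rfl
  · cases n with
    | zero => exact le_rfl
    | succ n =>
      rw [hxs]
      split_ifs with h
      · exact le_rfl
      · exact (not_le.1 h).le

/-- The `L^P_t L^∞_x` Strichartz estimate for data in the unit annulus. -/
theorem exists_lintegral_iSup_evol_le {ψ : Space → ℝ} (hψ : IsLPCutoff ψ) {F : ℝ} (hF : 0 < F)
    (hF1 : F ≠ 1) :
    ∃ C : ℝ, 0 ≤ C ∧ ∀ (P b ν : ℝ), 8 < P → b ≠ 0 → 0 ≤ ν → ∀ k : Space → ℂ, Measurable k →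
      Integrable k → SuppAnnulus k →
      (∫⁻ t in Ici 0, (⨆ x, ‖evol F b ν k t x‖ₑ) ^ P) ^ (1 / P) ≤
        (∫⁻ ω, ‖k ω‖ₑ ^ (2 : ℝ)) ^ (1 / 2 : ℝ) *
          ENNReal.ofReal (C * (2 / (|b| * (1 - 8 / P))) ^ (1 / P)) := by
  obtain ⟨C, hC0, hC⟩ := exists_lintegral_evol_le hψ hF hF1
  refine ⟨C, hC0, fun P b ν hP hb hν k hkm hk hks => ?_⟩
  have hP0 : 0 < P := by linarith
  set M := (∫⁻ ω, ‖k ω‖ₑ ^ (2 : ℝ)) ^ (1 / 2 : ℝ) *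
          ENNReal.ofReal (C * (2 / (|b| * (1 - 8 / P))) ^ (1 / P)) with hM
  set u : ℝ → Space → ℝ≥0∞ := fun t x => ‖evol F b ν k t x‖ₑ with hu
  have hum : Measurable fun p : ℝ × Space => u p.1 p.2 := (measurable_evol F b ν hkm).enorm
  obtain ⟨x, hxm, hxmono, hxq⟩ := exists_measurable_selection hum (TopologicalSpace.denseSeq Space)
  -- The time window grows together with the number of candidates, so a single monotone limit
  -- removes both truncations.
  set f : ℕ → ℝ → ℝ≥0∞ := fun n t => (Icc (0 : ℝ) n).indicator (fun t => u t (x n t) ^ P) t with hf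
  have hfm : ∀ n, Measurable (f n) := fun n =>
    ((hum.comp (measurable_id.prodMk (hxm n))).pow_const P).indicator measurableSet_Icc
  have hfmono : Monotone f := by
    intro n n' hnn t
    have hnn' : (n : ℝ) ≤ n' := by exact_mod_cast hnn
    simp only [hf]
    by_cases ht : t ∈ Icc (0 : ℝ) n
    · rw [indicator_of_mem ht, indicator_of_mem (Icc_subset_Icc_right hnn' ht)]
      exact ENNReal.rpow_le_rpow (hxmono t hnn) hP0.le
    · rw [indicator_of_notMem ht]
      exact zero_le
  have hfi : ∀ n, ∫⁻ t, f n t ≤ M ^ P := fun n => by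
    have h1 := hC P b ν hP hb hν k hk hks (x n) (hxm n) n
    rw [← hM] at h1
    simp only [hf]
    rw [lintegral_indicator measurableSet_Icc]
    have h2 := ENNReal.rpow_le_rpow h1 hP0.le
    rw [← ENNReal.rpow_mul, one_div, inv_mul_cancel₀ hP0.ne', ENNReal.rpow_one] at h2
    exact h2
  have hsup : ∀ t ∈ Ici (0 : ℝ), (⨆ y, ‖evol F b ν k t y‖ₑ) ^ P ≤ ⨆ n, f n t := by
    intro t ht
    obtain ⟨n₀, hn₀⟩ := exists_nat_ge t
    have h1 : (⨆ y, ‖evol F b ν k t y‖ₑ) ≤ (⨆ n, f n t) ^ (1 / P) := by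
      have hcont : Continuous fun y => ‖evol F b ν k t y‖ₑ :=
        (continuous_evol hν hkm hk hks ht).enorm
      have hclosed : IsClosed {y | ‖evol F b ν k t y‖ₑ ≤ (⨆ n, f n t) ^ (1 / P)} :=
        isClosed_le hcont continuous_const
      refine iSup_le fun y => ?_
      have hsub : range (TopologicalSpace.denseSeq Space) ⊆
          {y | ‖evol F b ν k t y‖ₑ ≤ (⨆ n, f n t) ^ (1 / P)} := by
        rintro _ ⟨n, rfl⟩
        have h2 : u t (TopologicalSpace.denseSeq Space n) ≤ u t (x (max n n₀) t) :=
          (hxq n t).trans (hxmono t (le_max_left _ _))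
        have h3 : f (max n n₀) t = u t (x (max n n₀) t) ^ P := by
          simp only [hf]
          rw [indicator_of_mem]
          exact ⟨ht, hn₀.trans (by exact_mod_cast le_max_right _ _)⟩
        have h4 : u t (x (max n n₀) t) ^ P ≤ ⨆ n, f n t := h3 ▸ le_iSup (fun n => f n t) _
        refine h2.trans ?_
        rw [one_div, ENNReal.le_rpow_inv_iff hP0]
        exact h4
      have := hclosed.closure_subset_iff.2 hsub
      rw [(TopologicalSpace.denseRange_denseSeq Space).closure_range] at this
      exact this (mem_univ y)
    rwa [one_div, ENNReal.le_rpow_inv_iff hP0] at h1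
  have hfin : ∫⁻ t in Ici 0, (⨆ x, ‖evol F b ν k t x‖ₑ) ^ P ≤ M ^ P :=
    calc _ ≤ ∫⁻ t in Ici 0, ⨆ n, f n t := setLIntegral_mono' measurableSet_Ici hsup
      _ ≤ ∫⁻ t, ⨆ n, f n t := setLIntegral_le_lintegral _ _
      _ = ⨆ n, ∫⁻ t, f n t := lintegral_iSup hfm hfmono
      _ ≤ M ^ P := iSup_le hfi
  rw [one_div, ENNReal.rpow_inv_le_iff hP0]
  exact hfin

/-! ### Fourier transforms of functions and of tempered distributions -/

lemma integral_fourierInv_smul_eq {χ : Space → ℂ} {h : Space → Val} (hχ : Integrable χ)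
    (hh : Integrable h) : ∫ ξ, 𝓕⁻ χ ξ • h ξ = ∫ x, χ x • 𝓕⁻ h x := by
  have hL : Continuous fun p : Space × Space => (-innerₗ Space p.1) p.2 := by
    have : (fun p : Space × Space => (-innerₗ Space p.1) p.2) = fun p => -inner ℝ p.1 p.2 := rfl
    rw [this]
    exact continuous_inner.neg
  have := VectorFourier.integral_fourierIntegral_smul_eq_flip (L := -innerₗ Space)
    Real.continuous_fourierChar hL hχ hh
  have hflip : (-innerₗ Space).flip = -innerₗ Space := by
    ext x y
    simp [real_inner_comm]
  rw [hflip] at this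
  exact this

lemma continuous_fourierInv {h : Space → Val} (hh : Integrable h) : Continuous (𝓕⁻ h) := by
  have hL : Continuous fun p : Space × Space => (-innerₗ Space p.1) p.2 := by
    have : (fun p : Space × Space => (-innerₗ Space p.1) p.2) = fun p => -inner ℝ p.1 p.2 := rfl
    rw [this]
    exact continuous_inner.neg
  exact VectorFourier.fourierIntegral_continuous (L := -innerₗ Space)
    Real.continuous_fourierChar hL hh

/-- Two locally integrable functions which agree against Schwartz functions agree a.e. -/
lemma ae_eq_of_integral_schwartz_smul_eq {h h' : Space → Val} (hh : LocallyIntegrable h)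
    (hh' : LocallyIntegrable h') (H : ∀ χ : 𝓢(Space, ℂ), ∫ x, χ x • h x = ∫ x, χ x • h' x) :
    h =ᵐ[volume] h' := by
  refine ae_eq_of_integral_contDiff_smul_eq hh hh' fun g hg hgc => ?_
  have hgc' : HasCompactSupport fun x => (g x : ℂ) := hgc.comp_left Complex.ofReal_zero
  have hg' : ContDiff ℝ ((⊤ : ℕ∞) : WithTop ℕ∞) fun x => (g x : ℂ) :=
    Complex.ofRealCLM.contDiff.comp hg
  have := H (hgc'.toSchwartzMap hg')
  simpa using this

/-- The pointwise integral and the L² transform define the same tempered distribution, hence agree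
almost everywhere, and the isometry transfers. If h is not in L², the right side is infinite. -/
lemma eLpNorm_two_fourierInv_le {h : Space → Val} (hh : Integrable h) :
    eLpNorm (𝓕⁻ h) 2 volume ≤ eLpNorm h 2 volume := by
  by_cases h2 : MemLp h 2 volume
  swap
  · have : eLpNorm h 2 volume = ∞ := by
      by_contra hne
      exact h2 ⟨hh.aestronglyMeasurable, lt_top_iff_ne_top.2 hne⟩
    rw [this]; exact le_top
  set f : Lp Val 2 (volume : Measure Space) := h2.toLp h with hf
  have hfe : (f : Space → Val) =ᵐ[volume] h := h2.coeFn_toLp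
  set w : Lp Val 2 (volume : Measure Space) := 𝓕⁻ f with hw
  have hww : (w : Space → Val) =ᵐ[volume] 𝓕⁻ h := by
    refine ae_eq_of_integral_schwartz_smul_eq ((Lp.memLp w).locallyIntegrable (by norm_num))
      (continuous_fourierInv hh).locallyIntegrable fun χ => ?_
    have h1 := congrArg (fun u : 𝓢'(Space, Val) => u χ)
      (Lp.fourierInv_toTemperedDistribution_eq f)
    simp only [TemperedDistribution.fourierInv_apply, Lp.toTemperedDistribution_apply] at h1
    rw [← hw] at h1
    rw [← h1, ← integral_fourierInv_smul_eq χ.integrable hh]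
    refine integral_congr_ae ?_
    filter_upwards [hfe] with x hx
    rw [hx, SchwartzMap.fourierInv_coe]
  have hnorm : ‖w‖ = ‖f‖ := by
    rw [← Lp.norm_fourier_eq w, hw, FourierTransform.fourier_fourierInv_eq]
  have h3 : eLpNorm w 2 volume = eLpNorm f 2 volume := by
    rw [← Lp.enorm_def, ← Lp.enorm_def, ← ofReal_norm, ← ofReal_norm, hnorm]
  rw [← eLpNorm_congr_ae hww, h3, eLpNorm_congr_ae hfe]

/-- The same identification from the other side: here h is merely locally integrable, and testing
with transforms of Schwartz functions identifies it with the L² Fourier transform of h₁. -/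
lemma eLpNorm_two_eq_of_representation {h h₁ : Space → Val} (hh : LocallyIntegrable h)
    (h2 : MemLp h₁ 2 volume)
    (H : ∀ χ : 𝓢(Space, ℂ), ∫ x, χ x • h₁ x = ∫ ξ, 𝓕⁻ χ ξ • h ξ) :
    eLpNorm h 2 volume = eLpNorm h₁ 2 volume := by
  set f : Lp Val 2 (volume : Measure Space) := h2.toLp h₁ with hf
  have hfe : (f : Space → Val) =ᵐ[volume] h₁ := h2.coeFn_toLp
  set w : Lp Val 2 (volume : Measure Space) := 𝓕 f with hw
  have hww : (w : Space → Val) =ᵐ[volume] h := by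
    refine ae_eq_of_integral_schwartz_smul_eq ((Lp.memLp w).locallyIntegrable (by norm_num))
      hh fun χ => ?_
    have h1 := congrArg (fun u : 𝓢'(Space, Val) => u χ)
      (Lp.fourier_toTemperedDistribution_eq f)
    simp only [TemperedDistribution.fourier_apply, Lp.toTemperedDistribution_apply] at h1
    rw [← hw] at h1
    have h3 := H (𝓕 χ)
    rw [FourierTransform.fourierInv_fourier_eq] at h3
    rw [← h1, ← h3]
    refine integral_congr_ae ?_
    filter_upwards [hfe] with x hx
    rw [hx]
  have h3 : eLpNorm w 2 volume = eLpNorm f 2 volume := by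
    rw [← Lp.enorm_def, ← Lp.enorm_def, ← ofReal_norm, ← ofReal_norm, hw, Lp.norm_fourier_eq]
  rw [← eLpNorm_congr_ae hww, h3, eLpNorm_congr_ae hfe]

/-! ### Multipliers supported away from the zero frequency -/

/-- A smooth multiplier with compact support in `ℝ³ \ {0}`. -/
structure IsBandMultiplier (m : Space → ℂ) : Prop where
  smooth : ContDiff ℝ ((⊤ : ℕ∞) : WithTop ℕ∞) m
  compact : HasCompactSupport m
  zero_notMem : (0 : Space) ∉ tsupport m

namespace IsBandMultiplier

variable {m : Space → ℂ} {u : 𝓢'(Space, Val)} {g : Space → Val}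

lemma integrable_smul (hm : IsBandMultiplier m) (hg : LocallyIntegrableOn g {0}ᶜ) :
    Integrable fun ξ => m ξ • g ξ := by
  obtain ⟨C, hC⟩ := hm.smooth.continuous.bounded_above_of_compact_support hm.compact
  have h1 : IntegrableOn g (tsupport m) := hg.integrableOn_compact_subset
    (fun ξ hξ h0 => hm.zero_notMem (by rwa [mem_singleton_iff.1 h0] at hξ)) hm.compact
  have h2 : IntegrableOn (fun ξ => m ξ • g ξ) (tsupport m) :=
    h1.bdd_smul C hm.smooth.continuous.aestronglyMeasurable (ae_of_all _ hC)
  refine (integrableOn_iff_integrable_of_support_subset ?_).1 h2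
  intro ξ hξ
  apply subset_tsupport m
  intro h0
  apply hξ
  simp [h0]

/-- The multiplier cuts the test function down to a compact set away from the origin, which is
exactly where the Fourier density represents the distribution. -/
lemma apply_eq (hm : IsBandMultiplier m) (hu : HasFourierDensity u g) (χ : 𝓢(Space, ℂ)) :
    TemperedDistribution.fourierMultiplierCLM Val m u χ = ∫ ξ, 𝓕⁻ χ ξ • (m ξ • g ξ) := by
  have hmt : Function.HasTemperateGrowth m := hm.compact.hasTemperateGrowth hm.smooth
  rw [TemperedDistribution.fourierMultiplierCLM_apply_apply]
  have happ : ∀ ξ, SchwartzMap.smulLeftCLM ℂ m (𝓕⁻ χ) ξ = m ξ • 𝓕⁻ χ ξ :=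
    SchwartzMap.smulLeftCLM_apply_apply hmt _
  have hsub : tsupport (SchwartzMap.smulLeftCLM ℂ m (𝓕⁻ χ)) ⊆ tsupport m := by
    refine closure_mono fun ξ hξ => ?_
    rw [Function.mem_support, happ] at hξ
    exact fun h0 => hξ (by simp [h0])
  have h1 := hu.2 (SchwartzMap.smulLeftCLM ℂ m (𝓕⁻ χ))
    (hm.compact.of_isClosed_subset (isClosed_tsupport _) hsub)
    (fun h0 => hm.zero_notMem (hsub h0))
  rw [TemperedDistribution.fourier_apply] at h1
  rw [h1]
  refine integral_congr_ae (ae_of_all _ fun ξ => ?_)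
  simp only [happ]
  rw [smul_smul, smul_eq_mul, mul_comm]

/-- The norm is an infimum over representatives, and the inverse Fourier integral is one whenever
its L^r norm is finite. -/
lemma distLpNorm_le (hm : IsBandMultiplier m) (hu : HasFourierDensity u g) (r : ℝ≥0∞) :
    distLpNorm (TemperedDistribution.fourierMultiplierCLM Val m u) r ≤
      eLpNorm (𝓕⁻ fun ξ => m ξ • g ξ) r volume := by
  have hi := hm.integrable_smul hu.1
  by_cases hfin : eLpNorm (𝓕⁻ fun ξ => m ξ • g ξ) r volume < ∞
  · unfold distLpNorm
    refine iInf_le_of_le _ (iInf_le_of_le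
      ⟨(continuous_fourierInv hi).aestronglyMeasurable, hfin⟩ (iInf_le_of_le (fun χ => ?_) le_rfl))
    rw [hm.apply_eq hu, SchwartzMap.fourierInv_coe, integral_fourierInv_smul_eq χ.integrable hi]
  · rw [not_lt, top_le_iff] at hfin
    rw [hfin]; exact le_top

/-- By Plancherel every L² representative has the norm of the Fourier side; when there is none, the
infimum is infinite. -/
lemma eLpNorm_two_le (hm : IsBandMultiplier m) (hu : HasFourierDensity u g) :
    eLpNorm (fun ξ => m ξ • g ξ) 2 volume ≤
      distLpNorm (TemperedDistribution.fourierMultiplierCLM Val m u) 2 := by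
  have hi := hm.integrable_smul hu.1
  unfold distLpNorm
  refine le_iInf fun h => le_iInf fun hmem => le_iInf fun hrep => ?_
  refine (eLpNorm_two_eq_of_representation hi.locallyIntegrable hmem fun χ => ?_).le
  rw [← hrep χ, hm.apply_eq hu, SchwartzMap.fourierInv_coe]

end IsBandMultiplier

/-! ### Linear differential constraints in Fourier variables -/

/-- Testing the derivative against a Fourier transform turns it into multiplication by 2πi ξ_k, and
multiplication does not enlarge the support of η, so the density remains usable. -/
lemma lineDeriv_fourier_apply {u : 𝓢'(Space, Val)} {g : Space → Val} (hu : HasFourierDensity u g)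
    (k : Fin 3) {η : 𝓢(Space, ℂ)} (hη : HasCompactSupport η) (h0 : (0 : Space) ∉ tsupport η) :
    (∂_{basisVec k} u) (𝓕 η) = (2 * Real.pi * Complex.I : ℂ) • ∫ ξ, η ξ • ((ξ k : ℂ) • g ξ) := by
  have hmt : Function.HasTemperateGrowth fun ξ : Space => ((inner ℝ ξ (basisVec k) : ℝ) : ℂ) := by
    fun_prop
  rw [← TemperedDistribution.fourier_apply, TemperedDistribution.fourier_lineDerivOp_eq]
  have happ : ∀ ξ, SchwartzMap.smulLeftCLM ℂ (fun ξ : Space => ((inner ℝ ξ (basisVec k) : ℝ) : ℂ)) η ξ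
      = (ξ k : ℂ) * η ξ := fun ξ => by
    rw [SchwartzMap.smulLeftCLM_apply_apply hmt, basisVec, EuclideanSpace.inner_single_right]
    simp
  have hsub : tsupport (SchwartzMap.smulLeftCLM ℂ
      (fun ξ : Space => ((inner ℝ ξ (basisVec k) : ℝ) : ℂ)) η) ⊆ tsupport η := by
    refine closure_mono fun ξ hξ => ?_
    rw [Function.mem_support, happ] at hξ
    exact fun h0 => hξ (by simp [h0])
  have h1 := hu.2 (SchwartzMap.smulLeftCLM ℂ (fun ξ : Space => ((inner ℝ ξ (basisVec k) : ℝ) : ℂ)) η)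
    (hη.of_isClosed_subset (isClosed_tsupport _) hsub) (fun h => h0 (hsub h))
  change (2 * Real.pi * Complex.I : ℂ) • (TemperedDistribution.smulLeftCLM Val _ (𝓕 u) η) = _
  rw [TemperedDistribution.smulLeftCLM_apply_apply, h1]
  congr 1
  refine integral_congr_ae (ae_of_all _ fun ξ => ?_)
  simp only [happ]
  rw [smul_smul, mul_comm]

/-- A first-order linear constraint `∑ c_{kl} ∂_k u^l = 0` holds a.e. for the Fourier density. -/
lemma ae_constraint {u : 𝓢'(Space, Val)} {g : Space → Val} (hu : HasFourierDensity u g)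
    (c : Fin 3 → Fin 4 → ℂ)
    (H : ∀ χ : 𝓢(Space, ℂ), ∑ k, ∑ l, c k l * (∂_{basisVec k} u) χ l = 0) :
    ∀ᵐ ξ : Space, ∑ k, ∑ l, c k l * ((ξ k : ℂ) * g ξ l) = 0 := by
  have hproj : ∀ l : Fin 4, LocallyIntegrableOn (fun ξ : Space => g ξ l) {0}ᶜ := by
    intro l ξ hξ
    obtain ⟨s, hs, hi⟩ := hu.1 ξ hξ
    exact ⟨s, hs, (EuclideanSpace.proj l : Val →L[ℂ] ℂ).integrable_comp hi⟩
  have hloc : ∀ (k : Fin 3) (l : Fin 4),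
      LocallyIntegrableOn (fun ξ : Space => c k l * ((ξ k : ℂ) * g ξ l)) {0}ᶜ := by
    intro k l
    have h2 : ContinuousOn (fun ξ : Space => c k l * (ξ k : ℂ)) {0}ᶜ := by
      fun_prop
    have := (hproj l).continuousOn_mul h2 isOpen_compl_singleton.isLocallyClosed
    simpa only [mul_assoc] using this
  have hfl : LocallyIntegrableOn (fun ξ : Space => ∑ k, ∑ l, c k l * ((ξ k : ℂ) * g ξ l)) {0}ᶜ := by
    simp only [Fin.sum_univ_four, Fin.sum_univ_three]
    exact ((((hloc 0 0).add (hloc 0 1)).add (hloc 0 2)).add (hloc 0 3)).add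
      ((((hloc 1 0).add (hloc 1 1)).add (hloc 1 2)).add (hloc 1 3)) |>.add
      ((((hloc 2 0).add (hloc 2 1)).add (hloc 2 2)).add (hloc 2 3))
  have := isOpen_compl_singleton.ae_eq_zero_of_integral_contDiff_smul_eq_zero hfl ?_
  · filter_upwards [this, Measure.ae_ne volume (0 : Space)] with ξ h1 h2
    exact h1 h2
  · intro η hη hηc hη0
    have hηc' : HasCompactSupport fun x => (η x : ℂ) := hηc.comp_left Complex.ofReal_zero
    have hη' : ContDiff ℝ ((⊤ : ℕ∞) : WithTop ℕ∞) fun x => (η x : ℂ) :=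
      Complex.ofRealCLM.contDiff.comp hη
    have h0 : (0 : Space) ∉ tsupport fun x => (η x : ℂ) := by
      have : tsupport (fun x => (η x : ℂ)) ⊆ tsupport η := by
        refine closure_mono fun ξ hξ => ?_
        rw [Function.mem_support] at hξ ⊢
        exact fun h => hξ (by simp [h])
      exact fun h => hη0 (this h) rfl
    have hi : ∀ k : Fin 3, Integrable fun ξ : Space => (η ξ : ℂ) • ((ξ k : ℂ) • g ξ) := by
      intro k
      have hloc' : LocallyIntegrableOn (fun ξ : Space => (ξ k : ℂ) • g ξ) {0}ᶜ := by
        have h2 : ContinuousOn (fun ξ : Space => (ξ k : ℂ)) {0}ᶜ := by fun_prop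
        exact hu.1.continuousOn_smul isOpen_compl_singleton.isLocallyClosed h2
      exact IsBandMultiplier.integrable_smul ⟨hη', hηc', h0⟩ hloc'
    have hcomp : ∀ (k : Fin 3) (l : Fin 4), (∫ ξ : Space, (η ξ : ℂ) • ((ξ k : ℂ) • g ξ)) l =
        ∫ ξ : Space, (η ξ : ℂ) * ((ξ k : ℂ) * g ξ l) := by
      intro k l
      have := (EuclideanSpace.proj l : Val →L[ℂ] ℂ).integral_comp_comm (hi k)
      simpa using this.symm
    have hic : ∀ (k : Fin 3) (l : Fin 4),
        Integrable fun ξ : Space => (η ξ : ℂ) * ((ξ k : ℂ) * g ξ l) := by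
      intro k l
      have := (EuclideanSpace.proj l : Val →L[ℂ] ℂ).integrable_comp (hi k)
      simpa using this
    have h1 := H (𝓕 (hηc'.toSchwartzMap hη'))
    have h3 : ∀ k : Fin 3, (∂_{basisVec k} u) (𝓕 (hηc'.toSchwartzMap hη')) =
        (2 * Real.pi * Complex.I : ℂ) • ∫ ξ, (η ξ : ℂ) • ((ξ k : ℂ) • g ξ) := fun k =>
      lineDeriv_fourier_apply hu k (η := hηc'.toSchwartzMap hη') hηc' h0
    simp only [h3, PiLp.smul_apply, hcomp, smul_eq_mul] at h1
    have h4 : (2 * Real.pi * Complex.I : ℂ) *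
        ∑ k, ∑ l, c k l * ∫ ξ : Space, (η ξ : ℂ) * ((ξ k : ℂ) * g ξ l) = 0 := by
      rw [← h1, Finset.mul_sum]
      refine Finset.sum_congr rfl fun k _ => ?_
      rw [Finset.mul_sum]
      refine Finset.sum_congr rfl fun l _ => ?_
      ring
    have h5 := (mul_eq_zero.1 h4).resolve_left Complex.two_pi_I_ne_zero
    rw [← h5]
    simp only [← integral_const_mul]
    have hic' : ∀ (k : Fin 3) (l : Fin 4),
        Integrable fun ξ : Space => c k l * ((η ξ : ℂ) * ((ξ k : ℂ) * g ξ l)) :=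
      fun k l => (hic k l).const_mul _
    have h6 : ∀ k : Fin 3, ∑ l, ∫ ξ : Space, c k l * ((η ξ : ℂ) * ((ξ k : ℂ) * g ξ l)) =
        ∫ ξ : Space, ∑ l, c k l * ((η ξ : ℂ) * ((ξ k : ℂ) * g ξ l)) := fun k =>
      (integral_finsetSum _ fun l _ => hic' k l).symm
    simp only [h6]
    rw [← integral_finsetSum _ fun k _ => integrable_finsetSum _ fun l _ => hic' k l]
    refine integral_congr_ae (ae_of_all _ fun ξ => ?_)
    simp only [Complex.real_smul, Finset.mul_sum]
    refine Finset.sum_congr rfl fun k _ => Finset.sum_congr rfl fun l _ => ?_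
    ring

/-- The symbols of functions of zero divergence and zero potential vorticity. -/
def IsWave (F : ℝ) (ω : Space) (z : Val) : Prop :=
  (ω 0 : ℂ) * z 0 + ω 1 * z 1 + ω 2 * z 2 = 0 ∧ (ω 0 : ℂ) * z 1 - ω 1 * z 0 - F * (ω 2 * z 3) = 0

lemma ae_isWave {F : ℝ} {u : 𝓢'(Space, Val)} {g : Space → Val} (hu : HasFourierDensity u g)
    (h1 : IsDivFree u) (h2 : HasZeroPotentialVorticity F u) :
    ∀ᵐ ξ : Space, IsWave F (angFreq ξ) (g ξ) := by
  have k1 := ae_constraint hu (fun k l => if (k : ℕ) = l then 1 else 0) (fun χ => by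
    have := h1 χ
    simpa [Fin.sum_univ_four, Fin.sum_univ_three] using this)
  have k2 := ae_constraint hu ![![0, 1, 0, 0], ![-1, 0, 0, 0], ![0, 0, 0, -(F : ℂ)]] (fun χ => by
    have := h2 χ
    simp [Fin.sum_univ_four, Fin.sum_univ_three] at this ⊢
    linear_combination this)
  filter_upwards [k1, k2] with ξ e1 e2
  simp [Fin.sum_univ_four, Fin.sum_univ_three] at e1 e2
  constructor
  · simp only [angFreq, PiLp.smul_apply, smul_eq_mul, Complex.ofReal_mul]
    linear_combination ((2 : ℝ) : ℂ) * (Real.pi : ℂ) * e1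
  · simp only [angFreq, PiLp.smul_apply, smul_eq_mul, Complex.ofReal_mul]
    linear_combination ((2 : ℝ) : ℂ) * (Real.pi : ℂ) * e2

/-! ### The symbols of the dyadic blocks -/

lemma IsLPCutoff.norm_mem_of_lpPhi_ne_zero {ψ : Space → ℝ} (hψ : IsLPCutoff ψ) {ω : Space}
    (h : lpPhi ψ ω ≠ 0) : 3 / 4 ≤ ‖ω‖ ∧ ‖ω‖ ≤ 8 / 3 := by
  constructor
  · by_contra! hlt
    apply h
    rw [lpPhi, hψ.eq_one_of_norm_le (ω := ω) hlt.le, hψ.eq_one_of_norm_le, sub_self]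
    rw [norm_smul]
    norm_num
    linarith [norm_nonneg ω]
  · by_contra! hlt
    apply h
    rw [lpPhi, hψ.eq_zero_of_lt_norm (ω := ω) (by linarith), hψ.eq_zero_of_lt_norm, sub_self]
    rw [norm_smul]
    norm_num
    linarith

/-- The symbol of `dyadicBlockAbsD`. -/
def blockSymbol (ψ : Space → ℝ) (d : ℝ) (j : ℤ) (ξ : Space) : ℝ :=
  lpPhi ψ ((2 : ℝ) ^ (-j) • angFreq ξ) * ‖angFreq ξ‖ ^ d

lemma norm_angFreq (ξ : Space) : ‖angFreq ξ‖ = 2 * Real.pi * ‖ξ‖ := by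
  rw [angFreq, norm_smul, Real.norm_of_nonneg (by positivity)]

lemma norm_mem_of_lpPhi_dyadic_ne_zero {ψ : Space → ℝ} (hψ : IsLPCutoff ψ) {j : ℤ} {ω : Space}
    (h : lpPhi ψ ((2 : ℝ) ^ (-j) • ω) ≠ 0) :
    3 / 4 * (2 : ℝ) ^ j ≤ ‖ω‖ ∧ ‖ω‖ ≤ 8 / 3 * (2 : ℝ) ^ j := by
  have h1 := hψ.norm_mem_of_lpPhi_ne_zero h
  have h2 : (0 : ℝ) < 2 ^ j := by positivity
  rw [norm_smul, Real.norm_of_nonneg (by positivity), zpow_neg, inv_mul_eq_div,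
    le_div_iff₀ h2, div_le_iff₀ h2] at h1
  exact h1

/-- The power |ω|^d is singular only at the origin, near which the symbol vanishes identically;
smoothness is therefore checked separately at 0 and elsewhere. -/
lemma isBandMultiplier_blockSymbol {ψ : Space → ℝ} (hψ : IsLPCutoff ψ) (d : ℝ) (j : ℤ) :
    IsBandMultiplier fun ξ => ((blockSymbol ψ d j ξ : ℝ) : ℂ) := by
  have hK : IsClosed {ξ : Space | 3 / 4 * (2 : ℝ) ^ j ≤ ‖angFreq ξ‖ ∧
      ‖angFreq ξ‖ ≤ 8 / 3 * (2 : ℝ) ^ j} := by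
    simp only [norm_angFreq]
    have hc : Continuous fun ξ : Space => 2 * Real.pi * ‖ξ‖ := by fun_prop
    exact (isClosed_le continuous_const hc).inter (isClosed_le hc continuous_const)
  have hsub : tsupport (fun ξ => ((blockSymbol ψ d j ξ : ℝ) : ℂ)) ⊆
      {ξ : Space | 3 / 4 * (2 : ℝ) ^ j ≤ ‖angFreq ξ‖ ∧ ‖angFreq ξ‖ ≤ 8 / 3 * (2 : ℝ) ^ j} := by
    refine closure_minimal (fun ξ hξ => ?_) hK
    apply norm_mem_of_lpPhi_dyadic_ne_zero hψ
    intro h0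
    apply hξ
    change ((blockSymbol ψ d j ξ : ℝ) : ℂ) = 0
    rw [blockSymbol, h0, zero_mul, Complex.ofReal_zero]
  have hz : (0 : Space) ∉ tsupport fun ξ => ((blockSymbol ψ d j ξ : ℝ) : ℂ) := by
    intro h0
    have h1 := (hsub h0).1
    rw [norm_angFreq, norm_zero, mul_zero] at h1
    have : (0 : ℝ) < 2 ^ j := by positivity
    linarith
  refine ⟨?_, ?_, hz⟩
  · rw [contDiff_iff_contDiffAt]
    intro ξ
    by_cases h0 : ξ = 0
    · rw [h0]
      have : (fun ξ => ((blockSymbol ψ d j ξ : ℝ) : ℂ)) =ᶠ[𝓝 0] fun _ => 0 :=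
        notMem_tsupport_iff_eventuallyEq.1 hz
      exact contDiffAt_const.congr_of_eventuallyEq this
    · have ha : angFreq ξ ≠ 0 := by
        rw [← norm_ne_zero_iff, norm_angFreq]
        have := norm_ne_zero_iff.2 h0
        positivity
      have hlin : ContDiff ℝ ((⊤ : ℕ∞) : WithTop ℕ∞) angFreq := by
        unfold angFreq; fun_prop
      have h1 : ContDiff ℝ ((⊤ : ℕ∞) : WithTop ℕ∞)
          fun ξ => lpPhi ψ ((2 : ℝ) ^ (-j) • angFreq ξ) := by
        unfold lpPhi
        exact (hψ.smooth.comp ((hlin.const_smul _).const_smul _)).sub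
          (hψ.smooth.comp (hlin.const_smul _))
      have h2 : ContDiffAt ℝ ((⊤ : ℕ∞) : WithTop ℕ∞) (fun ξ => ‖angFreq ξ‖ ^ d) ξ :=
        ((hlin.contDiffAt (x := ξ)).norm ℝ ha).rpow_const_of_ne (norm_ne_zero_iff.2 ha)
      exact Complex.ofRealCLM.contDiff.contDiffAt.comp ξ (h1.contDiffAt.mul h2)
  · refine (isCompact_closedBall (0 : Space) (8 / 3 * (2 : ℝ) ^ j / (2 * Real.pi))).of_isClosed_subset
      (isClosed_tsupport _) fun ξ hξ => ?_
    have := (hsub hξ).2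
    rw [norm_angFreq] at this
    rw [mem_closedBall_zero_iff, le_div_iff₀ (by positivity)]
    linarith

lemma isBandMultiplier_lpPhi {ψ : Space → ℝ} (hψ : IsLPCutoff ψ) (j : ℤ) :
    IsBandMultiplier fun ξ => ((lpPhi ψ ((2 : ℝ) ^ (-j) • angFreq ξ) : ℝ) : ℂ) := by
  simpa [blockSymbol] using isBandMultiplier_blockSymbol hψ 0 j

/-- On the annulus |ω| is 2^j times a number in [3/4, 8/3]. The d-th power is monotone there, and
the maximum over the endpoints covers both signs of d. -/
lemma abs_blockSymbol_le {ψ : Space → ℝ} (hψ : IsLPCutoff ψ) (d : ℝ) (j : ℤ) (ξ : Space) :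
    |blockSymbol ψ d j ξ| ≤ (2 : ℝ) ^ ((j : ℝ) * d) * max (lpInner ^ d) (lpOuter ^ d) *
      |lpPhi ψ ((2 : ℝ) ^ (-j) • angFreq ξ)| := by
  by_cases h : lpPhi ψ ((2 : ℝ) ^ (-j) • angFreq ξ) = 0
  · rw [blockSymbol, h, zero_mul, abs_zero, mul_zero]
  have h1 := norm_mem_of_lpPhi_dyadic_ne_zero hψ h
  rw [blockSymbol, abs_mul, mul_comm, abs_of_nonneg (by positivity)]
  refine mul_le_mul_of_nonneg_right ?_ (abs_nonneg _)
  set n := ‖angFreq ξ‖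
  have h2 : (0 : ℝ) < 2 ^ j := by positivity
  have hn : n = (2 : ℝ) ^ j * (n / (2 : ℝ) ^ j) := by field_simp
  have h3 : 3 / 4 ≤ n / (2 : ℝ) ^ j := by rw [le_div_iff₀ h2]; exact h1.1
  have h4 : n / (2 : ℝ) ^ j ≤ 8 / 3 := by rw [div_le_iff₀ h2]; exact h1.2
  rw [hn, Real.mul_rpow h2.le (by linarith), ← Real.rpow_intCast, ← Real.rpow_mul (by norm_num)]
  refine mul_le_mul_of_nonneg_left ?_ (by positivity)
  rw [Real.rpow_intCast, lpInner, lpOuter]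
  rcases le_total 0 d with hd | hd
  · exact (Real.rpow_le_rpow (by linarith) h4 hd).trans (le_max_right _ _)
  · exact (Real.rpow_le_rpow_of_nonpos (by norm_num) h3 hd).trans (le_max_left _ _)

lemma eLpNorm_blockSymbol_le {ψ : Space → ℝ} (hψ : IsLPCutoff ψ) (d : ℝ) (j : ℤ)
    {u : 𝓢'(Space, Val)} {g : Space → Val} (hu : HasFourierDensity u g) :
    eLpNorm (fun ξ => ((blockSymbol ψ d j ξ : ℝ) : ℂ) • g ξ) 2 volume ≤
      ENNReal.ofReal ((2 : ℝ) ^ ((j : ℝ) * d) * max (lpInner ^ d) (lpOuter ^ d)) *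
        distLpNorm (dyadicBlock ψ j u) 2 := by
  refine (eLpNorm_le_mul_eLpNorm_of_ae_le_mul
    (c := (2 : ℝ) ^ ((j : ℝ) * d) * max (lpInner ^ d) (lpOuter ^ d)) (g := fun ξ =>
    ((lpPhi ψ ((2 : ℝ) ^ (-j) • angFreq ξ) : ℝ) : ℂ) • g ξ) (ae_of_all _ fun ξ => ?_) 2).trans ?_
  · rw [norm_smul, norm_smul, Complex.norm_real, Complex.norm_real, ← mul_assoc]
    exact mul_le_mul_of_nonneg_right (abs_blockSymbol_le hψ d j ξ) (norm_nonneg _)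
  · gcongr
    exact (isBandMultiplier_lpPhi hψ j).eLpNorm_two_le hu

lemma distLpNorm_dyadicBlockAbsD_le {ψ : Space → ℝ} (hψ : IsLPCutoff ψ) (d : ℝ) (j : ℤ)
    {u : 𝓢'(Space, Val)} {g : Space → Val} (hu : HasFourierDensity u g) (r : ℝ≥0∞) :
    distLpNorm (dyadicBlockAbsD ψ d j u) r ≤
      eLpNorm (𝓕⁻ fun ξ => ((blockSymbol ψ d j ξ : ℝ) : ℂ) • g ξ) r volume :=
  (isBandMultiplier_blockSymbol hψ d j).distLpNorm_le hu r

/-! ### The propagator on divergence-free fields of zero potential vorticity -/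

/-- The symbol of `ℙ 𝒜`, as a map of `ℂ⁴`. -/
def coriolis (F : ℝ) (ω : Space) (z : Val) : Val := applyMat (symbolLeray ω * matrixA F) z

lemma applyMat_apply (M : Matrix (Fin 4) (Fin 4) ℝ) (z : Val) (i : Fin 4) :
    applyMat M z i = ∑ b, (M i b : ℂ) * z b := rfl

lemma applyMat_add (M : Matrix (Fin 4) (Fin 4) ℝ) (z w : Val) :
    applyMat M (z + w) = applyMat M z + applyMat M w := by
  ext i
  simp [applyMat_apply, mul_add, Finset.sum_add_distrib]

lemma applyMat_smul (M : Matrix (Fin 4) (Fin 4) ℝ) (c : ℂ) (z : Val) :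
    applyMat M (c • z) = c • applyMat M z := by
  ext i
  simp only [applyMat_apply, PiLp.smul_apply, smul_eq_mul, Finset.mul_sum]
  exact Finset.sum_congr rfl fun _ _ => by ring

/-- `applyMat M` as a continuous linear map. -/
def applyMatCLM (M : Matrix (Fin 4) (Fin 4) ℝ) : Val →L[ℂ] Val :=
  LinearMap.toContinuousLinearMap
    { toFun := applyMat M, map_add' := applyMat_add M, map_smul' := applyMat_smul M }

@[simp] lemma applyMatCLM_apply (M : Matrix (Fin 4) (Fin 4) ℝ) (z : Val) :
    applyMatCLM M z = applyMat M z := rfl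

/-- The component of `𝒜 z` along `ω`. -/
def coriolisPressure (F : ℝ) (ω : Space) (z : Val) : ℂ :=
  -(ω 0 : ℂ) * z 1 + ω 1 * z 0 + ω 2 * ((F : ℂ)⁻¹ * z 3)

lemma coriolis_zero (F : ℝ) (ω : Space) (z : Val) :
    coriolis F ω z 0 = -z 1 - ((‖ω‖ ^ 2 : ℝ) : ℂ)⁻¹ * (ω 0 * coriolisPressure F ω z) := by
  simp [coriolis, coriolisPressure, applyMat_apply, symbolLeray, matrixA, Matrix.mul_apply,
    Fin.sum_univ_four, Matrix.vecMulVec, Matrix.one_apply]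
  ring

lemma coriolis_one (F : ℝ) (ω : Space) (z : Val) :
    coriolis F ω z 1 = z 0 - ((‖ω‖ ^ 2 : ℝ) : ℂ)⁻¹ * (ω 1 * coriolisPressure F ω z) := by
  simp [coriolis, coriolisPressure, applyMat_apply, symbolLeray, matrixA, Matrix.mul_apply,
    Fin.sum_univ_four, Matrix.vecMulVec, Matrix.one_apply]
  ring

lemma coriolis_two (F : ℝ) (ω : Space) (z : Val) :
    coriolis F ω z 2 =
      (F : ℂ)⁻¹ * z 3 - ((‖ω‖ ^ 2 : ℝ) : ℂ)⁻¹ * (ω 2 * coriolisPressure F ω z) := by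
  simp [coriolis, coriolisPressure, applyMat_apply, symbolLeray, matrixA, Matrix.mul_apply,
    Fin.sum_univ_four, Matrix.vecMulVec, Matrix.one_apply]
  ring

lemma coriolis_three (F : ℝ) (ω : Space) (z : Val) :
    coriolis F ω z 3 = -((F : ℂ)⁻¹ * z 2) := by
  simp [coriolis, applyMat_apply, symbolLeray, matrixA, Matrix.mul_apply,
    Fin.sum_univ_four, Matrix.vecMulVec, Matrix.one_apply]

lemma phase_bounds {F : ℝ} (hF : 0 < F) {ω : Space} (hω : ω ≠ 0) :
    min 1 F / F ≤ phase F ω ∧ phase F ω ≤ max 1 F / F := by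
  refine phaseAux_bounds hF (by positivity) ?_
  rw [← norm_sq_eq]
  have := norm_pos_iff.2 hω
  positivity

lemma phase_pos {F : ℝ} (hF : 0 < F) {ω : Space} (hω : ω ≠ 0) : 0 < phase F ω :=
  lt_of_lt_of_le (by positivity) (phase_bounds hF hω).1

lemma phase_sq {F : ℝ} (hF : 0 < F) {ω : Space} (hω : ω ≠ 0) :
    phase F ω ^ 2 = (ω 0 ^ 2 + ω 1 ^ 2 + F ^ 2 * ω 2 ^ 2) / (F ^ 2 * ‖ω‖ ^ 2) := by
  have hn := norm_pos_iff.2 hω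
  rw [phase, phaseAux, div_pow, Real.sq_sqrt (by positivity), norm_sq_eq]
  field_simp

/-- The two constraints make the pressure terms explicit: zero potential vorticity evaluates the
pressure of z, and zero divergence that of its image, where the inner pressure cancels. What remains
is a polynomial identity modulo the two constraints. -/
lemma coriolis_coriolis {F : ℝ} (hF : 0 < F) {ω : Space} (hω : ω ≠ 0) {z : Val}
    (hz : IsWave F ω z) :
    coriolis F ω (coriolis F ω z) = (-(phase F ω ^ 2 : ℝ) : ℂ) • z := by
  obtain ⟨h1, h2⟩ := hz
  have hn : ((‖ω‖ ^ 2 : ℝ) : ℂ) ≠ 0 := by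
    have := norm_pos_iff.2 hω
    exact_mod_cast (by positivity : ‖ω‖ ^ 2 ≠ 0)
  have hFc : (F : ℂ) ≠ 0 := by exact_mod_cast hF.ne'
  have hnn : ((‖ω‖ ^ 2 : ℝ) : ℂ) = (ω 0 : ℂ) ^ 2 + (ω 1 : ℂ) ^ 2 + (ω 2 : ℂ) ^ 2 := by
    rw [norm_sq_eq]; push_cast; ring
  have ha : ((phase F ω ^ 2 : ℝ) : ℂ) =
      ((ω 0 : ℂ) ^ 2 + (ω 1 : ℂ) ^ 2 + (F : ℂ) ^ 2 * (ω 2 : ℂ) ^ 2) /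
        ((F : ℂ) ^ 2 * ((‖ω‖ ^ 2 : ℝ) : ℂ)) := by
    rw [phase_sq hF hω]; push_cast; ring
  have hk : coriolisPressure F ω z = ω 2 * z 3 * ((F : ℂ)⁻¹ - F) := by
    rw [coriolisPressure]
    linear_combination -h2
  have hk' : coriolisPressure F ω (coriolis F ω z) = ω 2 * z 2 * (1 - ((F : ℂ) ^ 2)⁻¹) := by
    rw [coriolisPressure, coriolis_zero, coriolis_one, coriolis_three]
    have : ((F : ℂ) ^ 2)⁻¹ = (F : ℂ)⁻¹ * (F : ℂ)⁻¹ := by rw [sq, mul_inv]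
    rw [this]
    linear_combination -h1
  ext i
  rw [PiLp.smul_apply, smul_eq_mul, ha]
  fin_cases i
  · show coriolis F ω (coriolis F ω z) 0 = _ * z 0
    rw [coriolis_zero, coriolis_one, hk', hk, hnn]
    rw [hnn] at hn
    field_simp
    linear_combination (-(ω 0 : ℂ) * (F ^ 2 - 1)) * h1 + (ω 1 : ℂ) * (F ^ 2 - 1) * h2
  · show coriolis F ω (coriolis F ω z) 1 = _ * z 1
    rw [coriolis_one, coriolis_zero, hk', hk, hnn]
    rw [hnn] at hn
    field_simp
    linear_combination (-(ω 1 : ℂ) * (F ^ 2 - 1)) * h1 - (ω 0 : ℂ) * (F ^ 2 - 1) * h2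
  · show coriolis F ω (coriolis F ω z) 2 = _ * z 2
    rw [coriolis_two, coriolis_three, hk', hnn]
    rw [hnn] at hn
    field_simp
    ring
  · show coriolis F ω (coriolis F ω z) 3 = _ * z 3
    rw [coriolis_three, coriolis_two, hk, hnn]
    rw [hnn] at hn
    field_simp
    ring

lemma abs_symbolLeray_le (ω : Space) (a b : Fin 4) : |symbolLeray ω a b| ≤ 2 := by
  have hv : ∀ c : Fin 4, |(![ω 0, ω 1, ω 2, 0] : Fin 4 → ℝ) c| ≤ ‖ω‖ := by
    intro c
    fin_cases c
    · exact abs_coord_le_norm ω 0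
    · exact abs_coord_le_norm ω 1
    · exact abs_coord_le_norm ω 2
    · simp
  have h1 : |(‖ω‖ ^ 2)⁻¹ * ((![ω 0, ω 1, ω 2, 0] : Fin 4 → ℝ) a *
      (![ω 0, ω 1, ω 2, 0] : Fin 4 → ℝ) b)| ≤ 1 := by
    rw [abs_mul, abs_mul, abs_inv, abs_of_nonneg (by positivity : 0 ≤ ‖ω‖ ^ 2)]
    refine (mul_le_mul_of_nonneg_left (mul_le_mul (hv a) (hv b) (abs_nonneg _) (norm_nonneg _))
      (by positivity)).trans ?_
    rw [← sq]
    exact inv_mul_le_one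
  have h2 : |(1 : Matrix (Fin 4) (Fin 4) ℝ) a b| ≤ 1 := by
    rw [Matrix.one_apply]
    split_ifs <;> simp
  have : symbolLeray ω a b = (1 : Matrix (Fin 4) (Fin 4) ℝ) a b - (‖ω‖ ^ 2)⁻¹ *
      ((![ω 0, ω 1, ω 2, 0] : Fin 4 → ℝ) a * (![ω 0, ω 1, ω 2, 0] : Fin 4 → ℝ) b) := by
    simp [symbolLeray, Matrix.vecMulVec]
  rw [this]
  exact (abs_sub _ _).trans (by linarith)

lemma abs_matrixA_le {F : ℝ} (hF : 0 < F) (a b : Fin 4) : |matrixA F a b| ≤ 1 + F⁻¹ := by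
  have : 0 < F⁻¹ := by positivity
  fin_cases a <;> fin_cases b <;> simp [matrixA, abs_of_pos hF] <;> linarith

lemma norm_apply_le_norm (z : Val) (i : Fin 4) : ‖z i‖ ≤ ‖z‖ := PiLp.norm_apply_le z i

lemma norm_le_sum_norm (z : Val) : ‖z‖ ≤ ∑ i, ‖z i‖ := by
  rw [EuclideanSpace.norm_eq]
  apply Real.sqrt_le_iff.2
  refine ⟨by positivity, ?_⟩
  exact Finset.sum_sq_le_sq_sum_of_nonneg fun i _ => norm_nonneg _

lemma norm_coriolis_apply_le {F : ℝ} (hF : 0 < F) (ω : Space) (z : Val) (i : Fin 4) :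
    ‖coriolis F ω z i‖ ≤ 32 * (1 + F⁻¹) * ‖z‖ := by
  have hP : 0 < 1 + F⁻¹ := by positivity
  have hent : ∀ b, |(symbolLeray ω * matrixA F) i b| ≤ 8 * (1 + F⁻¹) := by
    intro b
    rw [Matrix.mul_apply]
    refine (Finset.abs_sum_le_sum_abs _ _).trans ?_
    refine (Finset.sum_le_sum fun c _ => ?_).trans
      (b := ∑ _c : Fin 4, 2 * (1 + F⁻¹)) (by simp; linarith)
    rw [abs_mul]
    exact mul_le_mul (abs_symbolLeray_le _ _ _) (abs_matrixA_le hF _ _) (abs_nonneg _) (by norm_num)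
  rw [coriolis, applyMat_apply]
  refine (norm_sum_le _ _).trans ?_
  refine (Finset.sum_le_sum fun c _ => ?_).trans
    (b := ∑ _c : Fin 4, 8 * (1 + F⁻¹) * ‖z‖) (by simp; linarith)
  rw [norm_mul, Complex.norm_real]
  exact mul_le_mul (hent c) (norm_apply_le_norm z c) (norm_nonneg _) (by positivity)

/-- The flow at time `t` of `∂ₜ z = 𝔹(ω, ε) z` on divergence-free fields of zero potential
vorticity. -/
def flow (F ν ε t : ℝ) (ω : Space) (z : Val) : Val :=
  ((Real.exp (-(ν * t) * ‖ω‖ ^ 2) : ℝ) : ℂ) •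
    (((Real.cos (t / ε * phase F ω) : ℝ) : ℂ) • z -
      ((Real.sin (t / ε * phase F ω) / phase F ω : ℝ) : ℂ) • coriolis F ω z)

/-- The components of `z` (up to a factor) along the modes of phase `σ * phase F ω`. -/
def modeComponent (F σ : ℝ) (ω : Space) (z : Val) (i : Fin 4) : ℂ :=
  z i + (σ * Complex.I / phase F ω) * coriolis F ω z i

lemma flow_apply_eq (F ν ε t : ℝ) (ω : Space) (z : Val) (i : Fin 4) :
    flow F ν ε t ω z i = ((Real.exp (-(ν * t) * ‖ω‖ ^ 2) : ℝ) : ℂ) * (2⁻¹ *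
      (Complex.exp ((t * (1 / ε * phase F ω) : ℝ) * Complex.I) * modeComponent F 1 ω z i +
        Complex.exp ((t * (-1 / ε * phase F ω) : ℝ) * Complex.I) *
          modeComponent F (-1) ω z i)) := by
  have e1 : ((t * (1 / ε * phase F ω) : ℝ) : ℂ) = ((t / ε * phase F ω : ℝ) : ℂ) := by
    congr 1; ring
  have e2 : ((t * (-1 / ε * phase F ω) : ℝ) : ℂ) = -((t / ε * phase F ω : ℝ) : ℂ) := by
    rw [← Complex.ofReal_neg]; congr 1; ring
  rw [e1, e2, Complex.exp_mul_I, Complex.exp_mul_I, Complex.cos_neg, Complex.sin_neg]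
  simp only [flow, modeComponent, PiLp.smul_apply, PiLp.sub_apply, smul_eq_mul]
  push_cast
  linear_combination (-(Complex.exp (-((ν : ℂ) * t) * (‖ω‖ : ℂ) ^ 2)) *
    Complex.sin ((t : ℂ) / ε * phase F ω) / phase F ω * coriolis F ω z i) * Complex.I_sq

lemma norm_modeComponent_le {F : ℝ} (hF : 0 < F) {σ : ℝ} (hσ : |σ| = 1) {ω : Space} (hω : ω ≠ 0)
    (z : Val) (i : Fin 4) :
    ‖modeComponent F σ ω z i‖ ≤ (1 + F / min 1 F * (32 * (1 + F⁻¹))) * ‖z‖ := by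
  have ha := phase_pos hF hω
  have hm : 0 < min 1 F := by positivity
  rw [modeComponent]
  refine (norm_add_le _ _).trans ?_
  rw [add_mul, one_mul]
  refine add_le_add (norm_apply_le_norm z i) ?_
  rw [norm_mul, norm_div, norm_mul, Complex.norm_real, Complex.norm_I, Complex.norm_real,
    Real.norm_eq_abs, hσ, one_mul, Real.norm_of_nonneg ha.le, mul_assoc]
  refine mul_le_mul ?_ (norm_coriolis_apply_le hF ω z i) (norm_nonneg _) (by positivity)
  rw [one_div, ← inv_div]
  exact inv_anti₀ (by positivity) (phase_bounds hF hω).1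

/-- The constant in the bounds on the flow. -/
def flowConst (F : ℝ) : ℝ := 1 + F / min 1 F * (32 * (1 + F⁻¹))

lemma flowConst_pos {F : ℝ} (hF : 0 < F) : 0 < flowConst F := by
  have hm : 0 < min 1 F := by positivity
  unfold flowConst
  positivity

lemma norm_flow_le {F : ℝ} (hF : 0 < F) (ν ε t : ℝ) {ω : Space} (hω : ω ≠ 0) (z : Val) :
    ‖flow F ν ε t ω z‖ ≤ 4 * flowConst F * (Real.exp (-(ν * t) * ‖ω‖ ^ 2) * ‖z‖) := by
  refine (norm_le_sum_norm _).trans ?_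
  refine (Finset.sum_le_sum fun i _ => ?_).trans
    (b := ∑ _i : Fin 4, flowConst F * (Real.exp (-(ν * t) * ‖ω‖ ^ 2) * ‖z‖)) (by simp; linarith)
  rw [flow_apply_eq, norm_mul, Complex.norm_real, Real.norm_of_nonneg (Real.exp_pos _).le,
    norm_mul]
  have h1 := norm_modeComponent_le hF (σ := 1) (by simp) hω z i
  have h2 := norm_modeComponent_le hF (σ := -1) (by simp) hω z i
  rw [← flowConst] at h1 h2
  have h3 : ‖Complex.exp ((t * (1 / ε * phase F ω) : ℝ) * Complex.I) * modeComponent F 1 ω z i +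
        Complex.exp ((t * (-1 / ε * phase F ω) : ℝ) * Complex.I) *
          modeComponent F (-1) ω z i‖ ≤ 2 * (flowConst F * ‖z‖) := by
    refine (norm_add_le _ _).trans ?_
    rw [norm_mul, norm_mul, Complex.norm_exp_ofReal_mul_I, Complex.norm_exp_ofReal_mul_I]
    linarith
  have h4 : ‖(2⁻¹ : ℂ)‖ = 2⁻¹ := by simp
  rw [h4]
  have := mul_le_mul_of_nonneg_left h3 (Real.exp_pos (-(ν * t) * ‖ω‖ ^ 2)).le
  linarith

/-! ### Measurability of the flow -/

lemma measurable_of_apply {X : Type*} [MeasurableSpace X] {f : X → Val}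
    (h : ∀ i, Measurable fun x => f x i) : Measurable f :=
  (WithLp.measurable_toLp 2 (Fin 4 → ℂ)).comp (measurable_pi_lambda _ h)

lemma measurable_coriolis (F : ℝ) : Measurable fun p : Space × Val => coriolis F p.1 p.2 := by
  refine measurable_of_apply fun i => ?_
  fin_cases i
  · simp only [Fin.zero_eta, coriolis_zero, coriolisPressure]; fun_prop
  · simp only [Fin.mk_one, coriolis_one, coriolisPressure]; fun_prop
  · simp only [Fin.reduceFinMk, coriolis_two, coriolisPressure]; fun_prop
  · simp only [Fin.reduceFinMk, coriolis_three]; fun_prop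

lemma measurable_modeComponent (F σ : ℝ) (i : Fin 4) :
    Measurable fun p : Space × Val => modeComponent F σ p.1 p.2 i := by
  have h2 : Measurable fun p : Space × Val => (phase F p.1 : ℂ) :=
    Complex.measurable_ofReal.comp ((measurable_phase F).comp measurable_fst)
  have hp : Measurable fun z : Val => z i :=
    (EuclideanSpace.proj i : Val →L[ℂ] ℂ).continuous.measurable
  exact (hp.comp measurable_snd).add ((measurable_const.div h2).mul
    (hp.comp (measurable_coriolis F)))

lemma measurable_flow (F ν ε : ℝ) :
    Measurable fun p : ℝ × Space × Val => flow F ν ε p.1 p.2.1 p.2.2 := by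
  have h1 : Measurable fun p : ℝ × Space × Val => coriolis F p.2.1 p.2.2 :=
    (measurable_coriolis F).comp measurable_snd
  have h2 : Measurable fun p : ℝ × Space × Val => phase F p.2.1 :=
    (measurable_phase F).comp (measurable_fst.comp measurable_snd)
  unfold flow
  fun_prop

lemma measurable_angFreq : Measurable angFreq := by
  unfold angFreq; fun_prop

/-! ### Reduction of a dyadic block to the scalar evolutions -/

/-- `k` is supported in the `j`-th dyadic annulus. -/
def IsBand (j : ℤ) (k : Space → Val) : Prop :=
  ∀ ξ, k ξ ≠ 0 → 3 / 4 * (2 : ℝ) ^ j ≤ ‖angFreq ξ‖ ∧ ‖angFreq ξ‖ ≤ 8 / 3 * (2 : ℝ) ^ j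

lemma IsBand.angFreq_ne_zero {j : ℤ} {k : Space → Val} (hk : IsBand j k) {ξ : Space}
    (h : k ξ ≠ 0) : angFreq ξ ≠ 0 := by
  have := (hk ξ h).1
  have h2 : (0 : ℝ) < 2 ^ j := by positivity
  rw [← norm_pos_iff]
  linarith

/-- The ratio between the frequency variable and the rescaled one. -/
def bandScale (j : ℤ) : ℝ := (2 : ℝ) ^ j / (2 * Real.pi)

lemma bandScale_pos (j : ℤ) : 0 < bandScale j := by unfold bandScale; positivity

lemma angFreq_bandScale_smul (j : ℤ) (ω : Space) :
    angFreq (bandScale j • ω) = (2 : ℝ) ^ j • ω := by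
  rw [angFreq, bandScale, smul_smul, mul_div_cancel₀ _ (by positivity)]

lemma coriolis_zero_right (F : ℝ) (ω : Space) : coriolis F ω 0 = 0 := by
  ext i; simp [coriolis, applyMat_apply]

lemma modeComponent_zero (F σ : ℝ) (ω : Space) (i : Fin 4) : modeComponent F σ ω 0 i = 0 := by
  simp [modeComponent, coriolis_zero_right]

lemma flow_zero (F ν ε t : ℝ) (ω : Space) : flow F ν ε t ω 0 = 0 := by
  simp [flow, coriolis_zero_right]

/-- The rescaled data of the scalar modes. -/
def modeProfile (F σ : ℝ) (j : ℤ) (k : Space → Val) (i : Fin 4) (ω : Space) : ℂ :=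
  modeComponent F σ ((2 : ℝ) ^ j • ω) (k (bandScale j • ω)) i

lemma measurable_modeProfile (F σ : ℝ) (j : ℤ) {k : Space → Val} (hk : Measurable k) (i : Fin 4) :
    Measurable (modeProfile F σ j k i) :=
  (measurable_modeComponent F σ i).comp
    ((measurable_const_smul _).prodMk (hk.comp (measurable_const_smul _)))

lemma suppAnnulus_modeProfile (F σ : ℝ) {j : ℤ} {k : Space → Val} (hk : IsBand j k) (i : Fin 4) :
    SuppAnnulus (modeProfile F σ j k i) := by
  intro ω hω
  have hne : k (bandScale j • ω) ≠ 0 := fun h0 => hω (by rw [modeProfile, h0, modeComponent_zero])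
  have h1 := hk _ hne
  have h2 : (0 : ℝ) < 2 ^ j := by positivity
  rw [angFreq_bandScale_smul, norm_smul, Real.norm_of_nonneg h2.le] at h1
  exact ⟨le_of_mul_le_mul_left (by linarith [h1.1]) h2, le_of_mul_le_mul_left (by linarith [h1.2]) h2⟩

lemma norm_modeProfile_le {F : ℝ} (hF : 0 < F) {σ : ℝ} (hσ : |σ| = 1) {j : ℤ} {k : Space → Val}
    (hk : IsBand j k) (i : Fin 4) (ω : Space) :
    ‖modeProfile F σ j k i ω‖ ≤ flowConst F * ‖k (bandScale j • ω)‖ := by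
  by_cases h0 : k (bandScale j • ω) = 0
  · rw [modeProfile, h0, modeComponent_zero]; simp
  · have := hk.angFreq_ne_zero h0
    rw [angFreq_bandScale_smul] at this
    exact norm_modeComponent_le hF hσ this _ i

lemma integrable_modeProfile {F : ℝ} (hF : 0 < F) {σ : ℝ} (hσ : |σ| = 1) {j : ℤ} {k : Space → Val}
    (hkm : Measurable k) (hki : Integrable k) (hk : IsBand j k) (i : Fin 4) :
    Integrable (modeProfile F σ j k i) :=
  ((hki.comp_smul (bandScale_pos j).ne').norm.const_mul (flowConst F)).mono'
    (measurable_modeProfile F σ j hkm i).aestronglyMeasurable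
    (ae_of_all _ (norm_modeProfile_le hF hσ hk i))

lemma lintegral_comp_smul_space {L : ℝ} (hL : 0 < L) {f : Space → ℝ≥0∞} (hf : Measurable f) :
    ∫⁻ ω, f (L • ω) = ENNReal.ofReal (L ^ 3)⁻¹ * ∫⁻ ξ, f ξ := by
  have h1 := Measure.map_addHaar_smul (volume : Measure Space) hL.ne'
  rw [← lintegral_map (μ := volume) hf (measurable_const_smul L), h1, lintegral_smul_measure,
    smul_eq_mul]
  simp [abs_of_pos hL]

/-- The power -3/2 of the scale is the square root of the Jacobian of the dilation to unit
frequency. -/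
lemma lintegral_modeProfile_le {F : ℝ} (hF : 0 < F) {σ : ℝ} (hσ : |σ| = 1) {j : ℤ}
    {k : Space → Val} (hkm : Measurable k) (hk : IsBand j k) (i : Fin 4) :
    (∫⁻ ω, ‖modeProfile F σ j k i ω‖ₑ ^ (2 : ℝ)) ^ (1 / 2 : ℝ) ≤
      ENNReal.ofReal (flowConst F * bandScale j ^ (-(3 / 2) : ℝ)) * eLpNorm k 2 volume := by
  have hL := bandScale_pos j
  have hC := flowConst_pos hF
  have h1 : ∫⁻ ω, ‖modeProfile F σ j k i ω‖ₑ ^ (2 : ℝ) ≤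
      ENNReal.ofReal (flowConst F) ^ (2 : ℝ) *
        (ENNReal.ofReal (bandScale j ^ 3)⁻¹ * ∫⁻ ξ, ‖k ξ‖ₑ ^ (2 : ℝ)) := by
    rw [← lintegral_comp_smul_space hL (f := fun ξ => ‖k ξ‖ₑ ^ (2 : ℝ)) (by fun_prop),
      ← lintegral_const_mul _ (by fun_prop)]
    refine lintegral_mono fun ω => ?_
    rw [← ENNReal.mul_rpow_of_nonneg _ _ (by norm_num)]
    refine ENNReal.rpow_le_rpow ?_ (by norm_num)
    rw [← ofReal_norm, ← ofReal_norm, ← ENNReal.ofReal_mul hC.le]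
    exact ENNReal.ofReal_le_ofReal (norm_modeProfile_le hF hσ hk i ω)
  refine (ENNReal.rpow_le_rpow h1 (by norm_num)).trans_eq ?_
  rw [ENNReal.mul_rpow_of_nonneg _ _ (by norm_num), ENNReal.mul_rpow_of_nonneg _ _ (by norm_num),
    ← ENNReal.rpow_mul, eLpNorm_eq_lintegral_rpow_enorm_toReal (by norm_num) (by norm_num),
    ENNReal.ofReal_mul hC.le, mul_assoc]
  congr 2
  · norm_num
  · rw [ENNReal.ofReal_rpow_of_nonneg (by positivity) (by norm_num)]
    congr 1
    rw [← Real.rpow_natCast, ← Real.rpow_neg hL.le, ← Real.rpow_mul hL.le]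
    norm_num

/-- The evolution of a dyadic block. -/
def blockEvol (F ν ε : ℝ) (k : Space → Val) (t : ℝ) : Space → Val :=
  𝓕⁻ fun ξ => flow F ν ε t (angFreq ξ) (k ξ)

lemma norm_flow_band_le {F ν ε t : ℝ} (hF : 0 < F) (hν : 0 ≤ ν) (ht : 0 ≤ t) {j : ℤ}
    {k : Space → Val} (hk : IsBand j k) (ξ : Space) :
    ‖flow F ν ε t (angFreq ξ) (k ξ)‖ ≤
      4 * flowConst F * Real.exp (-(ν * 4 ^ j * t / 8)) * ‖k ξ‖ := by
  by_cases h0 : k ξ = 0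
  · rw [h0, flow_zero]; simp
  refine (norm_flow_le hF ν ε t (hk.angFreq_ne_zero h0) _).trans ?_
  rw [mul_assoc, mul_assoc, mul_assoc]
  have hC := flowConst_pos hF
  gcongr
  have h1 := (hk ξ h0).1
  have h2 : (0 : ℝ) < 2 ^ j := by positivity
  have h4 : (4 : ℝ) ^ j = (2 ^ j) ^ 2 := by
    rw [← zpow_natCast, ← zpow_mul, mul_comm, zpow_mul]; norm_num
  have h3 : (4 : ℝ) ^ j / 8 ≤ ‖angFreq ξ‖ ^ 2 := by
    rw [h4]; nlinarith
  have := mul_le_mul_of_nonneg_left h3 (mul_nonneg hν ht)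
  linarith

lemma measurable_flow_comp (F ν ε t : ℝ) {k : Space → Val} (hk : Measurable k) :
    Measurable fun ξ => flow F ν ε t (angFreq ξ) (k ξ) :=
  (measurable_flow F ν ε).comp
    (f := fun ξ => (t, angFreq ξ, k ξ))
    (measurable_const.prodMk (measurable_angFreq.prodMk hk))

lemma integrable_flow {F ν ε t : ℝ} (hF : 0 < F) (hν : 0 ≤ ν) (ht : 0 ≤ t) {j : ℤ}
    {k : Space → Val} (hkm : Measurable k) (hki : Integrable k) (hk : IsBand j k) :
    Integrable fun ξ => flow F ν ε t (angFreq ξ) (k ξ) :=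
  (hki.norm.const_mul _).mono' (measurable_flow_comp F ν ε t hkm).aestronglyMeasurable
    (ae_of_all _ (norm_flow_band_le hF hν ht hk))

lemma integrable_evolSymbol_mul {F b ν t : ℝ} (hν : 0 ≤ ν) (ht : 0 ≤ t) {k : Space → ℂ}
    (hkm : Measurable k) (hk : Integrable k) (hks : SuppAnnulus k) (x : Space) :
    Integrable fun ω => Complex.exp ((inner ℝ x ω : ℝ) * Complex.I) *
      (evolSymbol F b ν t ω * k ω) := by
  have hsm : Measurable (evolSymbol F b ν t) :=
    (measurable_evolSymbol F b ν).comp measurable_prodMk_left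
  refine hk.norm.mono' (by fun_prop) (ae_of_all _ fun ω => ?_)
  rw [norm_mul, Complex.norm_exp_ofReal_mul_I, one_mul, norm_mul, norm_evolSymbol]
  by_cases h0 : k ω = 0
  · simp [h0]
  refine mul_le_of_le_one_left (norm_nonneg _) (Real.exp_le_one_iff.2 ?_)
  have h1 := (hks ω h0).1
  have : 0 ≤ ν * t * (‖ω‖ ^ 2 - 1 / 8) := mul_nonneg (by positivity) (by nlinarith)
  linarith

/-- Substituting ξ = `bandScale j` • ω moves the block to the unit annulus. The phase is unchanged,
the viscosity becomes ν 4^j, and the space variable becomes 2^j x. Writing |ω|² = 1/8 + (|ω|² - 1/8)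
extracts the decay in time used later, and what is left still damps on the annulus. -/
lemma blockEvol_apply_eq {F ν ε t : ℝ} (hF : 0 < F) (hν : 0 ≤ ν) (ht : 0 ≤ t) {j : ℤ}
    {k : Space → Val} (hkm : Measurable k) (hki : Integrable k) (hk : IsBand j k)
    (x : Space) (i : Fin 4) :
    blockEvol F ν ε k t x i =
      ((bandScale j ^ 3 * Real.exp (-(ν * 4 ^ j * t / 8)) * 2⁻¹ : ℝ) : ℂ) *
        (evol F (1 / ε) (ν * 4 ^ j) (modeProfile F 1 j k i) t ((2 : ℝ) ^ j • x) +
          evol F (-1 / ε) (ν * 4 ^ j) (modeProfile F (-1) j k i) t ((2 : ℝ) ^ j • x)) := by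
  have hL := bandScale_pos j
  have h2 : (0 : ℝ) < 2 ^ j := by positivity
  have hν' : 0 ≤ ν * (4 : ℝ) ^ j := by positivity
  have hi := integrable_flow (ε := ε) hF hν ht hkm hki hk
  set e : Space → ℂ := fun ξ => Complex.exp (((2 * Real.pi * inner ℝ ξ x : ℝ) : ℂ) * Complex.I)
  have hie : Integrable fun ξ => e ξ • flow F ν ε t (angFreq ξ) (k ξ) := by
    refine hi.norm.mono' ?_ (ae_of_all _ fun ξ => ?_)
    · have := measurable_flow_comp F ν ε t hkm
      have he : Measurable e := by fun_prop
      exact (he.smul this).aestronglyMeasurable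
    · rw [norm_smul, Complex.norm_exp_ofReal_mul_I, one_mul]
  have e1 : blockEvol F ν ε k t x i = ∫ ξ, e ξ * flow F ν ε t (angFreq ξ) (k ξ) i := by
    rw [blockEvol, Real.fourierInv_eq']
    change (∫ ξ, e ξ • flow F ν ε t (angFreq ξ) (k ξ)) i = _
    have := (EuclideanSpace.proj i : Val →L[ℂ] ℂ).integral_comp_comm hie
    simpa using this.symm
  have e2 := Measure.integral_comp_smul (volume : Measure Space)
    (fun ξ => e ξ * flow F ν ε t (angFreq ξ) (k ξ) i) (bandScale j)
  have e3 : ∫ ξ, e ξ * flow F ν ε t (angFreq ξ) (k ξ) i = ((bandScale j ^ 3 : ℝ) : ℂ) *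
      ∫ ω, e (bandScale j • ω) *
        flow F ν ε t (angFreq (bandScale j • ω)) (k (bandScale j • ω)) i := by
    rw [e2, finrank_euclideanSpace, Fintype.card_fin, abs_of_pos (by positivity), Complex.real_smul,
      ← mul_assoc, ← Complex.ofReal_mul, mul_inv_cancel₀ (by positivity), Complex.ofReal_one, one_mul]
  rw [e1, e3]
  have h4 : (4 : ℝ) ^ j = (2 ^ j) ^ 2 := by
    rw [← zpow_natCast, ← zpow_mul, mul_comm, zpow_mul]; norm_num
  have e4 : ∀ ω, e (bandScale j • ω) *
      flow F ν ε t (angFreq (bandScale j • ω)) (k (bandScale j • ω)) i =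
      ((Real.exp (-(ν * 4 ^ j * t / 8)) * 2⁻¹ : ℝ) : ℂ) *
      (Complex.exp ((inner ℝ ((2 : ℝ) ^ j • x) ω : ℝ) * Complex.I) *
          (evolSymbol F (1 / ε) (ν * 4 ^ j) t ω * modeProfile F 1 j k i ω) +
        Complex.exp ((inner ℝ ((2 : ℝ) ^ j • x) ω : ℝ) * Complex.I) *
          (evolSymbol F (-1 / ε) (ν * 4 ^ j) t ω * modeProfile F (-1) j k i ω)) := by
    intro ω
    have g1 : 2 * Real.pi * inner ℝ (bandScale j • ω) x = inner ℝ ((2 : ℝ) ^ j • x) ω := by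
      rw [real_inner_smul_left, real_inner_smul_left, real_inner_comm, bandScale]
      field_simp
    have g2 : Real.exp (-(ν * t) * ‖(2 : ℝ) ^ j • ω‖ ^ 2) =
        Real.exp (-(ν * 4 ^ j * t / 8)) * Real.exp (-(ν * 4 ^ j * t) * (‖ω‖ ^ 2 - 1 / 8)) := by
      rw [← Real.exp_add, norm_smul, Real.norm_of_nonneg h2.le, mul_pow, h4]
      congr 1; ring
    rw [angFreq_bandScale_smul, flow_apply_eq, phase_smul F h2.ne', g2]
    simp only [e, g1, modeProfile, evolSymbol]
    push_cast
    ring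
  simp_rw [e4]
  rw [integral_const_mul, integral_add]
  · rw [evol, evol]
    push_cast
    ring
  · exact integrable_evolSymbol_mul hν' ht (measurable_modeProfile F 1 j hkm i)
      (integrable_modeProfile hF (by simp) hkm hki hk i) (suppAnnulus_modeProfile F 1 hk i) _
  · exact integrable_evolSymbol_mul hν' ht (measurable_modeProfile F (-1) j hkm i)
      (integrable_modeProfile hF (by simp) hkm hki hk i) (suppAnnulus_modeProfile F (-1) hk i) _

/-! ### Interpolation and Hölder inequalities -/

/-- Pointwise |f|^r ≤ |f|² S^(r - 2). Exponents are written with 1/r so that r = ∞ is included. -/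
lemma eLpNorm_le_of_enorm_le {X E : Type*} [MeasurableSpace X] {μ : Measure X}
    [NormedAddCommGroup E] {f : X → E} (hf : AEStronglyMeasurable f μ) {S : ℝ≥0∞}
    (hS : ∀ x, ‖f x‖ₑ ≤ S) {r : ℝ≥0∞} (hr : 2 ≤ r) :
    eLpNorm f r μ ≤ eLpNorm f 2 μ ^ (2 * (r⁻¹).toReal) * S ^ (1 - 2 * (r⁻¹).toReal) := by
  by_cases htop : r = ∞
  · simp only [htop, ENNReal.inv_top, ENNReal.toReal_zero, mul_zero, ENNReal.rpow_zero, sub_zero,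
      ENNReal.rpow_one, one_mul, eLpNorm_exponent_top]
    exact eLpNormEssSup_le_of_ae_enorm_bound (ae_of_all _ hS)
  have hr0 : r ≠ 0 := by
    rintro rfl
    simp at hr
  have hR : 2 ≤ r.toReal := by
    have := ENNReal.toReal_mono htop hr
    simpa using this
  have hR0 : 0 < r.toReal := by linarith
  rw [eLpNorm_eq_lintegral_rpow_enorm_toReal hr0 htop,
    eLpNorm_eq_lintegral_rpow_enorm_toReal two_ne_zero (by norm_num), ENNReal.toReal_inv]
  have h1 : ∫⁻ x, ‖f x‖ₑ ^ r.toReal ∂μ ≤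
      (∫⁻ x, ‖f x‖ₑ ^ (2 : ℝ) ∂μ) * S ^ (r.toReal - 2) := by
    rw [← lintegral_mul_const'' _ (hf.enorm.pow_const _)]
    refine lintegral_mono fun x => ?_
    have : r.toReal = 2 + (r.toReal - 2) := by ring
    rw [this, ENNReal.rpow_add_of_nonneg _ _ (by norm_num) (by linarith)]
    simp only [add_sub_cancel_left]
    gcongr
    exact hS x
  refine (ENNReal.rpow_le_rpow h1 (by positivity)).trans_eq ?_
  rw [ENNReal.mul_rpow_of_nonneg _ _ (by positivity), ← ENNReal.rpow_mul, ← ENNReal.rpow_mul]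
  simp only [ENNReal.toReal_ofNat]
  congr 2
  · ring
  · field_simp

lemma lintegral_Lp_finsetSum_le {X ι : Type*} [MeasurableSpace X] {μ : Measure X} {P : ℝ}
    (hP : 1 ≤ P) (s : Finset ι) {a : ι → X → ℝ≥0∞} (ha : ∀ i ∈ s, AEMeasurable (a i) μ)
    {B : ℝ≥0∞} (hB : ∀ i ∈ s, (∫⁻ x, a i x ^ P ∂μ) ^ (1 / P) ≤ B) :
    (∫⁻ x, (∑ i ∈ s, a i x) ^ P ∂μ) ^ (1 / P) ≤ s.card * B := by
  classical
  have hP0 : 0 < P := by linarith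
  induction s using Finset.induction_on with
  | empty => simp [hP0]
  | insert i s hi ih =>
    simp only [Finset.sum_insert hi]
    have h1 := ENNReal.lintegral_Lp_add_le (μ := μ) (f := a i) (g := fun x => ∑ i ∈ s, a i x)
      (ha i (Finset.mem_insert_self i s))
      (Finset.aemeasurable_fun_sum _ fun l hl => ha l (Finset.mem_insert_of_mem hl)) hP
    simp only [Pi.add_apply] at h1
    refine h1.trans ?_
    rw [Finset.card_insert_of_notMem hi, Nat.cast_add, Nat.cast_one, add_mul, one_mul, add_comm]
    exact add_le_add (ih (fun l hl => ha l (Finset.mem_insert_of_mem hl))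
      fun l hl => hB l (Finset.mem_insert_of_mem hl)) (hB i (Finset.mem_insert_self i s))

lemma lintegral_exp_neg_mul {c : ℝ} (hc : 0 < c) :
    ∫⁻ t in Ici (0 : ℝ), ENNReal.ofReal (Real.exp (-(c * t))) = ENNReal.ofReal c⁻¹ := by
  have hi : IntegrableOn (fun t => Real.exp (-c * t)) (Ioi 0) :=
    integrableOn_exp_mul_Ioi (neg_lt_zero.2 hc) 0
  have h := integral_exp_mul_Ioi (neg_lt_zero.2 hc) 0
  rw [setLIntegral_congr Ioi_ae_eq_Ici.symm]
  simp only [← neg_mul]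
  rw [← ofReal_integral_eq_lintegral_ofReal hi (ae_of_all _ fun t => (Real.exp_pos _).le), h]
  simp

/-- Hölder's inequality in time with an exponential weight. -/
lemma lintegral_exp_mul_rpow_le {m : ℝ → ℝ≥0∞} (hm : AEMeasurable m (volume.restrict (Ici 0)))
    {c β δ p a P : ℝ} (hc : 0 < c) (hβ : 0 ≤ β) (hδ : 0 ≤ δ) (hp : 0 < p) (hpe : 1 / p = β + δ)
    (ha : a = P * δ) :
    (∫⁻ t in Ici (0 : ℝ), (ENNReal.ofReal (Real.exp (-(c * t))) * m t ^ a) ^ p) ^ (1 / p) ≤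
      ENNReal.ofReal ((β / c) ^ β) * (∫⁻ t in Ici (0 : ℝ), m t ^ P) ^ δ := by
  have hsum : p * β + p * δ = 1 := by rw [← mul_add, ← hpe]; field_simp
  have h1 : ∫⁻ t in Ici (0 : ℝ), (ENNReal.ofReal (Real.exp (-(c * t))) * m t ^ a) ^ p ≤
      ∫⁻ t in Ici (0 : ℝ), ENNReal.ofReal (Real.exp (-(c / β * t))) ^ (p * β) *
        (m t ^ P) ^ (p * δ) := by
    refine setLIntegral_mono' measurableSet_Ici fun t ht => ?_
    rw [ENNReal.mul_rpow_of_nonneg _ _ hp.le, ← ENNReal.rpow_mul, ← ENNReal.rpow_mul]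
    have e1 : a * p = P * (p * δ) := by rw [ha]; ring
    rw [e1]
    gcongr
    rw [ENNReal.ofReal_rpow_of_pos (Real.exp_pos _), ENNReal.ofReal_rpow_of_pos (Real.exp_pos _),
      ← Real.exp_mul, ← Real.exp_mul]
    refine ENNReal.ofReal_le_ofReal (Real.exp_le_exp.2 ?_)
    -- When β = 0, the rate c/β is 0 by convention and the weight is raised to the power 0, so only
    -- exp ≤ 1 is used; this agrees with 0^0 = 1 in the final constant.
    rcases hβ.eq_or_lt with h0 | h0
    · rw [← h0]
      have : 0 ≤ c * t * p := by have := mem_Ici.1 ht; positivity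
      simp; linarith
    · apply le_of_eq
      field_simp
  have h2 := ENNReal.lintegral_mul_norm_pow_le (μ := volume.restrict (Ici (0 : ℝ)))
    (f := fun t => ENNReal.ofReal (Real.exp (-(c / β * t)))) (g := fun t => m t ^ P)
    (by fun_prop) (hm.pow_const _) (mul_nonneg hp.le hβ) (mul_nonneg hp.le hδ) hsum
  refine (ENNReal.rpow_le_rpow (h1.trans h2) (by positivity)).trans_eq ?_
  rw [ENNReal.mul_rpow_of_nonneg _ _ (by positivity), ← ENNReal.rpow_mul, ← ENNReal.rpow_mul]
  have e2 : p * β * (1 / p) = β := by field_simp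
  have e3 : p * δ * (1 / p) = δ := by field_simp
  rw [e2, e3]
  congr 1
  rcases hβ.eq_or_lt with h0 | h0
  · rw [← h0]; simp
  · rw [lintegral_exp_neg_mul (by positivity), ENNReal.ofReal_rpow_of_pos (by positivity), inv_div]

/-! ### Strichartz estimates for a dyadic block -/

/-- The sum over components and modes of the uniform norms of the scalar evolutions. -/
def modeSup (F ν ε : ℝ) (j : ℤ) (k : Space → Val) (t : ℝ) : ℝ≥0∞ :=
  ∑ s : Fin 4 × Bool, ⨆ x, ‖evol F ((if s.2 then 1 else -1) / ε) (ν * 4 ^ j)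
    (modeProfile F (if s.2 then 1 else -1) j k s.1) t x‖ₑ

lemma abs_ite_sign (b : Bool) : |(if b then 1 else -1 : ℝ)| = 1 := by cases b <;> simp

lemma iSup_denseSeq {u : Space → ℝ≥0∞} (hu : Continuous u) :
    ⨆ n, u (TopologicalSpace.denseSeq Space n) = ⨆ x, u x := by
  refine le_antisymm (iSup_le fun n => le_iSup u _) (iSup_le fun x => ?_)
  have hcl : IsClosed {y | u y ≤ ⨆ n, u (TopologicalSpace.denseSeq Space n)} :=
    isClosed_le hu continuous_const
  exact closure_minimal (t := {y | u y ≤ ⨆ n, u (TopologicalSpace.denseSeq Space n)})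
    (range_subset_iff.2 fun n =>
    le_iSup (fun n => u (TopologicalSpace.denseSeq Space n)) n) hcl
    (TopologicalSpace.denseRange_denseSeq Space x)

lemma aemeasurable_iSup_evol {F b ν : ℝ} (hν : 0 ≤ ν) {k : Space → ℂ} (hkm : Measurable k)
    (hk : Integrable k) (hks : SuppAnnulus k) :
    AEMeasurable (fun t => ⨆ x, ‖evol F b ν k t x‖ₑ) (volume.restrict (Ici 0)) := by
  refine AEMeasurable.congr (f := fun t => ⨆ n, ‖evol F b ν k t (TopologicalSpace.denseSeq Space n)‖ₑ) ?_ ?_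
  · refine Measurable.aemeasurable (Measurable.iSup fun n => ?_)
    exact ((measurable_evol F b ν hkm).comp
      (measurable_id.prodMk measurable_const : Measurable fun t : ℝ => (t, TopologicalSpace.denseSeq Space n))).enorm
  · refine (ae_restrict_iff' measurableSet_Ici).2 (ae_of_all _ fun t ht => ?_)
    have hc : Continuous fun x => ‖evol F b ν k t x‖ₑ := (continuous_evol hν hkm hk hks ht).enorm
    exact iSup_denseSeq hc

lemma enorm_blockEvol_le {F ν ε t : ℝ} (hF : 0 < F) (hν : 0 ≤ ν) (ht : 0 ≤ t) {j : ℤ}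
    {k : Space → Val} (hkm : Measurable k) (hki : Integrable k) (hk : IsBand j k) (x : Space) :
    ‖blockEvol F ν ε k t x‖ₑ ≤
      ENNReal.ofReal (bandScale j ^ 3 * Real.exp (-(ν * 4 ^ j / 8 * t))) *
        modeSup F ν ε j k t := by
  have hL := bandScale_pos j
  have h1 : ‖blockEvol F ν ε k t x‖ₑ ≤ ∑ i, ‖blockEvol F ν ε k t x i‖ₑ := by
    simp only [← ofReal_norm]
    rw [← ENNReal.ofReal_sum_of_nonneg fun _ _ => norm_nonneg _]
    exact ENNReal.ofReal_le_ofReal (norm_le_sum_norm _)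
  refine h1.trans ?_
  rw [modeSup, Fintype.sum_prod_type, Finset.mul_sum]
  refine Finset.sum_le_sum fun i _ => ?_
  rw [blockEvol_apply_eq hF hν ht hkm hki hk, enorm_mul, Fintype.sum_bool]
  refine mul_le_mul' ?_ ?_
  · rw [← ofReal_norm, Complex.norm_real, Real.norm_of_nonneg (by positivity)]
    refine ENNReal.ofReal_le_ofReal ?_
    have e : -(ν * 4 ^ j * t / 8) = -(ν * 4 ^ j / 8 * t) := by ring
    rw [e]
    have : 0 < bandScale j ^ 3 * Real.exp (-(ν * 4 ^ j / 8 * t)) := by positivity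
    linarith
  · refine (enorm_add_le _ _).trans (add_le_add ?_ ?_)
    · exact le_iSup (fun x => ‖evol F (1 / ε) (ν * 4 ^ j) (modeProfile F 1 j k i) t x‖ₑ) _
    · exact le_iSup (fun x => ‖evol F (-1 / ε) (ν * 4 ^ j) (modeProfile F (-1) j k i) t x‖ₑ) _

lemma eLpNorm_two_blockEvol_le {F ν ε t : ℝ} (hF : 0 < F) (hν : 0 ≤ ν) (ht : 0 ≤ t) {j : ℤ}
    {k : Space → Val} (hkm : Measurable k) (hki : Integrable k) (hk : IsBand j k) :
    eLpNorm (blockEvol F ν ε k t) 2 volume ≤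
      ENNReal.ofReal (4 * flowConst F * Real.exp (-(ν * 4 ^ j / 8 * t))) * eLpNorm k 2 volume := by
  refine (eLpNorm_two_fourierInv_le (integrable_flow hF hν ht hkm hki hk)).trans ?_
  refine eLpNorm_le_mul_eLpNorm_of_ae_le_mul (ae_of_all _ fun ξ => ?_) 2
  have e : -(ν * 4 ^ j / 8 * t) = -(ν * 4 ^ j * t / 8) := by ring
  rw [e]
  exact norm_flow_band_le hF hν ht hk ξ

lemma aemeasurable_modeSup {F ν ε : ℝ} (hF : 0 < F) (hν : 0 ≤ ν) {j : ℤ}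
    {k : Space → Val} (hkm : Measurable k) (hki : Integrable k) (hk : IsBand j k) :
    AEMeasurable (modeSup F ν ε j k) (volume.restrict (Ici 0)) := by
  unfold modeSup
  exact Finset.aemeasurable_fun_sum _ fun s _ => aemeasurable_iSup_evol (by positivity)
    (measurable_modeProfile F _ j hkm _)
    (integrable_modeProfile hF (abs_ite_sign s.2) hkm hki hk _) (suppAnnulus_modeProfile F _ hk _)

/-- Triangle inequality over 8 scalar evolutions, four components times two signs. The frequency
parameter is b = ±1/ε, so 2/|b| becomes 2ε: this is where the gain in ε originates. -/
lemma exists_lintegral_modeSup_le {ψ : Space → ℝ} (hψ : IsLPCutoff ψ) {F : ℝ} (hF : 0 < F)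
    (hF1 : F ≠ 1) :
    ∃ C : ℝ, 0 ≤ C ∧ ∀ (P ν ε : ℝ), 8 < P → 0 ≤ ν → 0 < ε → ∀ (j : ℤ) (k : Space → Val),
      Measurable k → Integrable k → IsBand j k →
      (∫⁻ t in Ici 0, modeSup F ν ε j k t ^ P) ^ (1 / P) ≤
        ENNReal.ofReal (C * bandScale j ^ (-(3 / 2) : ℝ) * (2 * ε / (1 - 8 / P)) ^ (1 / P)) *
          eLpNorm k 2 volume := by
  obtain ⟨C, hC, H⟩ := exists_lintegral_iSup_evol_le hψ hF hF1
  refine ⟨8 * (flowConst F * C), by have := flowConst_pos hF; positivity,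
    fun P ν ε hP hν hε j k hkm hki hk => ?_⟩
  have hfc := flowConst_pos hF
  have hL := bandScale_pos j
  set B : ℝ≥0∞ := ENNReal.ofReal (flowConst F * bandScale j ^ (-(3 / 2) : ℝ)) * eLpNorm k 2 volume *
    ENNReal.ofReal (C * (2 * ε / (1 - 8 / P)) ^ (1 / P)) with hB
  have h1 := lintegral_Lp_finsetSum_le (μ := volume.restrict (Ici (0 : ℝ))) (P := P) (by linarith)
    (Finset.univ : Finset (Fin 4 × Bool))
    (a := fun s t => ⨆ x, ‖evol F ((if s.2 then 1 else -1) / ε) (ν * 4 ^ j)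
      (modeProfile F (if s.2 then 1 else -1) j k s.1) t x‖ₑ) (B := B)
    (fun s _ => aemeasurable_iSup_evol (by positivity) (measurable_modeProfile F _ j hkm _)
      (integrable_modeProfile hF (abs_ite_sign s.2) hkm hki hk _)
      (suppAnnulus_modeProfile F _ hk _)) (fun s _ => ?_)
  · refine h1.trans_eq ?_
    have hpos : 0 ≤ (2 * ε / (1 - 8 / P)) ^ (1 / P) := by
      apply Real.rpow_nonneg
      have : 8 / P < 1 := by rw [div_lt_one (by linarith)]; exact hP
      exact div_nonneg (by positivity) (by linarith)
    rw [hB, mul_right_comm, ← mul_assoc, ← ENNReal.ofReal_mul (by positivity)]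
    have : ((Finset.univ : Finset (Fin 4 × Bool)).card : ℝ≥0∞) = ENNReal.ofReal 8 := by
      simp
    rw [this, ← ENNReal.ofReal_mul (by norm_num)]
    congr 2
    ring
  · have hb : (if s.2 then 1 else -1) / ε ≠ 0 := by
      have := abs_ite_sign s.2
      refine div_ne_zero (fun h => ?_) hε.ne'
      rw [h] at this; simp at this
    refine (H P _ (ν * 4 ^ j) hP hb (by positivity) _ (measurable_modeProfile F _ j hkm _)
      (integrable_modeProfile hF (abs_ite_sign s.2) hkm hki hk _)
      (suppAnnulus_modeProfile F _ hk _)).trans ?_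
    rw [hB]
    refine mul_le_mul' (lintegral_modeProfile_le hF (abs_ite_sign s.2) hkm hk _) (le_of_eq ?_)
    rw [abs_div, abs_ite_sign, abs_of_pos hε]
    congr 3
    field_simp

lemma four_zpow_eq (j : ℤ) : (4 : ℝ) ^ j = (2 : ℝ) ^ ((j : ℝ) * 2) := by
  rw [Real.rpow_mul (by norm_num), Real.rpow_intCast, Real.rpow_ofNat, ← zpow_natCast, ← zpow_mul,
    mul_comm, zpow_mul]
  norm_num

/-- Interpolation in space between the energy bound and the wave bound, followed by Hölder in time
between the exponential weight (exponent 1/p - δ) and the L^P norm of the waves (exponent δ). -/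
lemma exists_lintegral_blockEvol_le {ψ : Space → ℝ} (hψ : IsLPCutoff ψ) {F : ℝ} (hF : 0 < F)
    (hF1 : F ≠ 1) :
    ∃ C : ℝ, 0 < C ∧ ∀ (r : ℝ≥0∞) (p δ ν ε : ℝ), 4 < r → 1 ≤ p → 0 < δ →
      8 * δ < 1 - 2 * (r⁻¹).toReal → δ ≤ 1 / p → 0 < ν → 0 < ε → ∀ (j : ℤ) (k : Space → Val),
      Measurable k → Integrable k → IsBand j k →
      (∫⁻ t in Ici 0, eLpNorm (blockEvol F ν ε k t) r volume ^ p) ^ (1 / p) ≤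
        ENNReal.ofReal (C * (2 / lpInner ^ 2 * (1 / p - δ)) ^ (1 / p - δ) / ν ^ (1 / p - δ) *
          (ε ^ δ * (2 / (1 - 2 * (r⁻¹).toReal - 8 * δ))) *
          (2 : ℝ) ^ ((j : ℝ) * (3 / 2 * (1 - 2 * (r⁻¹).toReal) - 2 * (1 / p - δ)))) *
          eLpNorm k 2 volume := by
  obtain ⟨K, hK, H⟩ := exists_lintegral_modeSup_le hψ hF hF1
  have hfc := flowConst_pos hF
  set D : ℝ := 4 * flowConst F + K with hD
  have hD0 : 0 < D := by positivity
  refine ⟨3 * D, by positivity, fun r p δ ν ε hr hp hδ hδ8 hδp hν hε j k hkm hki hk => ?_⟩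
  set ρ := (r⁻¹).toReal with hρ
  set β := 1 / p - δ with hβ
  have hρ0 : 0 ≤ ρ := ENNReal.toReal_nonneg
  have hβ0 : 0 ≤ β := by linarith
  have hp0 : 0 < p := by linarith
  have hβ1 : β ≤ 1 := by
    have : 1 / p ≤ 1 := by rw [div_le_one hp0]; exact hp
    linarith
  set κ := 1 - 2 * ρ with hκ
  have hκ0 : 0 < κ := by linarith
  have hκ1 : κ ≤ 1 := by linarith
  -- Interpolation raises the supremum to the power κ = 1 - 2/r while Hölder leaves the time
  -- exponent δ, which forces κ = Pδ. The hypothesis on 8δ says exactly that P > 8.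
  set P := κ / δ with hP
  have hP8 : 8 < P := by rw [hP, lt_div_iff₀ hδ]; exact hδ8
  have hPδ : κ = P * δ := by rw [hP]; field_simp
  have hL := bandScale_pos j
  set L := bandScale j with hLdef
  set c := ν * 4 ^ j / 8 with hc
  have hc0 : 0 < c := by positivity
  set N := eLpNorm k 2 volume with hN
  set m := modeSup F ν ε j k with hm
  -- Both endpoints carry the same exponential, and the interpolation exponents 2/r and 1 - 2/r add
  -- up to 1, so it survives in full.
  have hpt : ∀ t ∈ Ici (0 : ℝ), eLpNorm (blockEvol F ν ε k t) r volume ≤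
      (ENNReal.ofReal D * N) ^ (2 * ρ) * ENNReal.ofReal (L ^ 3) ^ κ *
        (ENNReal.ofReal (Real.exp (-(c * t))) * m t ^ κ) := by
    intro t ht
    have hcont : Continuous (blockEvol F ν ε k t) :=
      continuous_fourierInv (integrable_flow hF hν.le ht hkm hki hk)
    refine (eLpNorm_le_of_enorm_le hcont.aestronglyMeasurable
      (enorm_blockEvol_le hF hν.le ht hkm hki hk)
      ((by norm_num : (2 : ℝ≥0∞) ≤ 4).trans hr.le)).trans ?_
    rw [← hρ, ← hκ, ← hm, ← hc, ← hLdef]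
    have h2 : eLpNorm (blockEvol F ν ε k t) 2 volume ≤
        ENNReal.ofReal D * N * ENNReal.ofReal (Real.exp (-(c * t))) := by
      refine (eLpNorm_two_blockEvol_le hF hν.le ht hkm hki hk).trans ?_
      rw [mul_right_comm (ENNReal.ofReal D), ← ENNReal.ofReal_mul hD0.le]
      gcongr
      linarith
    calc _ ≤ (ENNReal.ofReal D * N * ENNReal.ofReal (Real.exp (-(c * t)))) ^ (2 * ρ) *
          (ENNReal.ofReal (L ^ 3 * Real.exp (-(c * t))) * m t) ^ κ := by gcongr
      _ = _ := by
        rw [ENNReal.mul_rpow_of_nonneg _ _ (by positivity), ENNReal.mul_rpow_of_nonneg _ (m t) hκ0.le,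
          ENNReal.ofReal_mul (by positivity), ENNReal.mul_rpow_of_nonneg _ _ hκ0.le]
        have : ENNReal.ofReal (Real.exp (-(c * t))) ^ (2 * ρ) *
            ENNReal.ofReal (Real.exp (-(c * t))) ^ κ = ENNReal.ofReal (Real.exp (-(c * t))) := by
          rw [← ENNReal.rpow_add_of_nonneg _ _ (by positivity) hκ0.le]
          rw [hκ, add_sub_cancel, ENNReal.rpow_one]
        calc _ = (ENNReal.ofReal D * N) ^ (2 * ρ) * ENNReal.ofReal (L ^ 3) ^ κ *
            ((ENNReal.ofReal (Real.exp (-(c * t))) ^ (2 * ρ) *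
            ENNReal.ofReal (Real.exp (-(c * t))) ^ κ) * m t ^ κ) := by ring
          _ = _ := by rw [this]
  have hmm : AEMeasurable m (volume.restrict (Ici 0)) := aemeasurable_modeSup hF hν.le hkm hki hk
  set A : ℝ≥0∞ := (ENNReal.ofReal D * N) ^ (2 * ρ) * ENNReal.ofReal (L ^ 3) ^ κ with hA
  have hInt : (∫⁻ t in Ici 0, eLpNorm (blockEvol F ν ε k t) r volume ^ p) ^ (1 / p) ≤
      A * (ENNReal.ofReal ((β / c) ^ β) * (∫⁻ t in Ici (0 : ℝ), m t ^ P) ^ δ) := by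
    refine le_trans ?_ (mul_le_mul_right (lintegral_exp_mul_rpow_le hmm hc0 hβ0 hδ.le hp0
      (by rw [hβ]; ring) hPδ) A)
    have : (A : ℝ≥0∞) = (A ^ p) ^ (1 / p) := by
      rw [← ENNReal.rpow_mul, mul_one_div_cancel hp0.ne', ENNReal.rpow_one]
    conv_rhs => rw [this]
    rw [← ENNReal.mul_rpow_of_nonneg _ _ (by positivity)]
    refine ENNReal.rpow_le_rpow ?_ (by positivity)
    rw [← lintegral_const_mul'' _ (by fun_prop)]
    refine setLIntegral_mono' measurableSet_Ici fun t ht => ?_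
    rw [← ENNReal.mul_rpow_of_nonneg _ _ hp0.le]
    exact ENNReal.rpow_le_rpow (hpt t ht) hp0.le
  refine hInt.trans ?_
  have h8P : 1 - 8 / P = (κ - 8 * δ) / κ := by
    rw [hP]; field_simp
  have hv : 0 < κ - 8 * δ := by linarith
  have hm2 : (∫⁻ t in Ici (0 : ℝ), m t ^ P) ^ δ ≤
      (ENNReal.ofReal (D * L ^ (-(3 / 2) : ℝ)) * N) ^ κ *
        ENNReal.ofReal (ε ^ δ * (2 / (κ - 8 * δ))) := by
    have h1 := H P ν ε hP8 hν.le hε j k hkm hki hk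
    have h2 : (∫⁻ t in Ici (0 : ℝ), m t ^ P) ^ δ =
        ((∫⁻ t in Ici (0 : ℝ), m t ^ P) ^ (1 / P)) ^ κ := by
      rw [← ENNReal.rpow_mul]; congr 1; rw [hPδ]; field_simp
    rw [h2]
    refine (ENNReal.rpow_le_rpow h1 hκ0.le).trans ?_
    rw [ENNReal.ofReal_mul (by positivity), mul_right_comm, ENNReal.mul_rpow_of_nonneg _ _ hκ0.le]
    refine mul_le_mul' (ENNReal.rpow_le_rpow ?_ hκ0.le) ?_
    · gcongr
      linarith
    · have hpos : 0 < 2 * ε / (1 - 8 / P) := by rw [h8P]; positivity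
      rw [ENNReal.ofReal_rpow_of_pos (by positivity), ← Real.rpow_mul hpos.le]
      refine ENNReal.ofReal_le_ofReal ?_
      have e1 : 1 / P * κ = δ := by rw [hPδ]; field_simp
      rw [e1, h8P]
      have e2 : 2 * ε / ((κ - 8 * δ) / κ) = ε * (2 * κ / (κ - 8 * δ)) := by field_simp
      rw [e2, Real.mul_rpow hε.le (by positivity)]
      refine mul_le_mul_of_nonneg_left ?_ (by positivity)
      -- Since κ ≤ 1, the base is at most 2/(κ - 8δ), which is at least 1; as δ ≤ 1, its power δ may
      -- be replaced by the base itself.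
      have h3 : 2 * κ / (κ - 8 * δ) ≤ 2 / (κ - 8 * δ) := by gcongr; linarith
      refine (Real.rpow_le_rpow (by positivity) h3 hδ.le).trans ?_
      refine (Real.rpow_le_rpow_of_exponent_le ?_ (by linarith : δ ≤ 1)).trans_eq (Real.rpow_one _)
      rw [le_div_iff₀ hv]; linarith
  refine (mul_le_mul_right (mul_le_mul_right hm2 _) A).trans ?_
  have hNN : N ^ (2 * ρ) * N ^ κ = N := by
    rw [← ENNReal.rpow_add_of_nonneg _ _ (by positivity) hκ0.le, hκ, add_sub_cancel,
      ENNReal.rpow_one]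
  have hreal : D ^ (2 * ρ) * (L ^ 3) ^ κ * ((β / c) ^ β * ((D * L ^ (-(3 / 2) : ℝ)) ^ κ *
      (ε ^ δ * (2 / (κ - 8 * δ))))) ≤
      3 * D * (2 / lpInner ^ 2 * β) ^ β / ν ^ β * (ε ^ δ * (2 / (κ - 8 * δ))) *
          (2 : ℝ) ^ ((j : ℝ) * (3 / 2 * κ - 2 * β)) := by
    have r1 : D ^ (2 * ρ) * D ^ κ = D := by
      rw [← Real.rpow_add hD0, hκ, add_sub_cancel, Real.rpow_one]
    -- The Jacobian contributes L³ and the L² rescaling L^(-3/2), leaving L^(3/2) to the power κ;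
    -- here L ≤ 2^j because 2π ≥ 1.
    have r2 : (L ^ 3) ^ κ * (L ^ (-(3 / 2) : ℝ)) ^ κ ≤ (2 : ℝ) ^ ((j : ℝ) * (3 / 2 * κ)) := by
      rw [← Real.rpow_natCast, ← Real.rpow_mul hL.le, ← Real.rpow_mul hL.le, ← Real.rpow_add hL,
        Real.rpow_mul (by norm_num : (0 : ℝ) ≤ 2), Real.rpow_intCast]
      have e : ((3 : ℕ) : ℝ) * κ + -(3 / 2) * κ = 3 / 2 * κ := by push_cast; ring
      rw [e]
      refine Real.rpow_le_rpow hL.le ?_ (by positivity)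
      rw [hLdef, bandScale]
      exact div_le_self (by positivity) (by linarith [Real.pi_gt_three])
    have r3 : (β / c) ^ β ≤ 3 * ((2 / lpInner ^ 2 * β) ^ β / ν ^ β *
        (2 : ℝ) ^ ((j : ℝ) * (- (2 * β)))) := by
      -- The decay rate used is ν 4^j/8, and 8 = (9/4)·(2/c₀²) with c₀ = 3/4. The spare factor
      -- (9/4)^β is at most 3 because β ≤ 1.
      have e : β / c = 9 / 4 * (2 / lpInner ^ 2 * β) / ν / (2 : ℝ) ^ ((j : ℝ) * 2) := by
        rw [hc, four_zpow_eq, lpInner]; field_simp; ring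
      have hl : 0 ≤ 2 / lpInner ^ 2 * β := by rw [lpInner]; positivity
      rw [e, Real.div_rpow (by positivity) (by positivity), Real.div_rpow (by positivity) hν.le,
        Real.mul_rpow (by norm_num) hl, ← Real.rpow_mul (by norm_num)]
      have e2 : (2 : ℝ) ^ ((j : ℝ) * (-(2 * β))) = ((2 : ℝ) ^ ((j : ℝ) * 2 * β))⁻¹ := by
        rw [← Real.rpow_neg (by norm_num)]; congr 1; ring
      rw [e2, ← div_eq_mul_inv, ← mul_div_assoc, ← mul_div_assoc]
      gcongr
      calc (9 / 4 : ℝ) ^ β ≤ (9 / 4 : ℝ) ^ (1 : ℝ) :=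
            Real.rpow_le_rpow_of_exponent_le (by norm_num) hβ1
        _ ≤ 3 := by norm_num
    have e3 : (2 : ℝ) ^ ((j : ℝ) * (3 / 2 * κ - 2 * β)) =
        (2 : ℝ) ^ ((j : ℝ) * (3 / 2 * κ)) * (2 : ℝ) ^ ((j : ℝ) * (-(2 * β))) := by
      rw [← Real.rpow_add (by norm_num)]; congr 1; ring
    have hl : 0 ≤ 2 / lpInner ^ 2 * β := by rw [lpInner]; positivity
    rw [e3, Real.mul_rpow hD0.le (by positivity)]
    calc _ = (D ^ (2 * ρ) * D ^ κ) * (((L ^ 3) ^ κ * (L ^ (-(3 / 2) : ℝ)) ^ κ) * (β / c) ^ β) *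
          (ε ^ δ * (2 / (κ - 8 * δ))) := by ring
      _ ≤ D * ((2 : ℝ) ^ ((j : ℝ) * (3 / 2 * κ)) * (3 * ((2 / lpInner ^ 2 * β) ^ β / ν ^ β *
          (2 : ℝ) ^ ((j : ℝ) * (- (2 * β)))))) * (ε ^ δ * (2 / (κ - 8 * δ))) := by
        rw [r1]
        gcongr
      _ = _ := by ring
  calc _ = ENNReal.ofReal (D ^ (2 * ρ) * (L ^ 3) ^ κ * ((β / c) ^ β *
        ((D * L ^ (-(3 / 2) : ℝ)) ^ κ * (ε ^ δ * (2 / (κ - 8 * δ)))))) * (N ^ (2 * ρ) * N ^ κ) := by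
        rw [hA, ENNReal.mul_rpow_of_nonneg _ _ (by positivity), ENNReal.mul_rpow_of_nonneg _ _ hκ0.le,
          ENNReal.ofReal_rpow_of_pos hD0, ENNReal.ofReal_rpow_of_pos (pow_pos hL 3),
          ENNReal.ofReal_rpow_of_pos (mul_pos hD0 (Real.rpow_pos_of_pos hL _)),
          ENNReal.ofReal_mul (p := D ^ (2 * ρ) * (L ^ 3) ^ κ) (by positivity),
          ENNReal.ofReal_mul (p := D ^ (2 * ρ)) (by positivity),
          ENNReal.ofReal_mul (p := (β / c) ^ β) (by positivity),
          ENNReal.ofReal_mul (p := (D * L ^ (-(3 / 2) : ℝ)) ^ κ) (by positivity)]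
        ring
    _ ≤ _ := by
        rw [hNN]
        gcongr

/-! ### Minkowski's integral inequality -/

/-- The standard proof of Minkowski's inequality: write h^p = h^(p-1) h, exchange the integrals,
apply Hölder in x, and divide by a power of the left side. Introducing a minorant h of finite norm
is what makes the division legitimate. -/
lemma lintegral_rpow_lintegral_le_of_le {X Y : Type*} [MeasurableSpace X] [MeasurableSpace Y]
    {μ : Measure X} {ν : Measure Y} [SFinite μ] [SFinite ν] {f : X → Y → ℝ≥0∞}
    (hf : Measurable (Function.uncurry f)) {p : ℝ} (hp : 1 < p) {h : X → ℝ≥0∞} (hh : Measurable h)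
    (hle : ∀ x, h x ≤ ∫⁻ y, f x y ∂ν) (hfin : ∫⁻ x, h x ^ p ∂μ ≠ ∞) :
    (∫⁻ x, h x ^ p ∂μ) ^ (1 / p) ≤ ∫⁻ y, (∫⁻ x, f x y ^ p ∂μ) ^ (1 / p) ∂ν := by
  have hp0 : 0 < p := by linarith
  set A := ∫⁻ x, h x ^ p ∂μ with hA
  by_cases hA0 : A = 0
  · rw [hA0, ENNReal.zero_rpow_of_pos (by positivity)]; exact zero_le
  have hpq := Real.HolderConjugate.conjExponent hp
  set q := p.conjExponent with hq
  have hq0 : 0 < q := hpq.symm.pos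
  have h1 : A ≤ A ^ (1 / q) * ∫⁻ y, (∫⁻ x, f x y ^ p ∂μ) ^ (1 / p) ∂ν := by
    calc A ≤ ∫⁻ x, ∫⁻ y, h x ^ (p - 1) * f x y ∂ν ∂μ := by
          refine lintegral_mono fun x => ?_
          have hfx : Measurable fun y => f x y := hf.comp measurable_prodMk_left
          rw [lintegral_const_mul _ hfx]
          calc h x ^ p = h x ^ (p - 1) * h x := by
                conv_lhs => rw [show p = (p - 1) + 1 by ring]
                rw [ENNReal.rpow_add_of_nonneg _ _ (by linarith) zero_le_one, ENNReal.rpow_one]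
            _ ≤ _ := by gcongr; exact hle x
      _ = ∫⁻ y, ∫⁻ x, h x ^ (p - 1) * f x y ∂μ ∂ν :=
          lintegral_lintegral_swap ((((hh.pow_const _).comp measurable_fst).mul hf).aemeasurable)
      _ ≤ ∫⁻ y, A ^ (1 / q) * (∫⁻ x, f x y ^ p ∂μ) ^ (1 / p) ∂ν := by
          refine lintegral_mono fun y => ?_
          have := ENNReal.lintegral_mul_le_Lp_mul_Lq μ hpq.symm
            (f := fun x => h x ^ (p - 1)) (g := fun x => f x y)
            (hh.pow_const _).aemeasurable (hf.comp measurable_prodMk_right).aemeasurable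
          refine this.trans_eq ?_
          congr 2
          rw [hA]
          refine lintegral_congr fun x => ?_
          rw [← ENNReal.rpow_mul, hpq.sub_one_mul_conj]
      _ = _ := by
          rw [lintegral_const_mul]
          exact (Measurable.lintegral_prod_left' (hf.pow_const p)).pow_const _
  have hAq0 : A ^ (1 / q) ≠ 0 := (ENNReal.rpow_pos (pos_iff_ne_zero.2 hA0) hfin).ne'
  have hAqt : A ^ (1 / q) ≠ ∞ := ENNReal.rpow_ne_top_of_nonneg (by positivity) hfin
  have h2 : A = A ^ (1 / q) * A ^ (1 / p) := by
    rw [← ENNReal.rpow_add _ _ hA0 hfin, one_div, one_div, hpq.symm.inv_add_inv_eq_one,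
      ENNReal.rpow_one]
  exact (ENNReal.mul_le_mul_iff_right hAq0 hAqt).1 (h2.symm.trans_le h1)

theorem lintegral_rpow_lintegral_le {X Y : Type*} [MeasurableSpace X] [MeasurableSpace Y]
    {μ : Measure X} {ν : Measure Y} [SigmaFinite μ] [SFinite ν] {f : X → Y → ℝ≥0∞}
    (hf : Measurable (Function.uncurry f)) {p : ℝ} (hp : 1 ≤ p) :
    (∫⁻ x, (∫⁻ y, f x y ∂ν) ^ p ∂μ) ^ (1 / p) ≤ ∫⁻ y, (∫⁻ x, f x y ^ p ∂μ) ^ (1 / p) ∂ν := by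
  rcases hp.eq_or_lt with rfl | hp
  · simp only [ENNReal.rpow_one, one_div_one]
    rw [lintegral_lintegral_swap hf.aemeasurable]
  have hp0 : 0 < p := by linarith
  set I : X → ℝ≥0∞ := fun x => ∫⁻ y, f x y ∂ν with hI
  have hIm : Measurable I := Measurable.lintegral_prod_right' hf
  -- Truncation both in height and in space gives minorants of finite norm that increase to the full
  -- integral.
  set h : ℕ → X → ℝ≥0∞ := fun n => (spanningSets μ n).indicator fun x => min (I x) n with hh
  have hhm : ∀ n, Measurable (h n) := fun n =>
    (hIm.min measurable_const).indicator (measurableSet_spanningSets μ n)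
  have hmono : ∀ x, Monotone fun n => h n x := by
    intro x n m hnm
    simp only [hh, indicator]
    split_ifs with h1 h2
    · exact min_le_min le_rfl (by exact_mod_cast hnm)
    · exact absurd (monotone_spanningSets μ hnm h1) h2
    · exact zero_le
    · exact le_rfl
  have hsup : ∀ x, ⨆ n, h n x = I x := by
    intro x
    refine le_antisymm (iSup_le fun n => ?_) ?_
    · simp only [hh, indicator]
      split_ifs
      · exact min_le_left _ _
      · exact zero_le
    · refine le_of_forall_lt fun c hc => ?_
      obtain ⟨n, hn⟩ := ENNReal.exists_nat_gt (ne_top_of_lt hc)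
      have hx : x ∈ ⋃ n, spanningSets μ n := by rw [iUnion_spanningSets]; trivial
      obtain ⟨m, hm⟩ := mem_iUnion.1 hx
      refine lt_of_lt_of_le ?_ (le_iSup _ (max n m))
      have hx' : x ∈ spanningSets μ (max n m) := monotone_spanningSets μ (le_max_right n m) hm
      simp only [hh, indicator_of_mem hx']
      exact lt_min hc (hn.trans_le (by exact_mod_cast le_max_left n m))
  have hbound : ∀ n, (∫⁻ x, h n x ^ p ∂μ) ≤ (∫⁻ y, (∫⁻ x, f x y ^ p ∂μ) ^ (1 / p) ∂ν) ^ p := by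
    intro n
    have hfin : ∫⁻ x, h n x ^ p ∂μ ≠ ∞ := by
      have : ∫⁻ x, h n x ^ p ∂μ ≤ ∫⁻ x in spanningSets μ n, (n : ℝ≥0∞) ^ p ∂μ := by
        rw [← lintegral_indicator (measurableSet_spanningSets μ n)]
        refine lintegral_mono fun x => ?_
        simp only [hh, indicator]
        split_ifs
        · exact ENNReal.rpow_le_rpow (min_le_right _ _) hp0.le
        · rw [ENNReal.zero_rpow_of_pos hp0]
      refine ne_top_of_le_ne_top ?_ this
      rw [setLIntegral_const]
      exact ENNReal.mul_ne_top (ENNReal.rpow_ne_top_of_nonneg hp0.le (ENNReal.natCast_ne_top n))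
        (measure_spanningSets_lt_top μ n).ne
    have := lintegral_rpow_lintegral_le_of_le hf hp (hhm n)
      (fun x => (le_iSup (fun n => h n x) n).trans_eq (hsup x)) hfin
    have h2 := ENNReal.rpow_le_rpow this hp0.le
    rwa [← ENNReal.rpow_mul, one_div_mul_cancel hp0.ne', ENNReal.rpow_one] at h2
  have hlim : ∫⁻ x, I x ^ p ∂μ = ⨆ n, ∫⁻ x, h n x ^ p ∂μ := by
    rw [← lintegral_iSup (fun n => (hhm n).pow_const p)]
    · refine lintegral_congr fun x => ?_
      rw [← hsup x]
      exact (ENNReal.monotone_rpow_of_nonneg hp0.le).map_iSup_of_continuousAt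
        ENNReal.continuous_rpow_const.continuousAt (by simp [hp0])
    · intro n m hnm x
      exact ENNReal.rpow_le_rpow (hmono x hnm) hp0.le
  have hfinal : ∫⁻ x, I x ^ p ∂μ ≤ (∫⁻ y, (∫⁻ x, f x y ^ p ∂μ) ^ (1 / p) ∂ν) ^ p := by
    rw [hlim]; exact iSup_le hbound
  have h2 := ENNReal.rpow_le_rpow hfinal (by positivity : 0 ≤ 1 / p)
  rwa [← ENNReal.rpow_mul, mul_one_div_cancel hp0.ne', ENNReal.rpow_one] at h2

lemma enorm_le_eLpNorm_top_of_continuous {w : Space → Val} (hw : Continuous w) (x : Space) :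
    ‖w x‖ₑ ≤ eLpNorm w ∞ volume := by
  have h1 : ∀ᵐ y, ‖w y‖ₑ ≤ eLpNorm w ∞ volume := by
    rw [eLpNorm_exponent_top]
    exact enorm_ae_le_eLpNormEssSup w volume
  have hcl : IsClosed {y | ‖w y‖ₑ ≤ eLpNorm w ∞ volume} := isClosed_le hw.enorm continuous_const
  have := (Measure.dense_of_ae h1).closure_eq
  rw [hcl.closure_eq] at this
  exact this.ge (mem_univ x)

/-- Minkowski's inequality for the `L^r` norm of a superposition of continuous functions. -/
lemma eLpNorm_le_lintegral_eLpNorm {μ : Measure ℝ} [SFinite μ] {E : ℝ → Space → Val}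
    (hE : Measurable (Function.uncurry E)) (hc : ∀ᵐ s ∂μ, Continuous (E s)) {w : Space → Val}
    (hw : ∀ x, ‖w x‖ₑ ≤ ∫⁻ s, ‖E s x‖ₑ ∂μ) {r : ℝ≥0∞} (hr : 1 ≤ r) :
    eLpNorm w r volume ≤ ∫⁻ s, eLpNorm (E s) r volume ∂μ := by
  by_cases htop : r = ∞
  · rw [htop, eLpNorm_exponent_top]
    refine eLpNormEssSup_le_of_ae_enorm_bound (ae_of_all _ fun x => (hw x).trans ?_)
    refine lintegral_mono_ae ?_
    filter_upwards [hc] with s hs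
    exact enorm_le_eLpNorm_top_of_continuous hs x
  have hr0 : r ≠ 0 := (zero_lt_one.trans_le hr).ne'
  have hR : 1 ≤ r.toReal := by
    have := ENNReal.toReal_mono htop hr
    simpa using this
  simp only [eLpNorm_eq_lintegral_rpow_enorm_toReal hr0 htop]
  have hE' : Measurable (Function.uncurry fun (x : Space) (s : ℝ) => ‖E s x‖ₑ) :=
    (hE.comp measurable_swap).enorm
  refine le_trans ?_ (lintegral_rpow_lintegral_le hE' hR)
  refine ENNReal.rpow_le_rpow (lintegral_mono fun x => ?_) (by positivity)
  exact ENNReal.rpow_le_rpow (hw x) (by positivity)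

/-! ### The `ℓ^q` norm -/

lemma lqNorm_eq_lintegral {q : ℝ≥0∞} (hq : q ≠ ∞) (a : ℤ → ℝ≥0∞) :
    lqNorm q a = (∫⁻ j, a j ^ q.toReal ∂Measure.count) ^ (1 / q.toReal) := by
  rw [lqNorm, if_neg hq, lintegral_count]

lemma one_le_toReal {q : ℝ≥0∞} (h1 : 1 ≤ q) (hq : q ≠ ∞) : 1 ≤ q.toReal := by
  have := ENNReal.toReal_mono hq h1
  simpa using this

lemma lqNorm_mono {q : ℝ≥0∞} {a b : ℤ → ℝ≥0∞} (h : ∀ j, a j ≤ b j) : lqNorm q a ≤ lqNorm q b := by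
  unfold lqNorm
  split_ifs
  · exact iSup_mono h
  · gcongr with j
    exact h j

lemma lqNorm_const_mul {q : ℝ≥0∞} (hq : 1 ≤ q) (c : ℝ≥0∞) (a : ℤ → ℝ≥0∞) :
    lqNorm q (fun j => c * a j) = c * lqNorm q a := by
  by_cases htop : q = ∞
  · simp only [lqNorm, if_pos htop, ENNReal.mul_iSup]
  have h1 := one_le_toReal hq htop
  have h0 : 0 < q.toReal := by linarith
  simp only [lqNorm, if_neg htop, ENNReal.mul_rpow_of_nonneg _ _ h0.le, ENNReal.tsum_mul_left]
  rw [ENNReal.mul_rpow_of_nonneg _ _ (by positivity), ← ENNReal.rpow_mul,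
    mul_one_div_cancel h0.ne', ENNReal.rpow_one]

lemma lqNorm_add_le {q : ℝ≥0∞} (hq : 1 ≤ q) (a b : ℤ → ℝ≥0∞) :
    lqNorm q (fun j => a j + b j) ≤ lqNorm q a + lqNorm q b := by
  by_cases htop : q = ∞
  · simp only [lqNorm, if_pos htop]
    exact iSup_le fun j => add_le_add (le_iSup a j) (le_iSup b j)
  simp only [lqNorm_eq_lintegral htop]
  exact ENNReal.lintegral_Lp_add_le (Measurable.of_discrete).aemeasurable
    (Measurable.of_discrete).aemeasurable (one_le_toReal hq htop)

/-- Minkowski's integral inequality with counting measure on the dyadic indices. -/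
lemma lqNorm_lintegral_le {q : ℝ≥0∞} (hq : 1 ≤ q) {μ : Measure ℝ} [SFinite μ]
    {a : ℤ → ℝ → ℝ≥0∞} (ha : ∀ j, Measurable (a j)) :
    lqNorm q (fun j => ∫⁻ s, a j s ∂μ) ≤ ∫⁻ s, lqNorm q (fun j => a j s) ∂μ := by
  by_cases htop : q = ∞
  · simp only [lqNorm, if_pos htop]
    exact iSup_le fun j => lintegral_mono fun s => le_iSup (fun j => a j s) j
  simp only [lqNorm_eq_lintegral htop]
  exact lintegral_rpow_lintegral_le (measurable_from_prod_countable_right ha)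
    (one_le_toReal hq htop)

/-! ### Duhamel's formula -/

/-- The exponential `exp (t B)`. -/
def expFlow (B : Val →L[ℂ] Val) (t : ℝ) : Val →L[ℂ] Val := NormedSpace.exp (t • B)

lemma expFlow_zero (B : Val →L[ℂ] Val) : expFlow B 0 = 1 :=
  (congrArg NormedSpace.exp (zero_smul ℝ B)).trans NormedSpace.exp_zero

lemma hasDerivAt_expFlow (B : Val →L[ℂ] Val) (t : ℝ) :
    HasDerivAt (expFlow B) (expFlow B t * B) t :=
  hasDerivAt_exp_smul_const B t

lemma continuous_expFlow (B : Val →L[ℂ] Val) : Continuous (expFlow B) :=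
  continuous_iff_continuousAt.2 fun t => (hasDerivAt_expFlow B t).continuousAt

lemma hasDerivAt_expFlow_sub (B : Val →L[ℂ] Val) (t s : ℝ) :
    HasDerivAt (fun s => expFlow B (t - s)) (-(expFlow B (t - s) * B)) s := by
  have h1 : HasDerivAt (fun s : ℝ => t - s) (-1) s := by
    simpa using (hasDerivAt_id s).const_sub t
  exact ((hasDerivAt_expFlow B (t - s)).scomp s h1).congr_deriv (neg_one_smul ℝ _)

/-- Uniqueness for the linear equation: s ↦ exp((t - s)B) y(s) has zero derivative, and its values
at 0 and t are the two sides. -/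
lemma expFlow_apply_eq (B : Val →L[ℂ] Val) {y : ℝ → Val} (hy : ∀ t, HasDerivAt y (B (y t)) t)
    (t : ℝ) : expFlow B t (y 0) = y t := by
  have h : ∀ s, HasDerivAt (fun s => expFlow B (t - s) (y s)) 0 s := by
    intro s
    have h1 : HasDerivAt (fun s => (expFlow B (t - s)).restrictScalars ℝ)
        ((-(expFlow B (t - s) * B)).restrictScalars ℝ) s :=
      (ContinuousLinearMap.restrictScalarsL ℂ Val Val ℝ ℝ).hasFDerivAt.comp_hasDerivAt s
        (hasDerivAt_expFlow_sub B t s)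
    have := h1.clm_apply (hy s)
    simpa using this
  have := is_const_of_deriv_eq_zero (fun s => (h s).differentiableAt) (fun s => (h s).deriv) 0 t
  simpa [expFlow_zero] using this

/-- Duhamel's formula for `y = z₀ + ∫ u`. -/
lemma duhamel (B : Val →L[ℂ] Val) {t : ℝ} (ht : 0 ≤ t) {z₀ : Val} {u y : ℝ → Val}
    (hu : IntegrableOn u (Ioc 0 t))
    (hy : ∀ᵐ s ∂volume.restrict (Ioc 0 t), y s = z₀ + ∫ σ in (0 : ℝ)..s, u σ) :
    z₀ + ∫ s in (0 : ℝ)..t, u s =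
      expFlow B t z₀ + ∫ s in (0 : ℝ)..t, expFlow B (t - s) (u s - B (y s)) := by
  set μ := volume.restrict (Ioc (0 : ℝ) t) with hμ
  have : IsFiniteMeasure μ := ⟨by rw [hμ]; simp⟩
  have hcE : Continuous fun s => expFlow B (t - s) :=
    (continuous_expFlow B).comp (continuous_const.sub continuous_id)
  set Ψ : ℝ → Val →L[ℂ] Val := fun s => expFlow B (t - s) * B with hΨ
  have hΨc : Continuous Ψ := hcE.mul continuous_const
  -- Here Ψ is minus the derivative of s ↦ exp((t - s)B). Since u is only integrable, the proof
  -- avoids differentiating y: it inserts y = z₀ + ∫ u and exchanges integrals.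
  have hFTC : ∀ (σ : ℝ) (v : Val), ∫ s in σ..t, Ψ s v = expFlow B (t - σ) v - v := by
    intro σ v
    have hd : ∀ s, HasDerivAt (fun s => -(expFlow B (t - s) v)) (Ψ s v) s := by
      intro s
      have := (((ContinuousLinearMap.apply ℂ Val v).restrictScalars ℝ).hasFDerivAt.comp_hasDerivAt s
        (hasDerivAt_expFlow_sub B t s)).neg
      exact this.congr_deriv (by simp [hΨ])
    rw [intervalIntegral.integral_eq_sub_of_hasDerivAt (fun s _ => hd s)
      ((hΨc.clm_apply continuous_const).intervalIntegrable _ _)]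
    simp [expFlow_zero]
    abel
  obtain ⟨C, hC⟩ := isCompact_Icc.exists_bound_of_continuousOn (s := Icc 0 t) hΨc.continuousOn
  obtain ⟨C', hC'⟩ := isCompact_Icc.exists_bound_of_continuousOn (s := Icc 0 t) hcE.continuousOn
  set L : (Val →L[ℂ] Val) →L[ℂ] Val →L[ℂ] Val := ContinuousLinearMap.id ℂ _ with hL
  have hEu : Integrable (fun s => expFlow B (t - s) (u s)) μ := by
    refine (hu.norm.const_mul C').mono' ?_ ?_
    · exact L.aestronglyMeasurable_comp₂ hcE.aestronglyMeasurable hu.aestronglyMeasurable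
    · refine (ae_restrict_iff' measurableSet_Ioc).2 (ae_of_all _ fun s hs => ?_)
      exact (ContinuousLinearMap.le_opNorm _ _).trans
        (mul_le_mul_of_nonneg_right (hC' s ⟨hs.1.le, hs.2⟩) (norm_nonneg _))
  -- The integrand on the triangle σ ≤ s ≤ t. Integrated first in σ it gives Ψ applied to the
  -- primitive of u; integrated first in s it is computed by the fundamental theorem.
  set f : ℝ → ℝ → Val := fun s σ => (Iic s).indicator (fun σ => Ψ s (u σ)) σ with hf
  have hfi : Integrable (Function.uncurry f) (μ.prod μ) := by
    have hb : Integrable (fun p : ℝ × ℝ => C * ‖u p.2‖) (μ.prod μ) :=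
      (hu.norm.const_mul C).comp_snd μ
    have hms : MeasurableSet {p : ℝ × ℝ | p.2 ≤ p.1} := measurableSet_le measurable_snd measurable_fst
    have hfe : Function.uncurry f = {p : ℝ × ℝ | p.2 ≤ p.1}.indicator fun p => Ψ p.1 (u p.2) := by
      ext1 p
      simp [Function.uncurry, hf, indicator]
    rw [hfe]
    refine hb.mono' (AEStronglyMeasurable.indicator ?_ hms) ?_
    · exact L.aestronglyMeasurable_comp₂ (hΨc.comp continuous_fst).aestronglyMeasurable
        hu.aestronglyMeasurable.comp_snd
    · have hae : ∀ᵐ p : ℝ × ℝ ∂μ.prod μ, p.1 ∈ Ioc 0 t :=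
        Measure.quasiMeasurePreserving_fst.ae (ae_restrict_mem measurableSet_Ioc)
      filter_upwards [hae] with p hp
      have h1 : ‖Ψ p.1 (u p.2)‖ ≤ C * ‖u p.2‖ := (ContinuousLinearMap.le_opNorm _ _).trans
        (mul_le_mul_of_nonneg_right (hC p.1 ⟨hp.1.le, hp.2⟩) (norm_nonneg _))
      exact (norm_indicator_le_norm_self _ _).trans h1
  have hf1 : ∀ s ∈ Ioc 0 t, ∫ σ, f s σ ∂μ = Ψ s (∫ σ in (0 : ℝ)..s, u σ) := by
    intro s hs
    rw [hf]
    simp only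
    rw [integral_indicator measurableSet_Iic, hμ, Measure.restrict_restrict measurableSet_Iic,
      intervalIntegral.integral_of_le hs.1.le]
    have : Iic s ∩ Ioc 0 t = Ioc 0 s := by
      ext σ; simp only [mem_inter_iff, mem_Iic, mem_Ioc]
      exact ⟨fun h => ⟨h.2.1, h.1⟩, fun h => ⟨h.2, h.1, h.2.trans hs.2⟩⟩
    rw [this]
    exact (Ψ s).integral_comp_comm (hu.mono_set (Ioc_subset_Ioc_right hs.2))
  have hf2 : ∀ σ ∈ Ioc 0 t, ∫ s, f s σ ∂μ = expFlow B (t - σ) (u σ) - u σ := by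
    intro σ hσ
    rw [← hFTC, intervalIntegral.integral_of_le hσ.2,
      ← integral_Icc_eq_integral_Ioc (f := fun s => Ψ s (u σ)) (x := σ) (y := t)]
    have e : (fun s => f s σ) = (Ici σ).indicator fun s => Ψ s (u σ) := by
      ext1 s; simp [hf, indicator]
    rw [e, integral_indicator measurableSet_Ici, hμ, Measure.restrict_restrict measurableSet_Ici]
    have : Ici σ ∩ Ioc 0 t = Icc σ t := by
      ext s; simp only [mem_inter_iff, mem_Ici, mem_Ioc, mem_Icc]
      exact ⟨fun h => ⟨h.1, h.2.2⟩, fun h => ⟨h.1, hσ.1.trans_le h.1, h.2⟩⟩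
    rw [this]
  have hswap : ∫ s, Ψ s (∫ σ in (0 : ℝ)..s, u σ) ∂μ =
      ∫ s, expFlow B (t - s) (u s) ∂μ - ∫ s, u s ∂μ := by
    rw [← integral_sub hEu hu]
    calc _ = ∫ s, ∫ σ, f s σ ∂μ ∂μ :=
          (setIntegral_congr_fun measurableSet_Ioc hf1).symm
      _ = ∫ σ, ∫ s, f s σ ∂μ ∂μ := integral_integral_swap hfi
      _ = _ := setIntegral_congr_fun measurableSet_Ioc hf2
  have hint1 : Integrable (fun s => Ψ s (∫ σ in (0 : ℝ)..s, u σ)) μ := by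
    refine hfi.integral_prod_left.congr ?_
    exact (ae_restrict_iff' measurableSet_Ioc).2 (ae_of_all _ hf1)
  have hint2 : Integrable (fun s => Ψ s z₀) μ :=
    ((hΨc.clm_apply continuous_const).integrableOn_Icc.mono_set Ioc_subset_Icc_self)
  have hmain : ∫ s, expFlow B (t - s) (u s - B (y s)) ∂μ =
      ∫ s, (expFlow B (t - s) (u s) - (Ψ s z₀ + Ψ s (∫ σ in (0 : ℝ)..s, u σ))) ∂μ := by
    refine integral_congr_ae ?_
    filter_upwards [hy] with s hs
    rw [map_sub, hs, ← map_add]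
    rfl
  have hsplit : ∫ s, (expFlow B (t - s) (u s) - (Ψ s z₀ + Ψ s (∫ σ in (0 : ℝ)..s, u σ))) ∂μ =
      ∫ s, expFlow B (t - s) (u s) ∂μ -
        (∫ s, Ψ s z₀ ∂μ + ∫ s, Ψ s (∫ σ in (0 : ℝ)..s, u σ) ∂μ) :=
    (integral_sub hEu (hint2.add hint1)).trans (congrArg _ (integral_add hint2 hint1))
  rw [intervalIntegral.integral_of_le ht, intervalIntegral.integral_of_le ht, ← hμ, hmain, hsplit,
    hswap]
  have := hFTC 0 z₀
  rw [intervalIntegral.integral_of_le ht, ← hμ, sub_zero] at this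
  rw [this]
  abel

lemma applyMat_symbolB (F ν ε : ℝ) (ω : Space) (z : Val) :
    applyMat (symbolB F ν ν ε ω) z =
      ((-(ν * ‖ω‖ ^ 2) : ℝ) : ℂ) • z - ((ε⁻¹ : ℝ) : ℂ) • coriolis F ω z := by
  have hL : symbolL ν ν ω = Matrix.diagonal fun _ => -(ν * ‖ω‖ ^ 2) := by
    rw [symbolL]
    congr 1
    ext i
    fin_cases i <;> simp
  ext i
  simp only [symbolB, hL, coriolis, applyMat_apply, PiLp.sub_apply, PiLp.smul_apply, smul_eq_mul,
    Matrix.sub_apply, Matrix.smul_apply, Complex.ofReal_sub, sub_mul, Finset.sum_sub_distrib,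
    Complex.ofReal_mul, Finset.mul_sum, mul_assoc]
  congr 1
  rw [Finset.sum_eq_single i (fun b _ hb => by simp [Matrix.diagonal_apply_ne' _ hb]) (by simp)]
  simp [mul_assoc]

lemma hasDerivAt_flow {F ν ε : ℝ} (hF : 0 < F) {ω : Space} (hω : ω ≠ 0) {z : Val}
    (hz : IsWave F ω z) (t : ℝ) :
    HasDerivAt (fun t => flow F ν ε t ω z)
      (applyMatCLM (symbolB F ν ν ε ω) (flow F ν ε t ω z)) t := by
  have ha : (phase F ω : ℝ) ≠ 0 := (phase_pos hF hω).ne'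
  set a := phase F ω with haa
  have d1 : HasDerivAt (fun t : ℝ => Real.exp (-(ν * t) * ‖ω‖ ^ 2))
      (Real.exp (-(ν * t) * ‖ω‖ ^ 2) * (-(ν * ‖ω‖ ^ 2))) t := by
    have : HasDerivAt (fun t : ℝ => -(ν * t) * ‖ω‖ ^ 2) (-(ν * 1) * ‖ω‖ ^ 2) t :=
      (((hasDerivAt_id t).const_mul ν).neg).mul_const _
    convert this.exp using 1
    ring
  have d0 : HasDerivAt (fun t : ℝ => t / ε * a) (1 / ε * a) t :=
    ((hasDerivAt_id t).div_const ε).mul_const a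
  have d2 := d0.cos
  have d3 := (d0.sin).div_const a
  have d4 := d1.ofReal_comp.smul ((d2.ofReal_comp.smul_const z).sub
    (d3.ofReal_comp.smul_const (coriolis F ω z)))
  refine d4.congr_deriv ?_
  have hcc := coriolis_coriolis hF hω hz
  have hM : coriolis F ω (flow F ν ε t ω z) = ((Real.exp (-(ν * t) * ‖ω‖ ^ 2) : ℝ) : ℂ) •
    (((Real.cos (t / ε * a) : ℝ) : ℂ) • coriolis F ω z -
      ((Real.sin (t / ε * a) / a : ℝ) : ℂ) • coriolis F ω (coriolis F ω z)) := by
    have hlin : ∀ w, coriolis F ω w = applyMatCLM (symbolLeray ω * matrixA F) w := fun w => rfl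
    rw [flow, ← haa]
    simp only [hlin, map_smul, map_sub]
  have hac : (a : ℂ) ≠ 0 := by exact_mod_cast ha
  rw [applyMatCLM_apply, applyMat_symbolB, hM, hcc, flow, ← haa]
  ext i
  simp only [PiLp.add_apply, PiLp.sub_apply, PiLp.smul_apply, Pi.sub_apply, smul_eq_mul]
  push_cast
  field_simp
  ring

lemma expFlow_apply_of_isWave {F ν ε : ℝ} (hF : 0 < F) {ω : Space} (hω : ω ≠ 0) {z : Val}
    (hz : IsWave F ω z) (t : ℝ) :
    expFlow (applyMatCLM (symbolB F ν ν ε ω)) t z = flow F ν ε t ω z := by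
  have := expFlow_apply_eq _ (hasDerivAt_flow (ν := ν) (ε := ε) hF hω hz) t
  have h0 : flow F ν ε 0 ω z = z := by simp [flow]
  rwa [h0] at this

/-- Duhamel's formula at a fixed frequency. -/
lemma duhamel_flow {F ν ε t : ℝ} (hF : 0 < F) (ht : 0 ≤ t) {ω : Space} (hω : ω ≠ 0) {z₀ : Val}
    (hz₀ : IsWave F ω z₀) {y h : ℝ → Val} (hyi : IntegrableOn y (Ioc 0 t))
    (hhi : IntegrableOn h (Ioc 0 t)) (hh : ∀ᵐ s ∂volume.restrict (Ioc 0 t), IsWave F ω (h s))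
    (hy : ∀ᵐ s ∂volume.restrict (Ioc 0 t), y s = z₀ + ∫ σ in (0 : ℝ)..s,
      (applyMat (symbolB F ν ν ε ω) (y σ) + h σ)) :
    z₀ + ∫ s in (0 : ℝ)..t, (applyMat (symbolB F ν ν ε ω) (y s) + h s) =
      flow F ν ε t ω z₀ + ∫ s in (0 : ℝ)..t, flow F ν ε (t - s) ω (h s) := by
  set B := applyMatCLM (symbolB F ν ν ε ω) with hB
  have hu : IntegrableOn (fun s => applyMat (symbolB F ν ν ε ω) (y s) + h s) (Ioc 0 t) :=
    (B.integrable_comp hyi).add hhi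
  rw [duhamel B ht hu hy, hB, expFlow_apply_of_isWave hF hω hz₀]
  congr 1
  rw [intervalIntegral.integral_of_le ht, intervalIntegral.integral_of_le ht]
  refine integral_congr_ae ?_
  filter_upwards [hh] with s hs
  rw [applyMatCLM_apply, add_sub_cancel_left, expFlow_apply_of_isWave hF hω hs]

/-! ### Duhamel's formula for solutions of the linear system -/

lemma measurableSet_timeInterval (T : ℝ≥0∞) : MeasurableSet (timeInterval T) :=
  measurableSet_Ici.inter (ENNReal.measurable_ofReal measurableSet_Iio)

lemma Icc_subset_timeInterval {T : ℝ≥0∞} {t : ℝ} (ht : t ∈ timeInterval T) :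
    Icc 0 t ⊆ timeInterval T := fun _ hs =>
  ⟨hs.1, (ENNReal.ofReal_le_ofReal hs.2).trans_lt ht.2⟩

lemma timeInterval_eq_iUnion (T : ℝ≥0∞) :
    timeInterval T = ⋃ q : {q : ℚ // (q : ℝ) ∈ timeInterval T}, Icc (0 : ℝ) (q : ℚ) := by
  ext t
  rw [mem_iUnion]
  constructor
  · intro ht
    obtain ⟨q, hq0, hq1, hq2⟩ := ENNReal.lt_iff_exists_rat_btwn.1 ht.2
    have hq0' : (0 : ℝ) ≤ q := by exact_mod_cast hq0
    refine ⟨⟨q, hq0', hq2⟩, ht.1, ?_⟩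
    exact ((ENNReal.ofReal_lt_ofReal_iff_of_nonneg ht.1).1 hq1).le
  · rintro ⟨q, hq⟩
    exact Icc_subset_timeInterval q.2 hq

/-- An exhaustion of `ℝ³ \ {0}` by compact annuli. -/
def annulus (n : ℕ) : Set Space := Metric.closedBall 0 n \ Metric.ball 0 (1 / (n + 1 : ℝ))

lemma isCompact_annulus (n : ℕ) : IsCompact (annulus n) :=
  (isCompact_closedBall 0 _).diff Metric.isOpen_ball

lemma zero_notMem_annulus (n : ℕ) : (0 : Space) ∉ annulus n := fun h =>
  h.2 (Metric.mem_ball_self (by positivity))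

lemma iUnion_annulus : ⋃ n, annulus n = ({0}ᶜ : Set Space) := by
  ext ξ
  rw [mem_iUnion]
  constructor
  · rintro ⟨n, hn⟩ h0
    rw [mem_singleton_iff] at h0
    exact zero_notMem_annulus n (h0 ▸ hn)
  · intro h0
    have hpos : 0 < ‖ξ‖ := norm_pos_iff.2 h0
    obtain ⟨n, hn⟩ := exists_nat_gt ‖ξ‖
    obtain ⟨m, hm⟩ := exists_nat_one_div_lt hpos
    refine ⟨max n m, ?_, ?_⟩
    · rw [mem_closedBall_zero_iff]
      exact hn.le.trans (by exact_mod_cast le_max_left n m)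
    · rw [mem_ball_zero_iff, not_lt]
      refine le_trans ?_ hm.le
      have : (m : ℝ) ≤ (max n m : ℕ) := by exact_mod_cast le_max_right n m
      gcongr

lemma restrict_compl_zero : (volume : Measure Space).restrict {0}ᶜ = volume :=
  Measure.restrict_eq_self_of_ae_mem (Measure.ae_ne volume (0 : Space))

/-- Integrability on `[0, t] × K` for `t < T` and compact `K ⊆ ℝ³ \ {0}`. -/
def LocIntegrable (T : ℝ≥0∞) (H : ℝ → Space → Val) : Prop :=
  ∀ t ∈ timeInterval T, ∀ K : Set Space, IsCompact K → (0 : Space) ∉ K →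
    IntegrableOn (Function.uncurry H) (Icc 0 t ×ˢ K) (volume.prod volume)

lemma LocIntegrable.aestronglyMeasurable {T : ℝ≥0∞} {H : ℝ → Space → Val}
    (hH : LocIntegrable T H) :
    AEStronglyMeasurable (Function.uncurry H)
      ((volume.restrict (timeInterval T)).prod (volume : Measure Space)) := by
  conv => arg 2; arg 2; rw [← restrict_compl_zero]
  rw [Measure.prod_restrict, ← iUnion_annulus, timeInterval_eq_iUnion, iUnion_prod_const,
    aestronglyMeasurable_iUnion_iff]
  intro q
  rw [prod_iUnion, aestronglyMeasurable_iUnion_iff]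
  exact fun n =>
    (hH q q.2 _ (isCompact_annulus n) (zero_notMem_annulus n)).aestronglyMeasurable

lemma LocIntegrable.ae_integrableOn {T : ℝ≥0∞} {H : ℝ → Space → Val}
    (hH : LocIntegrable T H) {t : ℝ} (ht : t ∈ timeInterval T) :
    ∀ᵐ ξ : Space, IntegrableOn (fun s => H s ξ) (Icc 0 t) := by
  have h1 : ∀ n, ∀ᵐ ξ : Space, ξ ∈ annulus n → IntegrableOn (fun s => H s ξ) (Icc 0 t) := by
    intro n
    have h2 := hH t ht _ (isCompact_annulus n) (zero_notMem_annulus n)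
    rw [IntegrableOn, ← Measure.prod_restrict] at h2
    exact (ae_restrict_iff' (isCompact_annulus n).measurableSet).1 h2.prod_left_ae
  filter_upwards [ae_all_iff.2 h1, Measure.ae_ne volume (0 : Space)] with ξ h2 h3
  have : ξ ∈ ⋃ n, annulus n := by rw [iUnion_annulus]; exact h3
  obtain ⟨n, hn⟩ := mem_iUnion.1 this
  exact h2 n hn

lemma ae_ae_swap {μ : Measure ℝ} [SFinite μ] {P : ℝ × Space → Prop}
    (h : ∀ᵐ p ∂μ.prod (volume : Measure Space), P p) :
    ∀ᵐ ξ : Space, ∀ᵐ s ∂μ, P (s, ξ) :=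
  Measure.ae_ae_of_ae_prod
    ((Measure.measurePreserving_swap (μ := (volume : Measure Space)) (ν := μ)).quasiMeasurePreserving.ae h)

lemma measurable_applyMat_symbolB (F ν ε : ℝ) :
    Measurable fun p : Space × Val => applyMat (symbolB F ν ν ε p.1) p.2 := by
  have := measurable_coriolis F
  simp only [applyMat_symbolB]
  fun_prop

lemma measurableSet_isWave {X : Type*} [MeasurableSpace X] {F : ℝ} {a : X → Space} {b : X → Val}
    (ha : Measurable a) (hb : Measurable b) : MeasurableSet {x | IsWave F (a x) (b x)} := by
  have ha' : ∀ i, Measurable fun x => ((a x i : ℝ) : ℂ) := fun i =>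
    Complex.measurable_ofReal.comp
      ((EuclideanSpace.proj i : Space →L[ℝ] ℝ).continuous.measurable.comp ha)
  have hb' : ∀ i, Measurable fun x => b x i := fun i =>
    (EuclideanSpace.proj i : Val →L[ℂ] ℂ).continuous.measurable.comp hb
  exact (measurableSet_eq_fun ((((ha' 0).mul (hb' 0)).add ((ha' 1).mul (hb' 1))).add
    ((ha' 2).mul (hb' 2))) measurable_const).inter
    (measurableSet_eq_fun ((((ha' 0).mul (hb' 1)).sub ((ha' 1).mul (hb' 0))).sub
      (measurable_const.mul ((ha' 2).mul (hb' 3)))) measurable_const)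

/-- The equation holds at each time for almost every frequency, whereas Duhamel is applied at one
frequency for almost every time. Fubini exchanges the quantifiers once g and G are replaced by
jointly measurable versions. -/
theorem exists_measurable_duhamel {F ν ε : ℝ} (hF : 0 < F) {T : ℝ≥0∞} {g₀ : Space → Val}
    {g G : ℝ → Space → Val} (hg₀ : AEStronglyMeasurable g₀ volume) (hg : LocIntegrable T g)
    (hG : LocIntegrable T G) (hw₀ : ∀ᵐ ξ : Space, IsWave F (angFreq ξ) (g₀ ξ))
    (hwG : ∀ᵐ s ∂volume.restrict (timeInterval T), ∀ᵐ ξ : Space, IsWave F (angFreq ξ) (G s ξ))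
    (heq : ∀ t ∈ timeInterval T, ∀ᵐ ξ : Space, g t ξ = g₀ ξ +
      ∫ s in (0 : ℝ)..t, (applyMat (symbolB F ν ν ε (angFreq ξ)) (g s ξ) + G s ξ)) :
    ∃ (g₀' : Space → Val) (G' : ℝ → Space → Val), Measurable g₀' ∧
      Measurable (Function.uncurry G') ∧ g₀' =ᵐ[volume] g₀ ∧
      (∀ᵐ s ∂volume.restrict (timeInterval T), G' s =ᵐ[volume] G s) ∧ LocIntegrable T G' ∧
      ∀ t ∈ timeInterval T, ∀ᵐ ξ : Space, g t ξ = flow F ν ε t (angFreq ξ) (g₀' ξ) +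
        ∫ s in (0 : ℝ)..t, flow F ν ε (t - s) (angFreq ξ) (G' s ξ) := by
  set I := timeInterval T with hI
  have hIm : MeasurableSet I := measurableSet_timeInterval T
  have hgm := hg.aestronglyMeasurable
  have hGm := hG.aestronglyMeasurable
  set g' : ℝ × Space → Val := hgm.mk _ with hg'
  set G' : ℝ × Space → Val := hGm.mk _ with hG'
  set g₀' : Space → Val := hg₀.mk _ with hg₀'
  have mg' : Measurable g' := hgm.stronglyMeasurable_mk.measurable
  have mG' : Measurable G' := hGm.stronglyMeasurable_mk.measurable
  have mg₀' : Measurable g₀' := hg₀.stronglyMeasurable_mk.measurable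
  have e0 : g₀ =ᵐ[volume] g₀' := hg₀.ae_eq_mk
  have eg : ∀ᵐ p ∂(volume.restrict I).prod (volume : Measure Space), g p.1 p.2 = g' p :=
    hgm.ae_eq_mk
  have eG : ∀ᵐ p ∂(volume.restrict I).prod (volume : Measure Space), G p.1 p.2 = G' p :=
    hGm.ae_eq_mk
  have eg2 := ae_ae_swap eg
  have eG1 := Measure.ae_ae_of_ae_prod eG
  have eG2 := ae_ae_swap eG
  simp only at eg2 eG1 eG2
  have hGloc : LocIntegrable T (fun s ξ => G' (s, ξ)) := by
    intro t ht K hK h0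
    refine (hG t ht K hK h0).congr ?_
    have hle : (volume.prod (volume : Measure Space)).restrict (Icc 0 t ×ˢ K) ≤
        (volume.restrict I).prod (volume : Measure Space) := by
      rw [← Measure.prod_restrict]
      exact Measure.prod_mono (Measure.restrict_mono (Icc_subset_timeInterval ht) le_rfl)
        Measure.restrict_le_self
    exact hle.absolutelyContinuous.ae_le eG
  have hgloc : LocIntegrable T (fun s ξ => g' (s, ξ)) := by
    intro t ht K hK h0
    refine (hg t ht K hK h0).congr ?_
    have hle : (volume.prod (volume : Measure Space)).restrict (Icc 0 t ×ˢ K) ≤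
        (volume.restrict I).prod (volume : Measure Space) := by
      rw [← Measure.prod_restrict]
      exact Measure.prod_mono (Measure.restrict_mono (Icc_subset_timeInterval ht) le_rfl)
        Measure.restrict_le_self
    exact hle.absolutelyContinuous.ae_le eg
  refine ⟨g₀', fun s ξ => G' (s, ξ), mg₀', mG', e0.symm, ?_, hGloc, ?_⟩
  · filter_upwards [eG1] with s hs
    exact EventuallyEq.symm hs
  set U : ℝ → Space → Val := fun s ξ =>
    applyMat (symbolB F ν ν ε (angFreq ξ)) (g' (s, ξ)) + G' (s, ξ) with hU
  have mU : Measurable (Function.uncurry U) :=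
    ((measurable_applyMat_symbolB F ν ε).comp
      ((measurable_angFreq.comp measurable_snd).prodMk mg')).add mG'
  have hsub : ∀ {t}, t ∈ I → Ioc 0 t ⊆ I := fun ht =>
    Ioc_subset_Icc_self.trans (Icc_subset_timeInterval ht)
  have heq' : ∀ t ∈ I, ∀ᵐ ξ : Space, g t ξ = g₀' ξ + ∫ s in (0 : ℝ)..t, U s ξ := by
    intro t ht
    filter_upwards [heq t ht, e0, eg2, eG2] with ξ h1 h2 h3 h4
    rw [h1, h2, intervalIntegral.integral_of_le ht.1, intervalIntegral.integral_of_le ht.1]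
    congr 1
    refine integral_congr_ae ?_
    filter_upwards [ae_restrict_of_ae_restrict_of_subset (hsub ht) h3,
      ae_restrict_of_ae_restrict_of_subset (hsub ht) h4] with s h5 h6
    simp only [hU]
    rw [h5, h6]
  -- A jointly measurable version of the right side of the integral equation, needed so that the set
  -- where the equation holds is measurable.
  set R : ℝ → Space → Val := fun t ξ => g₀' ξ + ∫ s, (Ioc 0 t).indicator (fun s => U s ξ) s with hR
  have mR : Measurable (Function.uncurry R) := by
    refine (mg₀'.comp measurable_snd).add (StronglyMeasurable.measurable
      (StronglyMeasurable.integral_prod_right (f := fun (q : ℝ × Space) (s : ℝ) =>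
        (Ioc 0 q.1).indicator (fun s => U s q.2) s) ?_))
    have hset : MeasurableSet {w : (ℝ × Space) × ℝ | w.2 ∈ Ioc 0 w.1.1} :=
      (measurableSet_lt measurable_const measurable_snd).inter
        (measurableSet_le measurable_snd (measurable_fst.comp measurable_fst))
    have : (Function.uncurry fun (q : ℝ × Space) (s : ℝ) =>
        (Ioc 0 q.1).indicator (fun s => U s q.2) s) =
        {w : (ℝ × Space) × ℝ | w.2 ∈ Ioc 0 w.1.1}.indicator fun w => U w.2 w.1.2 := by
      ext1 w
      simp [Function.uncurry, indicator]
    rw [this]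
    exact (Measurable.indicator (mU.comp
      (measurable_snd.prodMk (measurable_snd.comp measurable_fst))) hset).stronglyMeasurable
  have hRint : ∀ t, 0 ≤ t → ∀ ξ, R t ξ = g₀' ξ + ∫ s in (0 : ℝ)..t, U s ξ := by
    intro t ht ξ
    rw [intervalIntegral.integral_of_le ht, ← integral_indicator measurableSet_Ioc]
  have hgR : ∀ᵐ ξ : Space, ∀ᵐ s ∂volume.restrict I, g' (s, ξ) = R s ξ := by
    refine (Measure.ae_ae_comm (p := fun s ξ => g' (s, ξ) = R s ξ)
      (measurableSet_eq_fun mg' mR)).1 ?_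
    have eg1 := Measure.ae_ae_of_ae_prod eg
    filter_upwards [eg1, ae_restrict_mem hIm] with s hs hsI
    filter_upwards [hs, heq' s hsI] with ξ h1 h2
    rw [hRint s hsI.1, ← h2, ← h1]
  have hwG' : ∀ᵐ ξ : Space, ∀ᵐ s ∂volume.restrict I, IsWave F (angFreq ξ) (G' (s, ξ)) := by
    refine (Measure.ae_ae_comm (p := fun s ξ => IsWave F (angFreq ξ) (G' (s, ξ)))
      (measurableSet_isWave (measurable_angFreq.comp measurable_snd) mG')).1 ?_
    filter_upwards [eG1, hwG] with s h1 h2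
    filter_upwards [h1, h2] with ξ h3 h4
    rwa [← h3]
  intro t ht
  filter_upwards [heq' t ht, hgR, hwG', hw₀, e0, hgloc.ae_integrableOn ht, hGloc.ae_integrableOn ht,
    Measure.ae_ne volume (0 : Space)] with ξ h1 h2 h3 h4 h5 h6 h7 h8
  have hω : angFreq ξ ≠ 0 := by
    rw [angFreq]
    exact smul_ne_zero (by positivity) h8
  rw [h1]
  refine duhamel_flow hF ht.1 hω (by rwa [← h5]) (h6.mono_set Ioc_subset_Icc_self)
    (h7.mono_set Ioc_subset_Icc_self) (ae_restrict_of_ae_restrict_of_subset (hsub ht) h3) ?_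
  filter_upwards [ae_restrict_of_ae_restrict_of_subset (hsub ht) h2,
    ae_restrict_mem measurableSet_Ioc] with s h9 h10
  rw [h9, hRint s h10.1.le]

/-! ### Superposition of block evolutions -/

lemma measurable_blockEvol (F ν ε : ℝ) {k : ℝ → Space → Val} (hk : Measurable (Function.uncurry k)) :
    Measurable fun q : (ℝ × ℝ) × Space => blockEvol F ν ε (k q.1.2) q.1.1 q.2 := by
  simp only [blockEvol, Real.fourierInv_eq']
  refine StronglyMeasurable.measurable (StronglyMeasurable.integral_prod_right
    (f := fun (q : (ℝ × ℝ) × Space) (ξ : Space) =>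
      Complex.exp (((2 * Real.pi * inner ℝ ξ q.2 : ℝ) : ℂ) * Complex.I) •
        flow F ν ε q.1.1 (angFreq ξ) (k q.1.2 ξ)) (Measurable.stronglyMeasurable ?_))
  have h1 : Measurable fun w : ((ℝ × ℝ) × Space) × Space => k w.1.1.2 w.2 :=
    hk.comp (f := fun w : ((ℝ × ℝ) × Space) × Space => (w.1.1.2, w.2)) (by fun_prop)
  have h2 : Measurable fun w : ((ℝ × ℝ) × Space) × Space =>
      flow F ν ε w.1.1.1 (angFreq w.2) (k w.1.1.2 w.2) :=
    (measurable_flow F ν ε).comp (f := fun w : ((ℝ × ℝ) × Space) × Space =>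
      (w.1.1.1, angFreq w.2, k w.1.1.2 w.2))
      ((by fun_prop : Measurable fun w : ((ℝ × ℝ) × Space) × Space => w.1.1.1).prodMk
        ((measurable_angFreq.comp measurable_snd).prodMk h1))
  have h3 : Measurable fun w : ((ℝ × ℝ) × Space) × Space =>
      Complex.exp (((2 * Real.pi * inner ℝ w.2 w.1.2 : ℝ) : ℂ) * Complex.I) := by fun_prop
  exact h3.smul h2

lemma eLpNorm_top_eq_iSup {w : Space → Val} (hw : Continuous w) :
    eLpNorm w ∞ volume = ⨆ n, ‖w (TopologicalSpace.denseSeq Space n)‖ₑ := by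
  rw [iSup_denseSeq hw.enorm]
  refine le_antisymm ?_ (iSup_le fun x => enorm_le_eLpNorm_top_of_continuous hw x)
  rw [eLpNorm_exponent_top]
  exact eLpNormEssSup_le_of_ae_enorm_bound (ae_of_all _ fun x => le_iSup (fun x => ‖w x‖ₑ) x)

lemma continuous_blockEvol {F ν ε t : ℝ} (hF : 0 < F) (hν : 0 ≤ ν) (ht : 0 ≤ t) {j : ℤ}
    {k : Space → Val} (hkm : Measurable k) (hki : Integrable k) (hk : IsBand j k) :
    Continuous (blockEvol F ν ε k t) :=
  continuous_fourierInv (integrable_flow hF hν ht hkm hki hk)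

/-- The `L^r` norm of a block evolution, extended by zero to negative times. -/
def blockNorm (F ν ε : ℝ) (r : ℝ≥0∞) (k : ℝ → Space → Val) (t s : ℝ) : ℝ≥0∞ :=
  if 0 ≤ t then eLpNorm (blockEvol F ν ε (k s) t) r volume else 0

lemma measurable_blockNorm {F ν ε : ℝ} (hF : 0 < F) (hν : 0 ≤ ν) {r : ℝ≥0∞} (hr : r ≠ 0) {j : ℤ}
    {k : ℝ → Space → Val} (hkm : Measurable (Function.uncurry k)) (hki : ∀ s, Integrable (k s))
    (hk : ∀ s, IsBand j (k s)) :
    Measurable (Function.uncurry (blockNorm F ν ε r k)) := by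
  have hm := measurable_blockEvol F ν ε hkm
  have hkm' : ∀ s, Measurable (k s) := fun s => hkm.comp measurable_prodMk_left
  have hset : MeasurableSet {q : ℝ × ℝ | 0 ≤ q.1} := measurableSet_le measurable_const measurable_fst
  by_cases htop : r = ∞
  · have : Function.uncurry (blockNorm F ν ε r k) = fun q : ℝ × ℝ => if 0 ≤ q.1 then
        ⨆ n, ‖blockEvol F ν ε (k q.2) q.1 (TopologicalSpace.denseSeq Space n)‖ₑ else 0 := by
      ext1 q
      simp only [Function.uncurry, blockNorm]
      split_ifs with h
      · rw [htop, eLpNorm_top_eq_iSup (continuous_blockEvol hF hν h (hkm' _) (hki _) (hk _))]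
      · rfl
    rw [this]
    refine Measurable.ite hset (Measurable.iSup fun n => ?_) measurable_const
    exact (hm.comp (measurable_id.prodMk measurable_const)).enorm
  · simp only [Function.uncurry_def, blockNorm, eLpNorm_eq_lintegral_rpow_enorm_toReal hr htop]
    refine Measurable.ite hset (Measurable.pow_const ?_ _) measurable_const
    exact Measurable.lintegral_prod_right' (f := fun q : (ℝ × ℝ) × Space =>
      ‖blockEvol F ν ε (k q.1.2) q.1.1 q.2‖ₑ ^ r.toReal) (hm.enorm.pow_const _)

lemma fourierInv_integral_eq {μ : Measure ℝ} [SFinite μ] {h : ℝ → Space → Val}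
    (hh : Integrable (Function.uncurry h) (μ.prod volume)) (x : Space) :
    𝓕⁻ (fun ξ => ∫ s, h s ξ ∂μ) x = ∫ s, 𝓕⁻ (h s) x ∂μ := by
  simp only [Real.fourierInv_eq']
  have hi : Integrable (Function.uncurry fun (s : ℝ) (ξ : Space) =>
      Complex.exp (((2 * Real.pi * inner ℝ ξ x : ℝ) : ℂ) * Complex.I) • h s ξ)
      (μ.prod volume) := by
    refine hh.norm.mono' ?_ (ae_of_all _ fun p => ?_)
    · have : Measurable fun p : ℝ × Space =>
        Complex.exp (((2 * Real.pi * inner ℝ p.2 x : ℝ) : ℂ) * Complex.I) := by fun_prop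
      exact this.aestronglyMeasurable.smul hh.aestronglyMeasurable
    · simp only [Function.uncurry, norm_smul, Complex.norm_exp_ofReal_mul_I, one_mul, le_refl]
  rw [integral_integral_swap hi]
  refine integral_congr_ae (ae_of_all _ fun ξ => ?_)
  exact (integral_smul _ _).symm

/-- The inverse Fourier transform commutes with the Duhamel integral, by integrability on time times
frequency, and the L^r norm passes under the time integral by Minkowski's inequality. -/
lemma eLpNorm_fourierInv_duhamel_le {F ν ε t : ℝ} (hF : 0 < F) (hν : 0 ≤ ν) (ht : 0 ≤ t)
    {r : ℝ≥0∞} (hr : 1 ≤ r) {j : ℤ} {k₀ : Space → Val} (hk₀m : Measurable k₀)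
    (hk₀i : Integrable k₀) (hk₀ : IsBand j k₀) {k : ℝ → Space → Val}
    (hkm : Measurable (Function.uncurry k)) (hki : ∀ s, Integrable (k s)) (hk : ∀ s, IsBand j (k s))
    (hkp : Integrable (Function.uncurry k) ((volume.restrict (Ioc 0 t)).prod volume))
    {w : Space → Val} (hw : ∀ᵐ ξ : Space, w ξ = flow F ν ε t (angFreq ξ) (k₀ ξ) +
      ∫ s in (0 : ℝ)..t, flow F ν ε (t - s) (angFreq ξ) (k s ξ)) :
    eLpNorm (𝓕⁻ w) r volume ≤ eLpNorm (blockEvol F ν ε k₀ t) r volume +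
      ∫⁻ s in Ioc 0 t, blockNorm F ν ε r k (t - s) s := by
  have hkm' : ∀ s, Measurable (k s) := fun s => hkm.comp measurable_prodMk_left
  set μ := volume.restrict (Ioc (0 : ℝ) t) with hμ
  set h : ℝ → Space → Val := fun s ξ => flow F ν ε (t - s) (angFreq ξ) (k s ξ) with hh
  have hfl : Measurable (Function.uncurry h) :=
    (measurable_flow F ν ε).comp (f := fun w : ℝ × Space => (t - w.1, angFreq w.2, k w.1 w.2))
      ((by fun_prop : Measurable fun w : ℝ × Space => t - w.1).prodMk
        ((measurable_angFreq.comp measurable_snd).prodMk hkm))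
  have hmem : ∀ᵐ s ∂μ, s ∈ Ioc 0 t := ae_restrict_mem measurableSet_Ioc
  have hhi : Integrable (Function.uncurry h) (μ.prod volume) := by
    refine (hkp.norm.const_mul (4 * flowConst F)).mono' hfl.aestronglyMeasurable ?_
    filter_upwards [Measure.quasiMeasurePreserving_fst.ae hmem] with p hp
    have hts : 0 ≤ t - p.1 := by linarith [hp.2]
    refine (norm_flow_band_le hF hν hts (hk p.1) p.2).trans ?_
    have hC := flowConst_pos hF
    refine mul_le_mul_of_nonneg_right ?_ (norm_nonneg _)
    refine mul_le_of_le_one_right (by positivity) (Real.exp_le_one_iff.2 ?_)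
    have : 0 ≤ ν * 4 ^ j * (t - p.1) / 8 := by positivity
    linarith
  have hw1 := integrable_flow (ε := ε) hF hν ht hk₀m hk₀i hk₀
  have hw2 : Integrable (fun ξ => ∫ s, h s ξ ∂μ) := hhi.integral_prod_right
  have e1 : 𝓕⁻ w = blockEvol F ν ε k₀ t + 𝓕⁻ fun ξ => ∫ s, h s ξ ∂μ := by
    ext1 x
    have hch : ∀ v : Space → Val, Integrable v → Integrable fun ξ : Space =>
        Complex.exp (((2 * Real.pi * inner ℝ ξ x : ℝ) : ℂ) * Complex.I) • v ξ := by
      intro v hv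
      refine hv.norm.mono' ?_ (ae_of_all _ fun ξ => ?_)
      · have : Measurable fun ξ : Space =>
          Complex.exp (((2 * Real.pi * inner ℝ ξ x : ℝ) : ℂ) * Complex.I) := by fun_prop
        exact this.aestronglyMeasurable.smul hv.aestronglyMeasurable
      · rw [norm_smul, Complex.norm_exp_ofReal_mul_I, one_mul]
    rw [Pi.add_apply, blockEvol, Real.fourierInv_eq', Real.fourierInv_eq', Real.fourierInv_eq',
      ← integral_add (hch _ hw1) (hch _ hw2)]
    refine integral_congr_ae ?_
    filter_upwards [hw] with ξ hξ
    rw [hξ, smul_add, intervalIntegral.integral_of_le ht]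
  rw [e1]
  refine (eLpNorm_add_le (continuous_blockEvol hF hν ht hk₀m hk₀i hk₀).aestronglyMeasurable
    (continuous_fourierInv hw2).aestronglyMeasurable hr).trans ?_
  refine add_le_add le_rfl ?_
  have hEm : Measurable (Function.uncurry fun s x => blockEvol F ν ε (k s) (t - s) x) :=
    (measurable_blockEvol F ν ε hkm).comp (f := fun q : ℝ × Space => ((t - q.1, q.1), q.2))
      (by fun_prop)
  refine (eLpNorm_le_lintegral_eLpNorm (μ := μ) hEm ?_ (fun x => ?_) hr).trans_eq ?_
  · filter_upwards [hmem] with s hs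
    exact continuous_blockEvol hF hν (by linarith [hs.2]) (hkm' s) (hki s) (hk s)
  · rw [fourierInv_integral_eq hhi]
    exact enorm_integral_le_lintegral_enorm _
  · refine lintegral_congr_ae ?_
    filter_upwards [hmem] with s hs
    rw [blockNorm, if_pos (by linarith [hs.2])]

/-- By Minkowski's inequality in time, the forcing at each instant s costs the same as initial data
k s evolved from time s, so the homogeneous constant Λ serves for both terms. -/
theorem lintegral_duhamel_le {F ν ε p : ℝ} (hF : 0 < F) (hν : 0 ≤ ν) (hp : 1 ≤ p) {T : ℝ≥0∞}
    {r : ℝ≥0∞} (hr : 1 ≤ r) {j : ℤ} {Λ : ℝ≥0∞}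
    (hΛ : ∀ k : Space → Val, Measurable k → Integrable k → IsBand j k →
      (∫⁻ t in Ici 0, eLpNorm (blockEvol F ν ε k t) r volume ^ p) ^ (1 / p) ≤
        Λ * eLpNorm k 2 volume)
    {k₀ : Space → Val} (hk₀m : Measurable k₀)
    (hk₀i : Integrable k₀) (hk₀ : IsBand j k₀) {k : ℝ → Space → Val}
    (hkm : Measurable (Function.uncurry k)) (hki : ∀ s, Integrable (k s)) (hk : ∀ s, IsBand j (k s))
    (hkp : ∀ t ∈ timeInterval T,
      Integrable (Function.uncurry k) ((volume.restrict (Ioc 0 t)).prod volume))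
    {w : ℝ → Space → Val} (hw : ∀ t ∈ timeInterval T, ∀ᵐ ξ : Space,
      w t ξ = flow F ν ε t (angFreq ξ) (k₀ ξ) +
        ∫ s in (0 : ℝ)..t, flow F ν ε (t - s) (angFreq ξ) (k s ξ)) :
    (∫⁻ t in timeInterval T, eLpNorm (𝓕⁻ (w t)) r volume ^ p) ^ (1 / p) ≤
      Λ * (eLpNorm k₀ 2 volume + ∫⁻ s in timeInterval T, eLpNorm (k s) 2 volume) := by
  have hp0 : 0 < p := by linarith
  have hr0 : r ≠ 0 := (zero_lt_one.trans_le hr).ne'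
  have hkm' : ∀ s, Measurable (k s) := fun s => hkm.comp measurable_prodMk_left
  have hIm := measurableSet_timeInterval T
  set I := timeInterval T with hI
  have hsub : I ⊆ Ici 0 := fun t ht => ht.1
  have hbm := measurable_blockNorm (ε := ε) hF hν hr0 hkm hki hk
  have hbm₀ : Measurable fun t => blockNorm F ν ε r (fun _ => k₀) t 0 :=
    (measurable_blockNorm (ε := ε) (k := fun _ => k₀) hF hν hr0 (hk₀m.comp measurable_snd)
      (fun _ => hk₀i) (fun _ => hk₀)).comp (f := fun t : ℝ => (t, (0 : ℝ))) (by fun_prop)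
  have hfm : Measurable (Function.uncurry fun t s => blockNorm F ν ε r k (t - s) s) :=
    hbm.comp (f := fun q : ℝ × ℝ => (q.1 - q.2, q.2)) (by fun_prop)
  have hfm' : Measurable fun t => ∫⁻ s in I, blockNorm F ν ε r k (t - s) s :=
    Measurable.lintegral_prod_right' hfm
  have h1 : ∫⁻ t in I, eLpNorm (𝓕⁻ (w t)) r volume ^ p ≤
      ∫⁻ t in I, ((fun t => blockNorm F ν ε r (fun _ => k₀) t 0) +
        fun t => ∫⁻ s in I, blockNorm F ν ε r k (t - s) s) t ^ p := by
    refine setLIntegral_mono' hIm fun t ht => ENNReal.rpow_le_rpow ?_ hp0.le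
    refine (eLpNorm_fourierInv_duhamel_le hF hν ht.1 hr hk₀m hk₀i hk₀ hkm hki hk (hkp t ht)
      (hw t ht)).trans ?_
    rw [Pi.add_apply]
    refine add_le_add ?_ (lintegral_mono_set
      (Ioc_subset_Icc_self.trans (Icc_subset_timeInterval ht)))
    rw [blockNorm, if_pos ht.1]
  refine (ENNReal.rpow_le_rpow h1 (by positivity)).trans ?_
  refine (ENNReal.lintegral_Lp_add_le hbm₀.aemeasurable hfm'.aemeasurable hp).trans ?_
  rw [mul_add]
  refine add_le_add ?_ ?_
  · refine le_trans (ENNReal.rpow_le_rpow ?_ (by positivity)) (hΛ k₀ hk₀m hk₀i hk₀)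
    refine (lintegral_mono_set hsub).trans (setLIntegral_mono' measurableSet_Ici fun t ht => ?_)
    rw [blockNorm, if_pos (mem_Ici.1 ht)]
  · refine (lintegral_rpow_lintegral_le hfm hp).trans ?_
    have hmono : ∀ s, (∫⁻ t in I, blockNorm F ν ε r k (t - s) s ^ p) ^ (1 / p) ≤
        Λ * eLpNorm (k s) 2 volume := by
      intro s
      refine le_trans (ENNReal.rpow_le_rpow ?_ (by positivity)) (hΛ (k s) (hkm' s) (hki s) (hk s))
      -- Because the block norm is zero at negative times, the integral may be extended to all of ℝ,
      -- where translation by s is free and encodes causality.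
      refine (setLIntegral_le_lintegral _ _).trans ?_
      rw [lintegral_sub_right_eq_self (fun t => blockNorm F ν ε r k t s ^ p) s,
        ← lintegral_indicator measurableSet_Ici]
      refine lintegral_mono fun t => ?_
      simp only [blockNorm, indicator, mem_Ici]
      split_ifs
      · exact le_rfl
      · rw [ENNReal.zero_rpow_of_pos hp0]
    refine (lintegral_mono hmono).trans_eq ?_
    rw [lintegral_const_mul]
    have hE : Measurable (Function.uncurry fun s ξ => ‖k s ξ‖ₑ ^ (2 : ℝ)) := hkm.enorm.pow_const _
    simp only [eLpNorm_eq_lintegral_rpow_enorm_toReal two_ne_zero ENNReal.ofNat_ne_top,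
      ENNReal.toReal_ofNat]
    exact (Measurable.lintegral_prod_right' hE).pow_const _

/-! ### Dyadic blocks of a solution -/

lemma flow_smul (F ν ε t : ℝ) (ω : Space) (c : ℂ) (z : Val) :
    flow F ν ε t ω (c • z) = c • flow F ν ε t ω z := by
  simp only [flow, coriolis, applyMat_smul]
  module

/-- The dyadic block of a family of Fourier densities, set to zero where it is not integrable. -/
def blockFamily (m : Space → ℝ) (G : ℝ → Space → Val) (s : ℝ) (ξ : Space) : Val :=
  open Classical in
  if ∫⁻ η, ‖(m η : ℂ) • G s η‖ₑ < ∞ then (m ξ : ℂ) • G s ξ else 0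

section blockFamily

variable {m : Space → ℝ} {G : ℝ → Space → Val}

lemma measurable_smul_family (hm : Measurable m) (hG : Measurable (Function.uncurry G)) :
    Measurable fun q : ℝ × Space => (m q.2 : ℂ) • G q.1 q.2 :=
  (Complex.measurable_ofReal.comp (hm.comp measurable_snd)).smul hG

lemma measurable_blockFamily (hm : Measurable m) (hG : Measurable (Function.uncurry G)) :
    Measurable (Function.uncurry (blockFamily m G)) := by
  classical
  have h1 := measurable_smul_family hm hG
  have h2 : Measurable fun s => ∫⁻ η, ‖(m η : ℂ) • G s η‖ₑ :=
    Measurable.lintegral_prod_right' (f := fun q : ℝ × Space => ‖(m q.2 : ℂ) • G q.1 q.2‖ₑ) h1.enorm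
  exact Measurable.ite ((h2.comp measurable_fst) measurableSet_Iio) h1 measurable_const

lemma integrable_blockFamily (hm : Measurable m) (hG : Measurable (Function.uncurry G)) (s : ℝ) :
    Integrable (blockFamily m G s) := by
  classical
  unfold blockFamily
  by_cases h : ∫⁻ η, ‖(m η : ℂ) • G s η‖ₑ < ∞
  · simp only [if_pos h]
    exact ⟨((measurable_smul_family hm hG).comp measurable_prodMk_left).aestronglyMeasurable, h⟩
  · simp only [if_neg h]
    exact integrable_zero _ _ _

lemma blockFamily_eq {s : ℝ} (h : Integrable fun ξ => (m ξ : ℂ) • G s ξ) (ξ : Space) :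
    blockFamily m G s ξ = (m ξ : ℂ) • G s ξ := by
  classical
  have h2 : ∫⁻ η, ‖(m η : ℂ) • G s η‖ₑ < ∞ := h.2
  rw [blockFamily, if_pos h2]

lemma norm_blockFamily_le (s : ℝ) (ξ : Space) :
    ‖blockFamily m G s ξ‖ ≤ ‖(m ξ : ℂ) • G s ξ‖ := by
  classical
  rw [blockFamily]
  split_ifs
  · exact le_rfl
  · simp

end blockFamily

lemma isBand_blockSymbol_smul {ψ : Space → ℝ} (hψ : IsLPCutoff ψ) (d : ℝ) (j : ℤ)
    (h : Space → Val) : IsBand j fun ξ => (blockSymbol ψ d j ξ : ℂ) • h ξ := by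
  intro ξ hξ
  apply norm_mem_of_lpPhi_dyadic_ne_zero hψ
  intro h0
  apply hξ
  change (blockSymbol ψ d j ξ : ℂ) • h ξ = 0
  rw [blockSymbol, h0, zero_mul, Complex.ofReal_zero, zero_smul]

lemma isBand_blockFamily {ψ : Space → ℝ} (hψ : IsLPCutoff ψ) (d : ℝ) (j : ℤ)
    (G : ℝ → Space → Val) (s : ℝ) : IsBand j (blockFamily (blockSymbol ψ d j) G s) := by
  intro ξ hξ
  refine isBand_blockSymbol_smul hψ d j (G s) ξ fun h0 => hξ ?_
  have := norm_blockFamily_le (m := blockSymbol ψ d j) (G := G) s ξ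
  rw [show (blockSymbol ψ d j ξ : ℂ) • G s ξ = 0 from h0, norm_zero] at this
  exact norm_le_zero_iff.1 this

lemma IsBandMultiplier.integrable_prod {m : Space → ℂ} (hm : IsBandMultiplier m) {T : ℝ≥0∞}
    {G : ℝ → Space → Val} (hG : LocIntegrable T G) {t : ℝ} (ht : t ∈ timeInterval T) :
    Integrable (fun q : ℝ × Space => m q.2 • G q.1 q.2)
      ((volume.restrict (Ioc 0 t)).prod volume) := by
  obtain ⟨C, hC⟩ := hm.smooth.continuous.bounded_above_of_compact_support hm.compact
  have h1 : IntegrableOn (Function.uncurry G) (Ioc 0 t ×ˢ tsupport m) (volume.prod volume) :=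
    (hG t ht _ hm.compact hm.zero_notMem).mono_set (prod_mono Ioc_subset_Icc_self le_rfl)
  have h2 : IntegrableOn (fun q : ℝ × Space => m q.2 • G q.1 q.2) (Ioc 0 t ×ˢ tsupport m)
      (volume.prod volume) :=
    h1.bdd_smul C (hm.smooth.continuous.comp continuous_snd).aestronglyMeasurable
      (ae_of_all _ fun q => hC q.2)
  have h3 : IntegrableOn (fun q : ℝ × Space => m q.2 • G q.1 q.2) (Ioc 0 t ×ˢ univ)
      (volume.prod volume) := by
    refine h2.of_forall_sdiff_eq_zero (measurableSet_Ioc.prod MeasurableSet.univ) fun q hq => ?_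
    have : q.2 ∉ tsupport m := fun h => hq.2 ⟨hq.1.1, h⟩
    rw [image_eq_zero_of_notMem_tsupport this, zero_smul]
  rwa [IntegrableOn, ← Measure.prod_restrict, Measure.restrict_univ] at h3

/-- From exp(x) ≥ 1 + x and log 2 ≤ 1 the denominator on the right is at most v/2, while the
numerator is at least 1. This fits the loss 2/(1 - 2/r - 8δ) of a block into the geometric factor of
`strichartzConst`. -/
lemma two_div_le_geometric {v : ℝ} (hv : 0 < v) :
    2 / v ≤ (2 : ℝ) ^ (1 / 2 * v) / (1 - (2 : ℝ) ^ (-(1 / 2 * v))) := by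
  have h1 : (2 : ℝ) ^ (-(1 / 2 * v)) < 1 :=
    Real.rpow_lt_one_of_one_lt_of_neg (by norm_num) (by linarith)
  have h2 : 1 ≤ (2 : ℝ) ^ (1 / 2 * v) := Real.one_le_rpow (by norm_num) (by positivity)
  have h3 : 1 - (2 : ℝ) ^ (-(1 / 2 * v)) ≤ v / 2 := by
    rw [Real.rpow_def_of_pos (by norm_num)]
    have := Real.add_one_le_exp (Real.log 2 * (-(1 / 2 * v)))
    have hl : Real.log 2 ≤ 1 := by linarith [Real.log_two_lt_d9]
    nlinarith
  rw [div_le_div_iff₀ hv (by linarith)]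
  nlinarith

end PrimitiveStrichartz

end

/-! ### Assembling the blocks -/

open PrimitiveStrichartz in
theorem mainTheorem5 (ψ : Space → ℝ) (hψ : IsLPCutoff ψ) (F : ℝ) (hF : 0 < F) (hF1 : F ≠ 1) :
    ∃ C_F : ℝ, 0 < C_F ∧
      ∀ (d : ℝ) (r q : ℝ≥0∞) (θ p ν ε : ℝ) (T : ℝ≥0∞)
        (f₀ : 𝓢'(Space, Val)) (Fext f : ℝ → 𝓢'(Space, Val)),
        4 < r → 1 ≤ q →
        0 < θ → θ < (1 / 2 - (r⁻¹).toReal) / (1 - 4 * (r⁻¹).toReal) → θ ≤ 1 →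
        1 ≤ p → p ≤ 4 / (θ * (1 - 4 * (r⁻¹).toReal)) →
        0 < ν → 0 < ε →
        IsDivFree f₀ → HasZeroPotentialVorticity F f₀ →
        (∀ᵐ t ∂volume.restrict (timeInterval T),
          IsDivFree (Fext t) ∧ HasZeroPotentialVorticity F (Fext t)) →
        IsSolution F ν ν ε T f₀ Fext f →
        tildeBesovNormAbsD ψ T d p 0 r q f ≤
          ENNReal.ofReal (C_F * max (lpInner ^ d) (lpOuter ^ d) * strichartzConst p θ r /
              ν ^ (1 / p - dispExponent θ r) * ε ^ dispExponent θ r) *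
            (besovNorm ψ (regIndex d p θ r) 2 q f₀ +
              ∫⁻ t in timeInterval T, besovNorm ψ (regIndex d p θ r) 2 q (Fext t)) := by
  obtain ⟨C, hC, H⟩ := exists_lintegral_blockEvol_le hψ hF hF1
  refine ⟨C, hC, fun d r q θ p ν ε T f₀ Fext f hr hq hθ hθ1 _ hp hpθ hν hε hdiv hpv hext hsol => ?_⟩
  obtain ⟨g₀, g, G, hg₀, hg, hG, hInt, heq⟩ := hsol
  have hp0 : 0 < p := by linarith
  -- exponents
  set ρ := (r⁻¹).toReal with hρ
  have hρ4 : 4 * ρ < 1 := by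
    have h1 : r⁻¹ < 4⁻¹ := ENNReal.inv_lt_inv.2 hr
    have h2 : ρ < ((4 : ℝ≥0∞)⁻¹).toReal := ENNReal.toReal_strict_mono (by simp) h1
    rw [ENNReal.toReal_inv] at h2
    norm_num at h2
    linarith
  have hr1 : 1 ≤ r := le_trans (by norm_num) hr.le
  set δ := dispExponent θ r with hδ
  have hδe : δ = θ / 4 * (1 - 4 * ρ) := rfl
  have hδ0 : 0 < δ := by rw [hδe]; exact mul_pos (by positivity) (by linarith)
  have hv : vertExponent θ r = 1 - 2 * ρ - 8 * δ := by
    rw [vertExponent, hδe, ← hρ]; ring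
  -- The upper bound on θ in multiplied form; it supplies the condition P > 8 of the block estimate.
  have hv0 : 0 < vertExponent θ r := by
    rw [lt_div_iff₀ (by linarith)] at hθ1
    rw [hv, hδe]; linarith
  have hδp : δ ≤ 1 / p := by
    rw [hδe, le_div_iff₀ hp0]
    rw [le_div_iff₀ (mul_pos hθ (by linarith))] at hpθ
    linarith
  set β := 1 / p - δ with hβ
  have hβ0 : 0 ≤ β := by linarith
  have hreg : regIndex d p θ r = d + (3 / 2 * (1 - 2 * ρ) - 2 * β) := by
    rw [regIndex, hβ, hδe, ← hρ]; ring
  set A : ℝ := C * (2 / lpInner ^ 2 * β) ^ β / ν ^ β * (ε ^ δ * (2 / (1 - 2 * ρ - 8 * δ))) with hA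
  set M : ℝ := max (lpInner ^ d) (lpOuter ^ d) with hM
  have hl : 0 ≤ 2 / lpInner ^ 2 * β := by rw [lpInner]; positivity
  have hA0 : 0 ≤ A := by
    rw [hv] at hv0
    rw [hA]; positivity
  have hM0 : 0 ≤ M := le_trans (by rw [lpInner]; positivity) (le_max_left _ _)
  have hconst : A * M ≤ C * M * strichartzConst p θ r / ν ^ β * ε ^ δ := by
    rw [strichartzConst, ← hδ, ← hβ, hA, ← hv]
    have h1 := two_div_le_geometric hv0
    calc _ = C * M * (2 / lpInner ^ 2 * β) ^ β / ν ^ β * ε ^ δ * (2 / vertExponent θ r) := by ring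
      _ ≤ C * M * (2 / lpInner ^ 2 * β) ^ β / ν ^ β * ε ^ δ * _ :=
        mul_le_mul_of_nonneg_left h1 (by positivity)
      _ = _ := by ring
  -- the Fourier side of the system
  have hgl : LocIntegrable T g := fun t ht K hK h0 => (hInt t ht K hK h0).1
  have hGl : LocIntegrable T G := fun t ht K hK h0 => (hInt t ht K hK h0).2
  have hg₀m : AEStronglyMeasurable g₀ volume := by
    have := hg₀.1.aestronglyMeasurable
    rwa [restrict_compl_zero] at this
  have hwG : ∀ᵐ s ∂volume.restrict (timeInterval T),
      ∀ᵐ ξ : Space, IsWave F (angFreq ξ) (G s ξ) := by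
    filter_upwards [hG, hext] with s h1 h2
    exact ae_isWave h1 h2.1 h2.2
  obtain ⟨g₀', G', mg₀', mG', e0, eG, hGl', hduh⟩ :=
    exists_measurable_duhamel hF hg₀m hgl hGl (ae_isWave hg₀ hdiv hpv) hwG heq
  have hbm := isBandMultiplier_blockSymbol hψ d
  have hms : ∀ j, Measurable (blockSymbol ψ d j) := fun j => by
    have := Complex.measurable_re.comp (hbm j).smooth.continuous.measurable
    simpa [Function.comp_def] using this
  set k₀ : ℤ → Space → Val := fun j ξ => (blockSymbol ψ d j ξ : ℂ) • g₀' ξ with hk₀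
  -- The forcing blocks are set to zero at exceptional times, so that integrability and band support
  -- hold at every time; almost every time is unaffected.
  set k : ℤ → ℝ → Space → Val := fun j => blockFamily (blockSymbol ψ d j) G' with hk
  have e0' : ∀ j, k₀ j =ᵐ[volume] fun ξ => (blockSymbol ψ d j ξ : ℂ) • g₀ ξ := fun j => by
    filter_upwards [e0] with ξ h
    simp only [hk₀, h]
  have mk₀ : ∀ j, Measurable (k₀ j) := fun j =>
    (Complex.measurable_ofReal.comp (hms j)).smul mg₀'
  have ik₀ : ∀ j, Integrable (k₀ j) := fun j =>
    ((hbm j).integrable_smul hg₀.1).congr (e0' j).symm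
  have mk : ∀ j, Measurable (Function.uncurry (k j)) := fun j => measurable_blockFamily (hms j) mG'
  have hGs : ∀ᵐ s ∂volume.restrict (timeInterval T), ∀ j,
      (Integrable fun ξ => (blockSymbol ψ d j ξ : ℂ) • G' s ξ) ∧
        k j s =ᵐ[volume] fun ξ => (blockSymbol ψ d j ξ : ℂ) • G s ξ := by
    filter_upwards [hG, eG] with s h1 h2 j
    have h3 : (fun ξ => (blockSymbol ψ d j ξ : ℂ) • G' s ξ) =ᵐ[volume]
        fun ξ => (blockSymbol ψ d j ξ : ℂ) • G s ξ := by
      filter_upwards [h2] with ξ h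
      rw [h]
    have h4 := ((hbm j).integrable_smul h1.1).congr h3.symm
    refine ⟨h4, ?_⟩
    filter_upwards [h3] with ξ h
    rw [← h]
    exact blockFamily_eq h4 ξ
  have pk : ∀ j, ∀ t ∈ timeInterval T,
      Integrable (Function.uncurry (k j)) ((volume.restrict (Ioc 0 t)).prod volume) :=
    fun j t ht => ((hbm j).integrable_prod hGl' ht).norm.mono' (mk j).aestronglyMeasurable
      (ae_of_all _ fun w => norm_blockFamily_le w.1 w.2)
  have hw : ∀ j, ∀ t ∈ timeInterval T, ∀ᵐ ξ : Space, (blockSymbol ψ d j ξ : ℂ) • g t ξ =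
      flow F ν ε t (angFreq ξ) (k₀ j ξ) +
        ∫ s in (0 : ℝ)..t, flow F ν ε (t - s) (angFreq ξ) (k j s ξ) := by
    intro j t ht
    filter_upwards [hduh t ht] with ξ h
    rw [h, smul_add, ← flow_smul, ← intervalIntegral.integral_smul]
    congr 1
    rw [intervalIntegral.integral_of_le ht.1, intervalIntegral.integral_of_le ht.1]
    refine integral_congr_ae ?_
    filter_upwards [ae_restrict_of_ae_restrict_of_subset
      (Ioc_subset_Icc_self.trans (Icc_subset_timeInterval ht)) hGs] with s hs
    rw [← flow_smul, hk]
    simp only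
    rw [blockFamily_eq (hs j).1]
  -- the estimate of each block
  set Λ : ℤ → ℝ≥0∞ := fun j =>
    ENNReal.ofReal (A * (2 : ℝ) ^ ((j : ℝ) * (3 / 2 * (1 - 2 * ρ) - 2 * β))) with hΛ
  have hblock : ∀ j : ℤ, (2 : ℝ≥0∞) ^ ((j : ℝ) * 0) *
      (∫⁻ t in timeInterval T, distLpNorm (dyadicBlockAbsD ψ d j (f t)) r ^ p) ^ (1 / p) ≤
      Λ j * eLpNorm (k₀ j) 2 volume +
        ∫⁻ s in timeInterval T, Λ j * eLpNorm (k j s) 2 volume := by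
    intro j
    rw [mul_zero, ENNReal.rpow_zero, one_mul, lintegral_const_mul' _ _ ENNReal.ofReal_ne_top,
      ← mul_add]
    refine le_trans (ENNReal.rpow_le_rpow ?_ (by positivity)) (lintegral_duhamel_le hF hν.le hp hr1
      (fun κ h1 h2 h3 => H r p δ ν ε hr hp hδ0 (by rw [hv] at hv0; linarith) hδp hν hε j κ h1 h2 h3)
      (mk₀ j) (ik₀ j) (isBand_blockSymbol_smul hψ d j g₀') (mk j)
      (integrable_blockFamily (hms j) mG') (isBand_blockFamily hψ d j G') (pk j) (hw j))
    refine setLIntegral_mono' (measurableSet_timeInterval T) fun t ht => ?_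
    exact ENNReal.rpow_le_rpow (distLpNorm_dyadicBlockAbsD_le hψ d j (hg t ht) r) hp0.le
  have htwo : ∀ x : ℝ, (2 : ℝ≥0∞) ^ x = ENNReal.ofReal ((2 : ℝ) ^ x) := fun x => by
    rw [← ENNReal.ofReal_rpow_of_pos (by norm_num)]; norm_num
  -- The factor 2^(jd) from |D|^d and the block exponent (3/2)(1 - 2/r) - 2β add up to σ.
  have hΛle : ∀ (j : ℤ) (N D : ℝ≥0∞),
      N ≤ ENNReal.ofReal ((2 : ℝ) ^ ((j : ℝ) * d) * M) * D →
      Λ j * N ≤ ENNReal.ofReal (A * M) * ((2 : ℝ≥0∞) ^ ((j : ℝ) * regIndex d p θ r) * D) := by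
    intro j N D hND
    refine (mul_le_mul_right hND _).trans_eq ?_
    rw [hΛ, htwo, ← mul_assoc, ← mul_assoc, ← ENNReal.ofReal_mul (by positivity),
      ← ENNReal.ofReal_mul (by positivity), hreg, mul_add, Real.rpow_add (by norm_num)]
    congr 2
    ring
  have hm2 : ∀ j, Measurable fun s => Λ j * eLpNorm (k j s) 2 volume := by
    intro j
    have hE : Measurable (Function.uncurry fun s ξ => ‖k j s ξ‖ₑ ^ (2 : ℝ)) :=
      (mk j).enorm.pow_const _
    simp only [eLpNorm_eq_lintegral_rpow_enorm_toReal two_ne_zero ENNReal.ofNat_ne_top,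
      ENNReal.toReal_ofNat]
    exact ((Measurable.lintegral_prod_right' hE).pow_const _).const_mul _
  calc tildeBesovNormAbsD ψ T d p 0 r q f
      ≤ lqNorm q fun j => Λ j * eLpNorm (k₀ j) 2 volume +
        ∫⁻ s in timeInterval T, Λ j * eLpNorm (k j s) 2 volume := lqNorm_mono hblock
    _ ≤ lqNorm q (fun j => Λ j * eLpNorm (k₀ j) 2 volume) +
        lqNorm q fun j => ∫⁻ s in timeInterval T, Λ j * eLpNorm (k j s) 2 volume :=
      lqNorm_add_le hq _ _
    _ ≤ lqNorm q (fun j => Λ j * eLpNorm (k₀ j) 2 volume) +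
        ∫⁻ s in timeInterval T, lqNorm q fun j => Λ j * eLpNorm (k j s) 2 volume :=
      add_le_add le_rfl (lqNorm_lintegral_le hq hm2)
    _ ≤ ENNReal.ofReal (A * M) * besovNorm ψ (regIndex d p θ r) 2 q f₀ +
        ∫⁻ s in timeInterval T,
          ENNReal.ofReal (A * M) * besovNorm ψ (regIndex d p θ r) 2 q (Fext s) := by
      refine add_le_add ?_ (lintegral_mono_ae ?_)
      · rw [besovNorm, ← lqNorm_const_mul hq]
        refine lqNorm_mono fun j => hΛle j _ _ ?_
        rw [eLpNorm_congr_ae (e0' j)]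
        exact eLpNorm_blockSymbol_le hψ d j hg₀
      · filter_upwards [hGs, hG] with s h1 h2
        rw [besovNorm, ← lqNorm_const_mul hq]
        refine lqNorm_mono fun j => hΛle j _ _ ?_
        rw [eLpNorm_congr_ae (h1 j).2]
        exact eLpNorm_blockSymbol_le hψ d j h2
    _ = ENNReal.ofReal (A * M) * (besovNorm ψ (regIndex d p θ r) 2 q f₀ +
        ∫⁻ s in timeInterval T, besovNorm ψ (regIndex d p θ r) 2 q (Fext s)) := by
      rw [lintegral_const_mul' _ _ ENNReal.ofReal_ne_top, mul_add]
    _ ≤ _ := by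
      gcongr
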